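/- Let $V_0:\mathbb{R}^3\to\mathbb{R}$ be a bounded measurable function with $V_0\le 0$ and $V_0(r)=0$ for $|r|\ge r_V$, for some $r_V$. For a bounded measurable $V$ write $-\Delta+V\ge 0$ if $\int_{\mathbb{R}^3}\bigl(|\nabla f|^2+V|f|^2\bigr)\,dr\ge 0$ for all $f\in C_c^\infty(\mathbb{R}^3;\mathbb{C})$, and say that $V$ is at critical coupling (has a zero-energy resonance) if $-\Delta+V\ge 0$ while $-\Delta+(1+\varepsilon)V\not\ge 0$ for every $\varepsilon>0$. Assume that $V_0$ is at critical coupling. For $R>0$ let $\chi_R$ be the indicator function of $\{|r|\le R\}$ and $\eta_R$ the indicator function of $\{R<|r|\le 2R\}$. Then for every $R>0$ there is $\delta=\delta(R)>0$ such that for every $\lambda>-\delta$ there is exactly one $B=B_R(\lambda)\in\mathbb{R}$ for which $V_0+\lambda\chi_R-B\eta_R$ is at critical coupling; moreover $B_R(\lambda)\ge 0$ for all $\lambda\ge 0$, and $\delta$ can be chosen so that $B_R$ is differentiable at every point of $(-\delta,\delta)$. Furthermore $|B_R'(0)|$ stays bounded as $R\to\infty$: there are constants $C$ and $R_0$, depending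 only on $V_0$, with $|B_R'(0)|\le C$ for all $R\ge R_0$. -/

import Mathlib

open scoped ContDiff

noncomputable section

/-- Three-dimensional Euclidean space. -/
abbrev E3 : Type := EuclideanSpace ℝ (Fin 3)

/-- The quadratic form `⟨f, (-Δ + V) f⟩ = ∫ (|∇f|² + V |f|²)` of the Schrödinger operator `-Δ + V`,
where `|∇f|² = ∑ i, |∂ᵢ f|²`. It is used only for test functions `f` and bounded measurable `V`, for
which the integrand is integrable. -/
def schrodingerForm (V : E3 → ℝ) (f : E3 → ℂ) : ℝ :=
  ∫ x, ((∑ i : Fin 3, ‖fderiv ℝ f x (EuclideanSpace.single i 1)‖ ^ 2) + V x * ‖f x‖ ^ 2)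

/-- `-Δ + V ≥ 0`, tested on smooth compactly supported functions (a core of the operator and of its
form when `V` is bounded). -/
def SchrodingerNonneg (V : E3 → ℝ) : Prop :=
  ∀ f : E3 → ℂ, ContDiff ℝ ∞ f → HasCompactSupport f → 0 ≤ schrodingerForm V f

/-- Critical coupling (zero-energy resonance): `-Δ + V ≥ 0`, but for every `ε > 0` the form of
`-Δ + (1 + ε) V` takes a negative value. -/
def AtCriticalCoupling (V : E3 → ℝ) : Prop :=
  SchrodingerNonneg V ∧ ∀ ε : ℝ, 0 < ε → ¬ SchrodingerNonneg (fun x => (1 + ε) * V x)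

/-- The function `χ_R`, equal to `1` where `|r| ≤ R` and to `0` elsewhere. -/
def chiR (R : ℝ) : E3 → ℝ :=
  Set.indicator {r | ‖r‖ ≤ R} (fun _ => 1)

/-- The function `η_R`, equal to `1` where `R < |r| ≤ 2R` and to `0` elsewhere. -/
def etaR (R : ℝ) : E3 → ℝ :=
  Set.indicator {r | R < ‖r‖ ∧ ‖r‖ ≤ 2 * R} (fun _ => 1)

/-- The perturbed potential `V₀ + l χ_R - b η_R`. -/
def perturbedPotential (V₀ : E3 → ℝ) (R l b : ℝ) : E3 → ℝ :=
  fun r => V₀ r + l * chiR R r - b * etaR R r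

end

/-!
Let `V` be a compactly supported potential with `-Δ + V ≥ 0`. By the Sobolev inequality and
Rellich's theorem, test functions of bounded Dirichlet integral are compact in `L²` of a ball
containing the support of `V`. Hence `V` is at critical coupling iff there is a zero-energy state
`u`: a nonzero limit on that ball of test functions whose energies tend to zero. Such a `u` has a
sign and does not vanish on sets of positive measure, which makes it unique up to a factor.

`B_R(l)` is the largest `b` with `-Δ + V₀ + l χ_R - b η_R ≥ 0`. Testing the form at `(l, B_R(l))` on
the zero-energy state of `(l₀, B_R(l₀))` bounds `B_R(l) - B_R(l₀)` from above by
`(l - l₀) ∫ χ_R u² / ∫ η_R u²`; compactness and uniqueness of `u` give the matching lower bound up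
to `o(l - l₀)`. So `B_R'(l₀)` is this quotient.

For the bound at `l₀ = 0` put `G = -∫ V₀ u`, with `u ≥ 0`. Testing the equation of `u` with
`1 - (1 + u)^(-1/3) ≤ 1` bounds the Dirichlet integral of `(1 + u)^(1/3) - 1` by a multiple of `G`,
because `V₀ ≤ 0`. The Sobolev inequality for this function, applied after scaling `u`, gives
`∫ χ_R u² = O(R G²)`. Testing `-Δ u = -V₀ u` with a cutoff `φ` that is `1` on the support of `V₀`
and has `Δφ` supported in the annulus gives `G = -∫ u Δφ`, so `R G² = O(∫ η_R u²)` by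
Cauchy-Schwarz.
-/

open scoped ContDiff Gradient Laplacian RealInnerProductSpace

open MeasureTheory Filter Topology Module

noncomputable section

namespace CriticalCoupling

/-- Smooth compactly supported real functions, the form core on which all quadratic forms below are
evaluated. A predicate rather than a bundled type, because the arguments constantly compose test
functions with scalar functions. -/
structure IsTestFunction {E : Type*} [NormedAddCommGroup E] [NormedSpace ℝ E] (f : E → ℝ) :
    Prop where
  contDiff : ContDiff ℝ ∞ f
  hasCompactSupport : HasCompactSupport f

/-- Bounded measurable potentials. -/
structure IsPotential {α : Type*} [MeasurableSpace α] (V : α → ℝ) : Prop where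
  measurable : Measurable V
  bdd : ∃ M : ℝ, ∀ x, |V x| ≤ M

section TestFunctions

variable {E : Type*} [NormedAddCommGroup E] [NormedSpace ℝ E] {f g : E → ℝ}

namespace IsTestFunction

lemma continuous (hf : IsTestFunction f) : Continuous f := hf.contDiff.continuous

lemma differentiable (hf : IsTestFunction f) : Differentiable ℝ f :=
  hf.contDiff.differentiable (by simp)

lemma const_mul (hf : IsTestFunction f) (a : ℝ) : IsTestFunction (fun x => a * f x) where
  contDiff := contDiff_const.mul hf.contDiff
  hasCompactSupport := hf.hasCompactSupport.mul_left (f := fun _ => a)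

lemma linComb (hf : IsTestFunction f) (hg : IsTestFunction g) (a b : ℝ) :
    IsTestFunction (fun x => a * f x + b * g x) where
  contDiff := (hf.const_mul a).contDiff.add (hg.const_mul b).contDiff
  hasCompactSupport := (hf.const_mul a).hasCompactSupport.add (hg.const_mul b).hasCompactSupport

lemma sub (hf : IsTestFunction f) (hg : IsTestFunction g) :
    IsTestFunction (fun x => f x - g x) where
  contDiff := hf.contDiff.sub hg.contDiff
  hasCompactSupport := hf.hasCompactSupport.sub hg.hasCompactSupport

lemma contDiff_two (hf : IsTestFunction f) : ContDiff ℝ 2 f := contDiff_infty.1 hf.contDiff 2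

lemma comp_const_smul (hf : IsTestFunction f) {c : ℝ} (hc : c ≠ 0) :
    IsTestFunction (fun x => f (c • x)) where
  contDiff := hf.contDiff.comp (contDiff_id.const_smul c)
  hasCompactSupport := hf.hasCompactSupport.comp_smul hc

lemma mul_contDiff (hf : IsTestFunction f) (hg : ContDiff ℝ ∞ g) :
    IsTestFunction (fun x => f x * g x) where
  contDiff := hf.contDiff.mul hg
  hasCompactSupport := hf.hasCompactSupport.mul_right

lemma pow (hf : IsTestFunction f) {k : ℕ} (hk : k ≠ 0) : IsTestFunction (fun x => f x ^ k) where
  contDiff := hf.contDiff.pow k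
  hasCompactSupport := hf.hasCompactSupport.comp_left (g := fun t : ℝ => t ^ k) (by simp [hk])

lemma fderiv_apply (hf : IsTestFunction f) (v : E) : IsTestFunction (fun x => fderiv ℝ f x v) where
  contDiff := (hf.contDiff.fderiv_right (m := ∞) (by simp)).clm_apply contDiff_const
  hasCompactSupport := hf.hasCompactSupport.fderiv_apply ℝ v

lemma integrable [MeasurableSpace E] [OpensMeasurableSpace E] {μ : Measure E}
    [IsFiniteMeasureOnCompacts μ] (hf : IsTestFunction f) : Integrable f μ :=
  hf.continuous.integrable_of_hasCompactSupport hf.hasCompactSupport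

lemma memLp_two [MeasurableSpace E] [OpensMeasurableSpace E] {μ : Measure E}
    [IsFiniteMeasureOnCompacts μ] (hf : IsTestFunction f) : MemLp f 2 μ :=
  hf.continuous.memLp_of_hasCompactSupport hf.hasCompactSupport

lemma integrable_mul_mul [MeasurableSpace E] [OpensMeasurableSpace E] {μ : Measure E}
    [IsFiniteMeasureOnCompacts μ] {V : E → ℝ} (hV : IsPotential V) (hf : IsTestFunction f)
    (hg : IsTestFunction g) : Integrable (fun x => V x * (f x * g x)) μ := by
  obtain ⟨M, hM⟩ := hV.bdd
  exact (hf.mul_contDiff hg.contDiff).integrable.bdd_mul hV.measurable.aestronglyMeasurable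
    (Eventually.of_forall hM)

end IsTestFunction

end TestFunctions

section Gradient

variable {E : Type*} [NormedAddCommGroup E] [InnerProductSpace ℝ E] [CompleteSpace E]
  {f g : E → ℝ} {x : E}

lemma gradient_linComb (hf : DifferentiableAt ℝ f x) (hg : DifferentiableAt ℝ g x) (a b : ℝ) :
    ∇ (fun x => a * f x + b * g x) x = a • ∇ f x + b • ∇ g x := by
  simp only [gradient, fderiv_fun_add (hf.const_mul a) (hg.const_mul b), fderiv_const_mul hf,
    fderiv_const_mul hg, map_add, map_smulₛₗ, conj_trivial]

lemma gradient_const_mul (f : E → ℝ) (a : ℝ) (x : E) :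
    ∇ (fun x => a * f x) x = a • ∇ f x := by
  have h : fderiv ℝ (fun x => a * f x) x = a • fderiv ℝ f x :=
    congrFun (fderiv_const_smul_field (𝕜 := ℝ) (f := f) a) x
  simp only [gradient, h, map_smulₛₗ, conj_trivial]

lemma gradient_mul (hf : DifferentiableAt ℝ f x) (hg : DifferentiableAt ℝ g x) :
    ∇ (fun x => f x * g x) x = f x • ∇ g x + g x • ∇ f x := by
  simp only [gradient, fderiv_fun_mul hf hg, map_add, map_smulₛₗ, conj_trivial]

lemma gradient_scomp {θ : ℝ → ℝ} {θ' : ℝ} (hf : DifferentiableAt ℝ f x)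
    (hθ : HasDerivAt θ θ' (f x)) : ∇ (fun x => θ (f x)) x = θ' • ∇ f x := by
  have h : HasFDerivAt (fun x => θ (f x)) (θ' • fderiv ℝ f x) x :=
    hθ.comp_hasFDerivAt x hf.hasFDerivAt
  simp only [gradient, h.fderiv, map_smulₛₗ, conj_trivial]

/-- The pointwise inner product `∇f · ∇g` of two gradients, the integrand of the Dirichlet form. -/
def gradInner (f g : E → ℝ) (x : E) : ℝ := ⟪∇ f x, ∇ g x⟫

lemma gradInner_comm (f g : E → ℝ) (x : E) : gradInner f g x = gradInner g f x :=
  real_inner_comm _ _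

lemma gradInner_self_nonneg (f : E → ℝ) (x : E) : 0 ≤ gradInner f f x := real_inner_self_nonneg

lemma gradInner_self_eq (f : E → ℝ) (x : E) : gradInner f f x = ‖fderiv ℝ f x‖ ^ 2 := by
  rw [gradInner, real_inner_self_eq_norm_sq, gradient, LinearIsometryEquiv.norm_map]

lemma gradInner_eq_sum {ι : Type*} [Fintype ι] (b : OrthonormalBasis ι ℝ E) (f g : E → ℝ)
    (x : E) : gradInner f g x = ∑ i, fderiv ℝ f x (b i) * fderiv ℝ g x (b i) := by
  rw [gradInner, ← b.sum_inner_mul_inner]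
  simp only [inner_gradient_left, inner_gradient_right, conj_trivial]

lemma gradInner_linComb_left {h : E → ℝ} (hf : DifferentiableAt ℝ f x)
    (hg : DifferentiableAt ℝ g x) (a b : ℝ) :
    gradInner (fun x => a * f x + b * g x) h x = a * gradInner f h x + b * gradInner g h x := by
  simp only [gradInner, gradient_linComb hf hg, inner_add_left, real_inner_smul_left]

lemma gradInner_scomp_right {θ : ℝ → ℝ} {θ' : ℝ} (hg : DifferentiableAt ℝ g x)
    (hθ : HasDerivAt θ θ' (g x)) : gradInner f (fun x => θ (g x)) x = θ' * gradInner f g x := by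
  rw [gradInner, gradient_scomp hg hθ, real_inner_smul_right, gradInner]

lemma gradInner_scomp_self {θ : ℝ → ℝ} {θ' : ℝ} (hf : DifferentiableAt ℝ f x)
    (hθ : HasDerivAt θ θ' (f x)) :
    gradInner (fun x => θ (f x)) (fun x => θ (f x)) x = θ' ^ 2 * gradInner f f x := by
  rw [gradInner_scomp_right hf hθ, gradInner_comm, gradInner_scomp_right hf hθ]
  ring

namespace IsTestFunction

lemma continuous_gradient (hf : IsTestFunction f) : Continuous (∇ f) :=
  (InnerProductSpace.toDual ℝ E).symm.continuous.comp (hf.contDiff.continuous_fderiv (by simp))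

lemma hasCompactSupport_gradient (hf : IsTestFunction f) : HasCompactSupport (∇ f) :=
  (hf.hasCompactSupport.fderiv ℝ).comp_left (g := (InnerProductSpace.toDual ℝ E).symm) (map_zero _)

lemma integrable_gradInner [MeasurableSpace E] [OpensMeasurableSpace E] {μ : Measure E}
    [IsFiniteMeasureOnCompacts μ] (hf : IsTestFunction f) (hg : IsTestFunction g) :
    Integrable (gradInner f g) μ := by
  refine (hf.continuous_gradient.inner hg.continuous_gradient).integrable_of_hasCompactSupport ?_
  refine hf.hasCompactSupport_gradient.mono fun x hx h0 => hx ?_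
  change ⟪∇ f x, ∇ g x⟫ = 0
  rw [h0, inner_zero_left]

end IsTestFunction

end Gradient

section Forms

variable {E : Type*} [NormedAddCommGroup E] [InnerProductSpace ℝ E] [FiniteDimensional ℝ E]
  [MeasurableSpace E] [BorelSpace E] {V f g h : E → ℝ}

/-- The Dirichlet form `∫ ∇f · ∇g`. -/
def dirichletForm (f g : E → ℝ) : ℝ := ∫ x, gradInner f g x

/-- The bilinear form `∫ V f g` of multiplication by the potential `V`. -/
def potentialForm (V f g : E → ℝ) : ℝ := ∫ x, V x * (f x * g x)

/-- The bilinear form `∫ (∇f · ∇g + V f g)` of the Schrödinger operator `-Δ + V` on real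
functions. -/
def energyForm (V f g : E → ℝ) : ℝ := dirichletForm f g + potentialForm V f g

/-- `-Δ + V ≥ 0`, tested on real-valued functions only. -/
def EnergyNonneg (V : E → ℝ) : Prop := ∀ f, IsTestFunction f → 0 ≤ energyForm V f f

namespace IsTestFunction

lemma integrable_energy (hf : IsTestFunction f) (hV : IsPotential V) :
    Integrable fun x => gradInner f f x + V x * (f x * f x) :=
  (hf.integrable_gradInner hf).add (hf.integrable_mul_mul hV hf)

lemma energyForm_self_eq_integral (hf : IsTestFunction f) (hV : IsPotential V) :
    energyForm V f f = ∫ x, gradInner f f x + V x * (f x * f x) :=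
  (integral_add (hf.integrable_gradInner hf) (hf.integrable_mul_mul hV hf)).symm

end IsTestFunction

lemma dirichletForm_self_nonneg (f : E → ℝ) : 0 ≤ dirichletForm f f :=
  integral_nonneg (gradInner_self_nonneg f)

lemma lintegral_gradInner_self (hf : IsTestFunction f) :
    ∫⁻ x, ENNReal.ofReal (gradInner f f x) = ENNReal.ofReal (dirichletForm f f) :=
  (ofReal_integral_eq_lintegral_ofReal (hf.integrable_gradInner hf)
    (Eventually.of_forall (gradInner_self_nonneg f))).symm

lemma potentialForm_self_nonneg (hV : ∀ x, 0 ≤ V x) (f : E → ℝ) : 0 ≤ potentialForm V f f :=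
  integral_nonneg fun x => mul_nonneg (hV x) (mul_self_nonneg _)

lemma potentialForm_self_nonpos (hV : ∀ x, V x ≤ 0) (f : E → ℝ) : potentialForm V f f ≤ 0 :=
  integral_nonpos fun x => mul_nonpos_of_nonpos_of_nonneg (hV x) (mul_self_nonneg _)

lemma energyForm_comm (V f g : E → ℝ) : energyForm V f g = energyForm V g f := by
  simp [energyForm, dirichletForm, potentialForm, gradInner_comm f g, mul_comm (f _)]

lemma energyForm_zero_potential (f g : E → ℝ) :
    energyForm (fun _ => 0) f g = dirichletForm f g := by
  simp [energyForm, potentialForm]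

lemma dirichletForm_linComb_left (hf : IsTestFunction f) (hg : IsTestFunction g)
    (hh : IsTestFunction h) (a b : ℝ) :
    dirichletForm (fun x => a * f x + b * g x) h =
      a * dirichletForm f h + b * dirichletForm g h := by
  simp only [dirichletForm, gradInner_linComb_left (hf.differentiable _) (hg.differentiable _)]
  rw [integral_add ((hf.integrable_gradInner hh).const_mul a)
    ((hg.integrable_gradInner hh).const_mul b), integral_const_mul, integral_const_mul]

lemma potentialForm_linComb_left (hV : IsPotential V) (hf : IsTestFunction f)
    (hg : IsTestFunction g) (hh : IsTestFunction h) (a b : ℝ) :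
    potentialForm V (fun x => a * f x + b * g x) h =
      a * potentialForm V f h + b * potentialForm V g h := by
  unfold potentialForm
  rw [← integral_const_mul, ← integral_const_mul,
    ← integral_add ((hf.integrable_mul_mul hV hh).const_mul a)
      ((hg.integrable_mul_mul hV hh).const_mul b)]
  congr 1 with x
  ring

lemma energyForm_linComb_left (hV : IsPotential V) (hf : IsTestFunction f) (hg : IsTestFunction g)
    (hh : IsTestFunction h) (a b : ℝ) :
    energyForm V (fun x => a * f x + b * g x) h =
      a * energyForm V f h + b * energyForm V g h := by
  simp only [energyForm, dirichletForm_linComb_left hf hg hh,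
    potentialForm_linComb_left hV hf hg hh]
  ring

lemma energyForm_linComb_self (hV : IsPotential V) (hf : IsTestFunction f) (hg : IsTestFunction g)
    (a b : ℝ) : energyForm V (fun x => a * f x + b * g x) (fun x => a * f x + b * g x) =
      a ^ 2 * energyForm V f f + 2 * a * b * energyForm V f g + b ^ 2 * energyForm V g g := by
  rw [energyForm_linComb_left hV hf hg (hf.linComb hg a b), energyForm_comm V f,
    energyForm_comm V g, energyForm_linComb_left hV hf hg hf, energyForm_linComb_left hV hf hg hg,
    energyForm_comm V g f]
  ring

lemma dirichletForm_const_mul_self (f : E → ℝ) (a : ℝ) :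
    dirichletForm (fun x => a * f x) (fun x => a * f x) = a ^ 2 * dirichletForm f f := by
  simp only [dirichletForm, gradInner, gradient_const_mul, real_inner_smul_left,
    real_inner_smul_right, ← integral_const_mul, ← mul_assoc, sq]

lemma potentialForm_const_mul_self (V f : E → ℝ) (a : ℝ) :
    potentialForm V (fun x => a * f x) (fun x => a * f x) = a ^ 2 * potentialForm V f f := by
  unfold potentialForm
  rw [← integral_const_mul]
  congr 1 with x
  ring

lemma energyForm_const_mul_self (V f : E → ℝ) (a : ℝ) :
    energyForm V (fun x => a * f x) (fun x => a * f x) = a ^ 2 * energyForm V f f := by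
  rw [energyForm, dirichletForm_const_mul_self, potentialForm_const_mul_self, energyForm]
  ring

lemma energyNonneg_of_nonneg (hV : ∀ x, 0 ≤ V x) : EnergyNonneg V := fun f _ =>
  add_nonneg (dirichletForm_self_nonneg f) (potentialForm_self_nonneg hV f)

namespace EnergyNonneg

lemma cauchy_schwarz (hn : EnergyNonneg V) (hV : IsPotential V) (hf : IsTestFunction f)
    (hg : IsTestFunction g) : energyForm V f g ^ 2 ≤ energyForm V f f * energyForm V g g := by
  have hquad : ∀ t : ℝ,
      0 ≤ energyForm V g g * (t * t) + 2 * energyForm V f g * t + energyForm V f f := fun t => by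
    have := hn _ (hf.linComb hg 1 t)
    rw [energyForm_linComb_self hV hf hg] at this
    linarith
  have := discrim_le_zero hquad
  unfold discrim at this
  linarith

lemma energyForm_linComb_self_le (hn : EnergyNonneg V) (hV : IsPotential V)
    (hf : IsTestFunction f) (hg : IsTestFunction g) (a b : ℝ) :
    energyForm V (fun x => a * f x + b * g x) (fun x => a * f x + b * g x) ≤
      2 * a ^ 2 * energyForm V f f + 2 * b ^ 2 * energyForm V g g := by
  have := hn _ (hf.linComb hg a (-b))
  rw [energyForm_linComb_self hV hf hg] at this ⊢
  linarith

lemma tendsto_energyForm_zero {f g : ℕ → E → ℝ} (hn : EnergyNonneg V) (hV : IsPotential V)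
    (hf : ∀ n, IsTestFunction (f n)) (hg : ∀ n, IsTestFunction (g n))
    (hlim : Tendsto (fun n => energyForm V (f n) (f n)) atTop (𝓝 0)) {K : ℝ}
    (hK : ∀ n, energyForm V (g n) (g n) ≤ K) :
    Tendsto (fun n => energyForm V (f n) (g n)) atTop (𝓝 0) := by
  have hsqrt : Tendsto (fun n => √(energyForm V (f n) (f n) * K)) atTop (𝓝 0) := by
    simpa using (hlim.mul_const K).sqrt
  refine squeeze_zero_norm (fun n => ?_) hsqrt
  refine Real.abs_le_sqrt ((hn.cauchy_schwarz hV (hf n) (hg n)).trans ?_)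
  exact mul_le_mul_of_nonneg_left (hK n) (hn _ (hf n))

end EnergyNonneg

lemma dirichletForm_sub_self_le (hf : IsTestFunction f) (hg : IsTestFunction g) :
    dirichletForm (fun x => f x - g x) (fun x => f x - g x) ≤
      2 * dirichletForm f f + 2 * dirichletForm g g := by
  have := (energyNonneg_of_nonneg (V := fun _ : E => 0) fun _ => le_rfl).energyForm_linComb_self_le
    ⟨measurable_const, 0, by simp⟩ hf hg 1 (-1)
  simpa [energyForm_zero_potential, sub_eq_add_neg] using this

end Forms

section ComplexTestFunctions

variable {V : E3 → ℝ} {f : E3 → ℂ}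

lemma isTestFunction_re (hf : ContDiff ℝ ∞ f) (hs : HasCompactSupport f) :
    IsTestFunction (fun x => (f x).re) :=
  ⟨Complex.reCLM.contDiff.comp hf, hs.comp_left (g := Complex.re) rfl⟩

lemma isTestFunction_im (hf : ContDiff ℝ ∞ f) (hs : HasCompactSupport f) :
    IsTestFunction (fun x => (f x).im) :=
  ⟨Complex.imCLM.contDiff.comp hf, hs.comp_left (g := Complex.im) rfl⟩

lemma sum_norm_fderiv_single_sq {x : E3} (hf : DifferentiableAt ℝ f x) :
    ∑ i : Fin 3, ‖fderiv ℝ f x (EuclideanSpace.single i 1)‖ ^ 2 =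
      gradInner (fun x => (f x).re) (fun x => (f x).re) x +
        gradInner (fun x => (f x).im) (fun x => (f x).im) x := by
  have hre : fderiv ℝ (fun x => (f x).re) x = Complex.reCLM.comp (fderiv ℝ f x) :=
    (Complex.reCLM.hasFDerivAt.comp x hf.hasFDerivAt).fderiv
  have him : fderiv ℝ (fun x => (f x).im) x = Complex.imCLM.comp (fderiv ℝ f x) :=
    (Complex.imCLM.hasFDerivAt.comp x hf.hasFDerivAt).fderiv
  simp only [gradInner_eq_sum (EuclideanSpace.basisFun (Fin 3) ℝ), hre, him,
    ← Finset.sum_add_distrib, Complex.sq_norm, Complex.normSq_apply]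
  simp

lemma schrodingerForm_eq_energyForm_re_add_im (hV : IsPotential V) (hf : ContDiff ℝ ∞ f)
    (hs : HasCompactSupport f) :
    schrodingerForm V f = energyForm V (fun x => (f x).re) (fun x => (f x).re) +
      energyForm V (fun x => (f x).im) (fun x => (f x).im) := by
  have hre := isTestFunction_re hf hs
  have him := isTestFunction_im hf hs
  rw [hre.energyForm_self_eq_integral hV, him.energyForm_self_eq_integral hV,
    ← integral_add (hre.integrable_energy hV) (him.integrable_energy hV), schrodingerForm]
  congr 1 with x
  rw [sum_norm_fderiv_single_sq (hf.differentiable (by simp) x), Complex.sq_norm,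
    Complex.normSq_apply]
  ring

lemma schrodingerForm_ofReal {f : E3 → ℝ} (hV : IsPotential V) (hf : IsTestFunction f) :
    schrodingerForm V (fun x => (f x : ℂ)) = energyForm V f f := by
  rw [schrodingerForm_eq_energyForm_re_add_im (f := fun x => (f x : ℂ)) hV
    (Complex.ofRealCLM.contDiff.comp hf.contDiff)
    (hf.hasCompactSupport.comp_left (g := fun t : ℝ => (t : ℂ)) Complex.ofReal_zero)]
  simp [energyForm, dirichletForm, potentialForm, gradInner]

lemma schrodingerNonneg_iff_energyNonneg (hV : IsPotential V) :
    SchrodingerNonneg V ↔ EnergyNonneg V := by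
  constructor
  · intro h f hf
    rw [← schrodingerForm_ofReal hV hf]
    exact h _ (Complex.ofRealCLM.contDiff.comp hf.contDiff)
      (hf.hasCompactSupport.comp_left (g := fun t : ℝ => (t : ℂ)) Complex.ofReal_zero)
  · intro h f hf hs
    rw [schrodingerForm_eq_energyForm_re_add_im hV hf hs]
    exact add_nonneg (h _ (isTestFunction_re hf hs)) (h _ (isTestFunction_im hf hs))

end ComplexTestFunctions

section L2

variable {α : Type*} [MeasurableSpace α] {μ : Measure α}

lemma inner_toLp_toLp {f g : α → ℝ} (hf : MemLp f 2 μ) (hg : MemLp g 2 μ) :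
    ⟪hf.toLp f, hg.toLp g⟫ = ∫ x, f x * g x ∂μ := by
  rw [L2.inner_def]
  refine integral_congr_ae ?_
  filter_upwards [hf.coeFn_toLp, hg.coeFn_toLp] with x hfx hgx
  simp [hfx, hgx, mul_comm]

lemma norm_toLp_sq {f : α → ℝ} (hf : MemLp f 2 μ) : ‖hf.toLp f‖ ^ 2 = ∫ x, f x ^ 2 ∂μ := by
  rw [← real_inner_self_eq_norm_sq, inner_toLp_toLp]
  simp only [sq]

lemma sq_integral_mul_le {f g : α → ℝ} (hf : MemLp f 2 μ) (hg : MemLp g 2 μ) :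
    (∫ x, f x * g x ∂μ) ^ 2 ≤ (∫ x, f x ^ 2 ∂μ) * ∫ x, g x ^ 2 ∂μ := by
  rw [← inner_toLp_toLp hf hg, ← norm_toLp_sq hf, ← norm_toLp_sq hg, ← mul_pow, ← sq_abs]
  exact pow_le_pow_left₀ (abs_nonneg _) (abs_real_inner_le_norm _ _) 2

lemma tendsto_toLp_iff {f : ℕ → α → ℝ} {u : α → ℝ} (hf : ∀ n, MemLp (f n) 2 μ)
    (hu : MemLp u 2 μ) : Tendsto (fun n => (hf n).toLp (f n)) atTop (𝓝 (hu.toLp u)) ↔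
      Tendsto (fun n => ∫ x, (f n x - u x) ^ 2 ∂μ) atTop (𝓝 0) := by
  have hnorm : ∀ n, ‖(hf n).toLp (f n) - hu.toLp u‖ ^ 2 = ∫ x, (f n x - u x) ^ 2 ∂μ := fun n => by
    rw [← MemLp.toLp_sub, norm_toLp_sq]
    rfl
  simp only [← hnorm, tendsto_iff_norm_sub_tendsto_zero (b := hu.toLp u)]
  refine ⟨fun h => by simpa using h.pow 2, fun h => ?_⟩
  simpa only [Real.sqrt_sq (norm_nonneg _), Real.sqrt_zero] using h.sqrt

lemma tendsto_integral_mul {f g : ℕ → α → ℝ} {u w : α → ℝ} (hf : ∀ n, MemLp (f n) 2 μ)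
    (hg : ∀ n, MemLp (g n) 2 μ) (hu : MemLp u 2 μ) (hw : MemLp w 2 μ)
    (hfu : Tendsto (fun n => ∫ x, (f n x - u x) ^ 2 ∂μ) atTop (𝓝 0))
    (hgw : Tendsto (fun n => ∫ x, (g n x - w x) ^ 2 ∂μ) atTop (𝓝 0)) :
    Tendsto (fun n => ∫ x, f n x * g n x ∂μ) atTop (𝓝 (∫ x, u x * w x ∂μ)) := by
  simp only [← inner_toLp_toLp, hf, hg, hu, hw]
  exact ((tendsto_toLp_iff hf hu).2 hfu).inner ((tendsto_toLp_iff hg hw).2 hgw)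

namespace IsPotential

variable {V : α → ℝ}

lemma memLp_mul {p : ENNReal} {u : α → ℝ} (hV : IsPotential V) (hu : MemLp u p μ) :
    MemLp (fun x => V x * u x) p μ := by
  obtain ⟨M, hM⟩ := hV.bdd
  refine hu.of_le_mul (c := M) (hV.measurable.aestronglyMeasurable.mul hu.1)
    (Eventually.of_forall fun x => ?_)
  rw [norm_mul]
  exact mul_le_mul_of_nonneg_right (hM x) (norm_nonneg _)

lemma tendsto_integral_sq_mul_sub {f : ℕ → α → ℝ} {u : α → ℝ} (hV : IsPotential V)
    (hf : ∀ n, MemLp (f n) 2 μ) (hu : MemLp u 2 μ)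
    (hfu : Tendsto (fun n => ∫ x, (f n x - u x) ^ 2 ∂μ) atTop (𝓝 0)) :
    Tendsto (fun n => ∫ x, (V x * f n x - V x * u x) ^ 2 ∂μ) atTop (𝓝 0) := by
  obtain ⟨M, hM⟩ := hV.bdd
  refine squeeze_zero (fun n => integral_nonneg fun x => sq_nonneg _) (fun n => ?_)
    (by simpa using hfu.const_mul (M ^ 2))
  rw [← integral_const_mul]
  refine integral_mono_of_nonneg (Eventually.of_forall fun x => sq_nonneg _)
    (((hf n).sub hu).integrable_sq.const_mul _) (Eventually.of_forall fun x => ?_)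
  change (V x * f n x - V x * u x) ^ 2 ≤ M ^ 2 * (f n x - u x) ^ 2
  rw [← mul_sub, mul_pow, ← sq_abs (V x)]
  gcongr
  exact hM x

lemma tendsto_integral_mul_mul {f g : ℕ → α → ℝ} {u w : α → ℝ} (hV : IsPotential V)
    (hf : ∀ n, MemLp (f n) 2 μ) (hg : ∀ n, MemLp (g n) 2 μ) (hu : MemLp u 2 μ)
    (hw : MemLp w 2 μ) (hfu : Tendsto (fun n => ∫ x, (f n x - u x) ^ 2 ∂μ) atTop (𝓝 0))
    (hgw : Tendsto (fun n => ∫ x, (g n x - w x) ^ 2 ∂μ) atTop (𝓝 0)) :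
    Tendsto (fun n => ∫ x, V x * (f n x * g n x) ∂μ) atTop (𝓝 (∫ x, V x * (u x * w x) ∂μ)) := by
  simp only [← mul_assoc]
  exact tendsto_integral_mul (fun n => hV.memLp_mul (hf n)) hg (hV.memLp_mul hu) hw
    (hV.tendsto_integral_sq_mul_sub hf hu hfu) hgw

end IsPotential

lemma tendsto_integral_sq_linComb_sub {f g : ℕ → α → ℝ} {u w : α → ℝ} (hf : ∀ n, MemLp (f n) 2 μ)
    (hg : ∀ n, MemLp (g n) 2 μ) (hu : MemLp u 2 μ) (hw : MemLp w 2 μ)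
    (hfu : Tendsto (fun n => ∫ x, (f n x - u x) ^ 2 ∂μ) atTop (𝓝 0))
    (hgw : Tendsto (fun n => ∫ x, (g n x - w x) ^ 2 ∂μ) atTop (𝓝 0)) (a b : ℝ) :
    Tendsto (fun n => ∫ x, (a * f n x + b * g n x - (a * u x + b * w x)) ^ 2 ∂μ) atTop (𝓝 0) :=
  (tendsto_toLp_iff (fun n => ((hf n).const_smul a).add ((hg n).const_smul b))
    ((hu.const_smul a).add (hw.const_smul b))).1
    ((((tendsto_toLp_iff hf hu).2 hfu).const_smul a).add
      (((tendsto_toLp_iff hg hw).2 hgw).const_smul b))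

lemma sq_sub_abs_le_of_abs_sub_abs_le {a b c e : ℝ} (h : |a - (|b|)| ≤ e) :
    (a - |c|) ^ 2 ≤ 2 * e ^ 2 + 2 * (b - c) ^ 2 := by
  have hle : |a - (|c|)| ≤ e + |b - c| := by
    calc |a - (|c|)| ≤ |a - (|b|)| + |(|b| - |c|)| := abs_sub_le _ _ _
      _ ≤ e + |b - c| := add_le_add h (abs_abs_sub_abs_le b c)
  calc (a - |c|) ^ 2 = |a - (|c|)| ^ 2 := (sq_abs _).symm
    _ ≤ (e + |b - c|) ^ 2 := pow_le_pow_left₀ (abs_nonneg _) hle 2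
    _ ≤ 2 * e ^ 2 + 2 * |b - c| ^ 2 := by linarith [sq_nonneg (e - |b - c|)]
    _ = 2 * e ^ 2 + 2 * (b - c) ^ 2 := by rw [sq_abs]

lemma tendsto_integral_sq_sub_abs [IsFiniteMeasure μ] {f g : ℕ → α → ℝ} {u : α → ℝ} {e : ℕ → ℝ}
    (hf : ∀ n, MemLp (f n) 2 μ) (hu : MemLp u 2 μ)
    (hfu : Tendsto (fun n => ∫ x, (f n x - u x) ^ 2 ∂μ) atTop (𝓝 0))
    (hg : ∀ n x, |g n x - (|f n x|)| ≤ e n) (he : Tendsto e atTop (𝓝 0)) :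
    Tendsto (fun n => ∫ x, (g n x - |u x|) ^ 2 ∂μ) atTop (𝓝 0) := by
  refine squeeze_zero (fun n => integral_nonneg fun x => sq_nonneg _) (fun n => ?_)
    (by simpa using (((he.pow 2).const_mul 2).const_mul (μ.real Set.univ)).add (hfu.const_mul 2))
  have hint : Integrable (fun x => 2 * (f n x - u x) ^ 2) μ :=
    ((hf n).sub hu).integrable_sq.const_mul 2
  calc ∫ x, (g n x - |u x|) ^ 2 ∂μ ≤ ∫ x, (2 * e n ^ 2 + 2 * (f n x - u x) ^ 2) ∂μ :=
        integral_mono_of_nonneg (Eventually.of_forall fun x => sq_nonneg _)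
          ((integrable_const _).add hint)
          (Eventually.of_forall fun x => sq_sub_abs_le_of_abs_sub_abs_le (hg n x))
    _ = _ := by
      rw [integral_add (integrable_const _) hint, integral_const, integral_const_mul, smul_eq_mul]

lemma integral_sq_pos_of_integral_mul_sq_ne {u W : α → ℝ} (hu : MemLp u 2 μ)
    (h : ∫ x, W x * u x ^ 2 ∂μ ≠ 0) : 0 < ∫ x, u x ^ 2 ∂μ := by
  refine (integral_nonneg fun x => sq_nonneg _).lt_of_ne fun h0 => h (integral_eq_zero_of_ae ?_)
  filter_upwards [(integral_eq_zero_iff_of_nonneg (fun x => sq_nonneg _) hu.integrable_sq).1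
    h0.symm] with x hx
  simp only [Pi.zero_apply] at hx ⊢
  rw [hx, mul_zero]

lemma sq_setAverage_le {s : Set α} {f : α → ℝ} (h0 : μ s ≠ 0) (hs : μ s ≠ ⊤)
    (hf : IntegrableOn f s μ) (hf2 : IntegrableOn (fun x => f x ^ 2) s μ) :
    (⨍ x in s, f x ∂μ) ^ 2 ≤ ⨍ x in s, f x ^ 2 ∂μ :=
  (even_two.convexOn_pow (𝕜 := ℝ)).map_set_average_le (continuous_pow 2).continuousOn isClosed_univ
    h0 hs (Eventually.of_forall fun _ => Set.mem_univ _) hf hf2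

lemma eLpNorm_two_eq {F : Type*} [NormedAddCommGroup F] {f : α → F} (hf : MemLp f 2 μ) :
    eLpNorm f 2 μ = ENNReal.ofReal (√(∫ x, ‖f x‖ ^ 2 ∂μ)) := by
  rw [hf.eLpNorm_eq_integral_rpow_norm (by simp) (by simp), Real.sqrt_eq_rpow]
  simp

end L2

section Sobolev

variable {E : Type*} [NormedAddCommGroup E] [InnerProductSpace ℝ E] [FiniteDimensional ℝ E]
  [MeasurableSpace E] [BorelSpace E]

lemma IsTestFunction.eLpNorm_fderiv {f : E → ℝ} (hf : IsTestFunction f) :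
    eLpNorm (fderiv ℝ f) 2 volume = ENNReal.ofReal (√(dirichletForm f f)) := by
  have hmem : MemLp (fderiv ℝ f) 2 volume :=
    (hf.contDiff.continuous_fderiv (by simp)).memLp_of_hasCompactSupport
      (hf.hasCompactSupport.fderiv ℝ)
  simp only [eLpNorm_two_eq hmem, dirichletForm, gradInner_self_eq]

lemma exists_sobolev_exponent {d : ℕ} (hd : 2 < d) :
    ∃ p : NNReal, 2 ≤ p ∧ (p : ℝ)⁻¹ = (2 : NNReal)⁻¹ - (d : ℝ)⁻¹ := by
  have hd' : (2 : ℝ) < d := by exact_mod_cast hd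
  have hpos : (0 : ℝ) < 2⁻¹ - (d : ℝ)⁻¹ := sub_pos.2 (inv_strictAnti₀ two_pos hd')
  refine ⟨(2⁻¹ - (d : ℝ)⁻¹)⁻¹.toNNReal, ?_, ?_⟩
  · rw [Real.le_toNNReal_iff_coe_le (inv_nonneg.2 hpos.le), NNReal.coe_ofNat,
      le_inv_comm₀ two_pos hpos]
    simp
  · rw [Real.coe_toNNReal _ (inv_nonneg.2 hpos.le), inv_inv]
    simp

lemma exists_eLpNorm_two_restrict_le (hd : 2 < finrank ℝ E) {s : Set E} (hs : volume s ≠ ⊤) :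
    ∃ C : ENNReal, C ≠ ⊤ ∧ ∀ f : E → ℝ, IsTestFunction f →
      eLpNorm f 2 (volume.restrict s) ≤ C * eLpNorm (fderiv ℝ f) 2 volume := by
  obtain ⟨p, hp2, hp⟩ := exists_sobolev_exponent hd
  obtain ⟨K, hK⟩ : ∃ K : NNReal, ∀ f : E → ℝ, IsTestFunction f →
      eLpNorm f p volume ≤ K * eLpNorm (fderiv ℝ f) 2 volume :=
    ⟨_, fun f hf => eLpNorm_le_eLpNorm_fderiv_of_eq_inner volume (hf.contDiff.of_le (by simp))
      hf.hasCompactSupport (p := 2) (by norm_num) (by lia) hp⟩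
  set T : ENNReal := volume s ^ (1 / (2 : ENNReal).toReal - 1 / (p : ENNReal).toReal)
  have hT : T ≠ ⊤ := by
    refine ENNReal.rpow_ne_top_of_nonneg ?_ hs
    simp [hp]
  refine ⟨K * T, ENNReal.mul_ne_top ENNReal.coe_ne_top hT, fun f hf => ?_⟩
  have hp2' : (2 : ENNReal) ≤ p := by exact_mod_cast hp2
  calc eLpNorm f 2 (volume.restrict s)
      ≤ eLpNorm f p (volume.restrict s) * T := by
        simpa [T] using eLpNorm_le_eLpNorm_mul_rpow_measure_univ (μ := volume.restrict s) hp2'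
          hf.continuous.aestronglyMeasurable
    _ ≤ K * eLpNorm (fderiv ℝ f) 2 volume * T := by
        gcongr
        exact (eLpNorm_mono_measure f Measure.restrict_le_self).trans (hK f hf)
    _ = K * T * eLpNorm (fderiv ℝ f) 2 volume := by ring

lemma exists_setIntegral_sq_le_dirichletForm (hd : 2 < finrank ℝ E) {s : Set E}
    (hs : volume s ≠ ⊤) :
    ∃ C : ℝ, 0 ≤ C ∧
      ∀ f : E → ℝ, IsTestFunction f → ∫ x in s, f x ^ 2 ≤ C * dirichletForm f f := by
  obtain ⟨C, hC, hle⟩ := exists_eLpNorm_two_restrict_le hd hs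
  refine ⟨C.toReal ^ 2, sq_nonneg _, fun f hf => ?_⟩
  have h := hle f hf
  rw [eLpNorm_two_eq hf.memLp_two, hf.eLpNorm_fderiv, ← ENNReal.ofReal_toReal hC,
    ← ENNReal.ofReal_mul ENNReal.toReal_nonneg, ENNReal.ofReal_le_ofReal_iff (by positivity),
    Real.sqrt_le_left (by positivity), mul_pow, Real.sq_sqrt (dirichletForm_self_nonneg f)] at h
  simpa only [Real.norm_eq_abs, sq_abs] using h

end Sobolev

section Translation

variable {E : Type*} [NormedAddCommGroup E] [NormedSpace ℝ E]

lemma intervalIntegral_fderiv_line {f : E → ℝ} (hf : ContDiff ℝ 1 f) (x z : E) :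
    ∫ t in (0 : ℝ)..1, fderiv ℝ f (x + t • z) z = f (x + z) - f x := by
  have hderiv : ∀ t : ℝ, HasDerivAt (fun t : ℝ => f (x + t • z)) (fderiv ℝ f (x + t • z) z) t := by
    intro t
    have hline : HasDerivAt (fun t : ℝ => x + t • z) z t := by
      simpa using ((hasDerivAt_id t).smul_const z).const_add x
    exact (hf.differentiable (by simp) _).hasFDerivAt.comp_hasDerivAt t hline
  have hcont : Continuous fun t : ℝ => fderiv ℝ f (x + t • z) z :=
    ((hf.continuous_fderiv (by simp)).comp (by fun_prop)).clm_apply continuous_const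
  simpa using intervalIntegral.integral_eq_sub_of_hasDerivAt (a := 0) (b := 1)
    (fun t _ => hderiv t) (hcont.intervalIntegrable _ _)

lemma ofReal_sq_sub_le_lintegral {f : E → ℝ} (hf : ContDiff ℝ 1 f) (x z : E) :
    ENNReal.ofReal ((f (x + z) - f x) ^ 2) ≤
      ∫⁻ t in Set.Ioc (0 : ℝ) 1, ENNReal.ofReal (‖z‖ ^ 2 * ‖fderiv ℝ f (x + t • z)‖ ^ 2) := by
  have hcont : Continuous fun t : ℝ => fderiv ℝ f (x + t • z) z :=
    ((hf.continuous_fderiv (by simp)).comp (by fun_prop)).clm_apply continuous_const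
  have hint : IntegrableOn (fun t => fderiv ℝ f (x + t • z) z) (Set.Ioc (0 : ℝ) 1) :=
    (hcont.intervalIntegrable 0 1).1
  have hint2 : IntegrableOn (fun t => fderiv ℝ f (x + t • z) z ^ 2) (Set.Ioc (0 : ℝ) 1) :=
    ((hcont.pow 2).intervalIntegrable 0 1).1
  have hjensen : (f (x + z) - f x) ^ 2 ≤
      ∫ t in Set.Ioc (0 : ℝ) 1, fderiv ℝ f (x + t • z) z ^ 2 := by
    have h := sq_setAverage_le (μ := volume) (by simp) (by simp) hint hint2
    simp only [setAverage_eq, Real.volume_real_Ioc, sub_zero, max_eq_left zero_le_one, inv_one,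
      one_smul] at h
    rwa [← intervalIntegral.integral_of_le zero_le_one, intervalIntegral_fderiv_line hf] at h
  refine (ENNReal.ofReal_le_ofReal hjensen).trans ?_
  rw [ofReal_integral_eq_lintegral_ofReal hint2 (Eventually.of_forall fun t => sq_nonneg _)]
  refine lintegral_mono fun t => ENNReal.ofReal_le_ofReal ?_
  rw [← sq_abs, ← mul_pow, mul_comm]
  exact pow_le_pow_left₀ (abs_nonneg _) ((fderiv ℝ f (x + t • z)).le_opNorm z) 2

lemma IsTestFunction.translate {f : E → ℝ} (hf : IsTestFunction f) (z : E) :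
    IsTestFunction fun x => f (x + z) where
  contDiff := hf.contDiff.comp (contDiff_id.add contDiff_const)
  hasCompactSupport := hf.hasCompactSupport.comp_homeomorph (Homeomorph.addRight z)

variable [MeasurableSpace E] [BorelSpace E] [SecondCountableTopology E]

lemma lintegral_sq_sub_translate_le {μ : Measure E} [SFinite μ] [μ.IsAddRightInvariant]
    {f : E → ℝ} (hf : ContDiff ℝ 1 f) {s s' : Set E} (hs : MeasurableSet s)
    (hs' : MeasurableSet s') (z : E)
    (hss : ∀ x ∈ s, ∀ t ∈ Set.Ioc (0 : ℝ) 1, x + t • z ∈ s') :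
    ∫⁻ x in s, ENNReal.ofReal ((f (x + z) - f x) ^ 2) ∂μ ≤
      ENNReal.ofReal (‖z‖ ^ 2) * ∫⁻ x in s', ENNReal.ofReal (‖fderiv ℝ f x‖ ^ 2) ∂μ := by
  have hcont : Continuous (fderiv ℝ f) := hf.continuous_fderiv (by simp)
  set F : E → ENNReal := fun x => ENNReal.ofReal (‖z‖ ^ 2 * ‖fderiv ℝ f x‖ ^ 2)
  have hF : Measurable F := (by fun_prop : Continuous fun x =>
    (‖z‖ ^ 2 * ‖fderiv ℝ f x‖ ^ 2)).measurable.ennreal_ofReal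
  have hshift : ∀ t ∈ Set.Ioc (0 : ℝ) 1, ∫⁻ x in s, F (x + t • z) ∂μ ≤ ∫⁻ x in s', F x ∂μ := by
    intro t ht
    rw [← lintegral_indicator hs, ← lintegral_indicator hs',
      ← lintegral_add_right_eq_self (s'.indicator F) (t • z)]
    refine lintegral_mono fun x => ?_
    by_cases hx : x ∈ s
    · rw [Set.indicator_of_mem hx, Set.indicator_of_mem (hss x hx t ht)]
    · exact (Set.indicator_of_notMem hx _).trans_le zero_le
  calc ∫⁻ x in s, ENNReal.ofReal ((f (x + z) - f x) ^ 2) ∂μ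
      ≤ ∫⁻ x in s, (∫⁻ t in Set.Ioc (0 : ℝ) 1, F (x + t • z)) ∂μ :=
        lintegral_mono fun x => ofReal_sq_sub_le_lintegral hf x z
    _ = ∫⁻ t in Set.Ioc (0 : ℝ) 1, ∫⁻ x in s, F (x + t • z) ∂μ := by
        refine lintegral_lintegral_swap (Measurable.aemeasurable ?_)
        exact hF.comp (by fun_prop)
    _ ≤ ∫⁻ _ in Set.Ioc (0 : ℝ) 1, ∫⁻ x in s', F x ∂μ :=
        setLIntegral_mono measurable_const hshift
    _ = ∫⁻ x in s', F x ∂μ := by simp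
    _ = _ := by
        simp only [F, ENNReal.ofReal_mul (sq_nonneg ‖z‖)]
        exact lintegral_const_mul _ (hcont.norm.pow 2).measurable.ennreal_ofReal

end Translation

section LocalAverages

variable {E : Type*} [NormedAddCommGroup E] [NormedSpace ℝ E] [FiniteDimensional ℝ E]
  [MeasurableSpace E] [BorelSpace E] {μ : Measure E} [μ.IsAddHaarMeasure]

lemma setIntegral_ball_sq_sub_le {f : E → ℝ} (hf : Continuous f) {c x : E} {r : ℝ}
    (hx : x ∈ Metric.ball c r) :
    ∫ w in Metric.ball c r, (f w - f x) ^ 2 ∂μ ≤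
      ∫ z in Metric.closedBall (0 : E) (2 * r), (f (x + z) - f x) ^ 2 ∂μ := by
  have hshift : ∫ z in Metric.closedBall (0 : E) (2 * r), (f (x + z) - f x) ^ 2 ∂μ =
      ∫ w in Metric.closedBall x (2 * r), (f w - f x) ^ 2 ∂μ := by
    have := (measurePreserving_add_left μ x).setIntegral_preimage_emb
      (measurableEmbedding_addLeft x) (fun w => (f w - f x) ^ 2) (Metric.closedBall x (2 * r))
    simpa using this
  rw [hshift]
  refine setIntegral_mono_set ?_ (Eventually.of_forall fun w => sq_nonneg _) ?_
  · exact ((hf.sub continuous_const).pow 2).continuousOn.integrableOn_compact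
      (isCompact_closedBall x (2 * r))
  · refine LE.le.eventuallyLE
      (Metric.ball_subset_closedBall.trans (Metric.closedBall_subset_closedBall' ?_))
    rw [Metric.mem_ball'] at hx
    linarith

lemma sq_sub_setAverage_ball_le {f : E → ℝ} (hf : Continuous f) {c x : E} {r : ℝ} (hr : 0 < r)
    (hx : x ∈ Metric.ball c r) :
    (f x - ⨍ w in Metric.ball c r, f w ∂μ) ^ 2 ≤ (μ.real (Metric.ball c r))⁻¹ *
      ∫ z in Metric.closedBall (0 : E) (2 * r), (f (x + z) - f x) ^ 2 ∂μ := by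
  have hint : ∀ {g : E → ℝ}, Continuous g → IntegrableOn g (Metric.ball c r) μ := fun hg =>
    (hg.continuousOn.integrableOn_compact (isCompact_closedBall c r)).mono_set
      Metric.ball_subset_closedBall
  have h0 : μ (Metric.ball c r) ≠ 0 := (Metric.measure_ball_pos _ _ hr).ne'
  have htop : μ (Metric.ball c r) ≠ ⊤ := measure_ball_lt_top.ne
  have hcentre : (⨍ w in Metric.ball c r, (f w - f x) ∂μ) =
      (⨍ w in Metric.ball c r, f w ∂μ) - f x := by
    rw [setAverage_eq, integral_sub (hint hf) (hint continuous_const), smul_sub, ← setAverage_eq,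
      ← setAverage_eq, setAverage_const h0 htop]
  calc (f x - ⨍ w in Metric.ball c r, f w ∂μ) ^ 2
      = (⨍ w in Metric.ball c r, (f w - f x) ∂μ) ^ 2 := by rw [hcentre]; ring
    _ ≤ ⨍ w in Metric.ball c r, (f w - f x) ^ 2 ∂μ :=
        sq_setAverage_le h0 htop (hint (by fun_prop)) (hint (by fun_prop))
    _ ≤ _ := by
        rw [setAverage_eq, smul_eq_mul]
        gcongr
        exact setIntegral_ball_sq_sub_le hf hx

end LocalAverages

section Rellich

variable {E : Type*} [NormedAddCommGroup E] [InnerProductSpace ℝ E] [FiniteDimensional ℝ E]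
  [MeasurableSpace E] [BorelSpace E]

/-- Lebesgue measure restricted to the closed ball of radius `ρ` about the origin; compactness of
minimising sequences is only available in `L²` of such balls. -/
abbrev ballMeasure (ρ : ℝ) : Measure E := volume.restrict (Metric.closedBall 0 ρ)

instance isFiniteMeasure_ballMeasure (ρ : ℝ) : IsFiniteMeasure (ballMeasure ρ : Measure E) :=
  isFiniteMeasure_restrict.2 measure_closedBall_lt_top.ne

lemma setIntegral_sq_sub_translate_le {f : E → ℝ} (hf : IsTestFunction f) (s : Set E) (z : E) :
    ∫ x in s, (f (x + z) - f x) ^ 2 ≤ ‖z‖ ^ 2 * dirichletForm f f := by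
  have hint : Integrable fun x => (f (x + z) - f x) ^ 2 :=
    (((hf.translate z).sub hf).pow two_ne_zero).integrable
  refine (setIntegral_le_integral hint (Eventually.of_forall fun x => sq_nonneg _)).trans ?_
  have h := lintegral_sq_sub_translate_le (μ := volume) (hf.contDiff.of_le (by simp))
    MeasurableSet.univ MeasurableSet.univ z (by simp)
  simp only [setLIntegral_univ, ← gradInner_self_eq, lintegral_gradInner_self hf] at h
  rwa [← ofReal_integral_eq_lintegral_ofReal hint (Eventually.of_forall fun x => sq_nonneg _),
    ← ENNReal.ofReal_mul (sq_nonneg _), ENNReal.ofReal_le_ofReal_iff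
      (mul_nonneg (sq_nonneg _) (dirichletForm_self_nonneg f))] at h

lemma integral_setIntegral_closedBall_sq_sub_le {f : E → ℝ} (hf : IsTestFunction f) (ρ r : ℝ) :
    ∫ x, (∫ z in Metric.closedBall (0 : E) r, (f (x + z) - f x) ^ 2) ∂(ballMeasure ρ) ≤
      volume.real (Metric.closedBall (0 : E) r) * (r ^ 2 * dirichletForm f f) := by
  have hcont : Continuous (Function.uncurry fun x z : E => (f (x + z) - f x) ^ 2) := by
    have := hf.continuous
    fun_prop
  have hint : Integrable (Function.uncurry fun x z : E => (f (x + z) - f x) ^ 2)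
      ((ballMeasure ρ).prod (ballMeasure r)) := by
    rw [Measure.prod_restrict]
    exact hcont.continuousOn.integrableOn_compact
      ((isCompact_closedBall _ _).prod (isCompact_closedBall _ _))
  calc ∫ x, (∫ z in Metric.closedBall (0 : E) r, (f (x + z) - f x) ^ 2) ∂(ballMeasure ρ)
      = ∫ z in Metric.closedBall (0 : E) r, ∫ x, (f (x + z) - f x) ^ 2 ∂(ballMeasure ρ) :=
        integral_integral_swap hint
    _ ≤ ∫ _ in Metric.closedBall (0 : E) r, r ^ 2 * dirichletForm f f := by
        refine integral_mono_of_nonneg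
          (Eventually.of_forall fun z => integral_nonneg fun x => sq_nonneg _)
          (integrable_const _) (ae_restrict_of_forall_mem measurableSet_closedBall fun z hz => ?_)
        refine (setIntegral_sq_sub_translate_le hf _ z).trans ?_
        exact mul_le_mul_of_nonneg_right
          (pow_le_pow_left₀ (norm_nonneg z) (mem_closedBall_zero_iff.1 hz) 2)
          (dirichletForm_self_nonneg f)
    _ = _ := by simp

lemma sq_le_of_mem_cover {f : E → ℝ} (hf : Continuous f) {t : Finset E} {r : ℝ} (hr : 0 < r)
    {x : E} (hx : ∃ c ∈ t, x ∈ Metric.ball c r) :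
    f x ^ 2 ≤ 2 * (volume.real (Metric.ball (0 : E) r))⁻¹ *
        (∫ z in Metric.closedBall (0 : E) (2 * r), (f (x + z) - f x) ^ 2) +
      2 * ∑ c ∈ t, (⨍ w in Metric.ball c r, f w) ^ 2 := by
  obtain ⟨c, hc, hxc⟩ := hx
  have hosc := sq_sub_setAverage_ball_le (μ := volume) hf hr hxc
  have hvol : volume.real (Metric.ball c r) = volume.real (Metric.ball (0 : E) r) := by
    simp only [Measure.real, Measure.addHaar_ball_center]
  rw [hvol] at hosc
  have hsum : (⨍ w in Metric.ball c r, f w) ^ 2 ≤ ∑ c ∈ t, (⨍ w in Metric.ball c r, f w) ^ 2 :=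
    Finset.single_le_sum (f := fun c => (⨍ w in Metric.ball c r, f w) ^ 2)
      (fun _ _ => sq_nonneg _) hc
  linarith [sq_nonneg (f x - 2 * ⨍ w in Metric.ball c r, f w)]

lemma integral_sq_le_of_cover {f : E → ℝ} (hf : IsTestFunction f) {ρ r : ℝ} {t : Finset E}
    (hr : 0 < r) (ht : ∀ x ∈ Metric.closedBall (0 : E) ρ, ∃ c ∈ t, x ∈ Metric.ball c r) :
    ∫ x, f x ^ 2 ∂(ballMeasure ρ) ≤ 2 ^ (finrank ℝ E + 3) * r ^ 2 * dirichletForm f f +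
      2 * volume.real (Metric.closedBall (0 : E) ρ) *
        ∑ c ∈ t, (⨍ w in Metric.ball c r, f w) ^ 2 := by
  set S := ∑ c ∈ t, (⨍ w in Metric.ball c r, f w) ^ 2
  set v := volume.real (Metric.ball (0 : E) r)
  set J : E → ℝ := fun x => ∫ z in Metric.closedBall (0 : E) (2 * r), (f (x + z) - f x) ^ 2
  have hv : 0 < v :=
    ENNReal.toReal_pos (Metric.measure_ball_pos _ _ hr).ne' measure_ball_lt_top.ne
  have hJ : Integrable (fun x => 2 * v⁻¹ * J x) (ballMeasure ρ) := by
    have hcont : Continuous J := continuous_parametric_integral_of_continuous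
      (f := fun x z => (f (x + z) - f x) ^ 2)
      (by have := hf.continuous; fun_prop) (isCompact_closedBall 0 (2 * r))
    exact (hcont.continuousOn.integrableOn_compact (isCompact_closedBall 0 ρ)).const_mul _
  have hvol : volume.real (Metric.closedBall (0 : E) (2 * r)) = 2 ^ finrank ℝ E * v := by
    simp only [v, measureReal_def, Measure.addHaar_closedBall volume _ (by positivity : 0 ≤ 2 * r),
      Measure.addHaar_ball_of_pos volume _ hr, ENNReal.toReal_mul,
      ENNReal.toReal_ofReal (by positivity : 0 ≤ (2 * r) ^ finrank ℝ E),
      ENNReal.toReal_ofReal (by positivity : 0 ≤ r ^ finrank ℝ E)]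
    ring
  calc ∫ x, f x ^ 2 ∂(ballMeasure ρ)
      ≤ ∫ x, (2 * v⁻¹ * J x + 2 * S) ∂(ballMeasure ρ) :=
        integral_mono_of_nonneg (Eventually.of_forall fun x => sq_nonneg _)
          (hJ.add (integrable_const _)) (ae_restrict_of_forall_mem measurableSet_closedBall
            fun x hx => sq_le_of_mem_cover hf.continuous hr (ht x hx))
    _ = 2 * v⁻¹ * (∫ x, J x ∂(ballMeasure ρ)) +
          2 * volume.real (Metric.closedBall (0 : E) ρ) * S := by
        rw [integral_add hJ (integrable_const _), integral_const_mul, integral_const,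
          measureReal_restrict_apply_univ, smul_eq_mul]
        ring
    _ ≤ 2 * v⁻¹ * (2 ^ finrank ℝ E * v * ((2 * r) ^ 2 * dirichletForm f f)) +
          2 * volume.real (Metric.closedBall (0 : E) ρ) * S := by
        gcongr
        rw [← hvol]
        exact integral_setIntegral_closedBall_sq_sub_le hf ρ (2 * r)
    _ = _ := by field_simp; ring

lemma exists_integral_sq_le_sum_setAverage (ρ : ℝ) {ε : ℝ} (hε : 0 < ε) :
    ∃ (t : Finset E) (r C : ℝ), 0 < r ∧ 0 ≤ C ∧ ∀ f : E → ℝ, IsTestFunction f →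
      ∫ x, f x ^ 2 ∂(ballMeasure ρ) ≤
        ε * dirichletForm f f + C * ∑ c ∈ t, (⨍ w in Metric.ball c r, f w) ^ 2 := by
  set K : ℝ := 2 ^ (finrank ℝ E + 3)
  have hK : 0 < K := by positivity
  obtain ⟨r, hr, hrK⟩ : ∃ r, 0 < r ∧ K * r ^ 2 = ε :=
    ⟨√(ε / K), by positivity, by rw [Real.sq_sqrt (by positivity)]; field_simp⟩
  obtain ⟨t, -, htf, ht⟩ := Metric.finite_approx_of_totallyBounded
    (isCompact_closedBall (0 : E) ρ).totallyBounded _ hr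
  refine ⟨htf.toFinset, r, 2 * volume.real (Metric.closedBall (0 : E) ρ), hr,
    by positivity, fun f hf => ?_⟩
  rw [← hrK]
  refine integral_sq_le_of_cover hf hr fun x hx => ?_
  simpa using ht hx

lemma exists_sq_setAverage_ball_le (hd : 2 < finrank ℝ E) (c : E) {r : ℝ} (hr : 0 < r) :
    ∃ C : ℝ, 0 ≤ C ∧ ∀ f : E → ℝ, IsTestFunction f →
      (⨍ w in Metric.ball c r, f w) ^ 2 ≤ C * dirichletForm f f := by
  obtain ⟨C, hC0, hC⟩ := exists_setIntegral_sq_le_dirichletForm hd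
    (measure_ball_lt_top (μ := volume) (x := c) (r := r)).ne
  refine ⟨(volume.real (Metric.ball c r))⁻¹ * C, by positivity, fun f hf => ?_⟩
  refine (sq_setAverage_le (Metric.measure_ball_pos _ _ hr).ne' measure_ball_lt_top.ne
    hf.integrable.integrableOn (hf.pow two_ne_zero).integrable.integrableOn).trans ?_
  rw [setAverage_eq, smul_eq_mul, mul_assoc]
  gcongr
  exact hC f hf

lemma exists_finite_cover_range_of_dist_lt {ι X Y : Type*} [PseudoMetricSpace X]
    [PseudoMetricSpace Y] {F : ι → X} {a : ι → Y} (ha : TotallyBounded (Set.range a)) {δ ε : ℝ}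
    (hδ : 0 < δ) (h : ∀ i j, dist (a i) (a j) < δ → dist (F i) (F j) < ε) :
    ∃ s : Set X, s.Finite ∧ Set.range F ⊆ ⋃ y ∈ s, Metric.ball y ε := by
  obtain ⟨s, hs, hfin, hcov⟩ := Metric.finite_approx_of_totallyBounded ha δ hδ
  choose idx hidx using fun y : s => hs y.2
  have := hfin.to_subtype
  refine ⟨Set.range fun y : s => F (idx y), Set.finite_range _, ?_⟩
  rintro _ ⟨i, rfl⟩
  obtain ⟨y, hy, hiy⟩ := Set.mem_iUnion₂.1 (hcov ⟨i, rfl⟩)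
  refine Set.mem_iUnion₂.2 ⟨_, ⟨⟨y, hy⟩, rfl⟩, h _ _ ?_⟩
  rw [hidx]
  exact hiy

lemma totallyBounded_range_setAverage (hd : 2 < finrank ℝ E) {ι : Type*} {f : ι → E → ℝ}
    (hf : ∀ i, IsTestFunction (f i)) {K : ℝ} (hK : ∀ i, dirichletForm (f i) (f i) ≤ K)
    (t : Finset E) {r : ℝ} (hr : 0 < r) :
    TotallyBounded (Set.range fun i (c : t) => ⨍ w in Metric.ball (c : E) r, f i w) := by
  choose C hC0 hC using fun c : t => exists_sq_setAverage_ball_le hd (c : E) hr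
  refine (isCompact_univ_pi fun c : t =>
    isCompact_Icc (a := -√(C c * K)) (b := √(C c * K))).totallyBounded.subset ?_
  rintro _ ⟨i, rfl⟩ c -
  exact abs_le.1 (Real.abs_le_sqrt ((hC c (f i) (hf i)).trans
    (mul_le_mul_of_nonneg_left (hK i) (hC0 c))))

lemma sum_sq_setAverage_sub_le {f g : E → ℝ} (hf : IsTestFunction f) (hg : IsTestFunction g)
    (t : Finset E) {r δ : ℝ} (hδ : dist (fun c : t => ⨍ w in Metric.ball (c : E) r, f w)
      (fun c : t => ⨍ w in Metric.ball (c : E) r, g w) < δ) :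
    ∑ c ∈ t, (⨍ w in Metric.ball c r, (f w - g w)) ^ 2 ≤ t.card * δ ^ 2 := by
  rw [← nsmul_eq_mul]
  refine Finset.sum_le_card_nsmul _ _ _ fun c hc => ?_
  have hsub : (⨍ w in Metric.ball c r, (f w - g w)) =
      (⨍ w in Metric.ball c r, f w) - ⨍ w in Metric.ball c r, g w := by
    simp only [setAverage_eq]
    rw [integral_sub hf.integrable.restrict hg.integrable.restrict, smul_sub]
  rw [hsub, ← sq_abs]
  exact pow_le_pow_left₀ (abs_nonneg _) ((dist_le_pi_dist _ _ (⟨c, hc⟩ : t)).trans hδ.le) 2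

lemma totallyBounded_range_toLp (hd : 2 < finrank ℝ E) (ρ : ℝ) {ι : Type*} {f : ι → E → ℝ}
    (hf : ∀ i, IsTestFunction (f i)) {K : ℝ} (hK : ∀ i, dirichletForm (f i) (f i) ≤ K) :
    TotallyBounded (Set.range fun i => ((hf i).memLp_two (μ := ballMeasure ρ)).toLp (f i)) := by
  rw [Metric.totallyBounded_iff]
  intro ε hε
  rcases isEmpty_or_nonempty ι with hι | ⟨⟨i₀⟩⟩
  · exact ⟨∅, Set.finite_empty, by simp [hι]⟩
  have hK0 : 0 ≤ K := (dirichletForm_self_nonneg _).trans (hK i₀)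
  obtain ⟨t, r, C, hr, hC, hbound⟩ :=
    exists_integral_sq_le_sum_setAverage (E := E) ρ (ε := ε ^ 2 / (8 * (K + 1))) (by positivity)
  obtain ⟨δ, hδ, hδε⟩ : ∃ δ : ℝ, 0 < δ ∧ C * (t.card * δ ^ 2) ≤ ε ^ 2 / 4 :=
    ⟨√(ε ^ 2 / (4 * (C * t.card + 1))), by positivity, by
      rw [Real.sq_sqrt (by positivity), ← mul_assoc, ← mul_div_assoc, div_le_div_iff₀
        (by positivity) (by positivity)]
      nlinarith [sq_nonneg ε]⟩
  refine exists_finite_cover_range_of_dist_lt (totallyBounded_range_setAverage hd hf hK t hr) hδ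
    fun i j hij => ?_
  rw [dist_eq_norm, ← MemLp.toLp_sub]
  refine lt_of_pow_lt_pow_left₀ 2 hε.le ?_
  have henergy : dirichletForm (fun x => f i x - f j x) (fun x => f i x - f j x) ≤ 4 * (K + 1) := by
    linarith [dirichletForm_sub_self_le (hf i) (hf j), hK i, hK j]
  calc ‖_‖ ^ 2 = ∫ x, (f i x - f j x) ^ 2 ∂(ballMeasure ρ) := norm_toLp_sq _
    _ ≤ _ := hbound _ ((hf i).sub (hf j))
    _ ≤ ε ^ 2 / (8 * (K + 1)) * (4 * (K + 1)) + C * (t.card * δ ^ 2) := by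
        gcongr
        exact sum_sq_setAverage_sub_le (hf i) (hf j) t hij
    _ ≤ ε ^ 2 / 2 + ε ^ 2 / 4 := by
        gcongr
        exact (by field_simp; norm_num : ε ^ 2 / (8 * (K + 1)) * (4 * (K + 1)) = ε ^ 2 / 2).le
    _ < ε ^ 2 := by linarith [pow_pos hε 2]

theorem exists_subseq_tendsto_integral_sq_sub (hd : 2 < finrank ℝ E) (ρ : ℝ) {f : ℕ → E → ℝ}
    (hf : ∀ n, IsTestFunction (f n)) {K : ℝ} (hK : ∀ n, dirichletForm (f n) (f n) ≤ K) :
    ∃ φ : ℕ → ℕ, StrictMono φ ∧ ∃ u : E → ℝ, MemLp u 2 (ballMeasure ρ) ∧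
      Tendsto (fun n => ∫ x, (f (φ n) x - u x) ^ 2 ∂(ballMeasure ρ)) atTop (𝓝 0) := by
  obtain ⟨U, -, φ, hφ, hlim⟩ :=
    ((totallyBounded_range_toLp hd ρ hf hK).closure.isCompact_of_isClosed
      isClosed_closure).tendsto_subseq (fun n => subset_closure ⟨n, rfl⟩)
  refine ⟨φ, hφ, U, Lp.memLp U,
    (tendsto_toLp_iff (fun n => (hf (φ n)).memLp_two) (Lp.memLp U)).1 ?_⟩
  rwa [Lp.toLp_coeFn]

end Rellich

section SupportedInBall

/-- The function `V` vanishes outside the closed ball of radius `ρ` about the origin. -/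
def SupportedInBall {E : Type*} [NormedAddCommGroup E] (V : E → ℝ) (ρ : ℝ) : Prop :=
  ∀ x, ρ < ‖x‖ → V x = 0

variable {E : Type*} [NormedAddCommGroup E] [InnerProductSpace ℝ E] [FiniteDimensional ℝ E]
  [MeasurableSpace E] [BorelSpace E] {V f : E → ℝ} {ρ : ℝ}

lemma SupportedInBall.mono {E : Type*} [NormedAddCommGroup E] {V : E → ℝ} {r R : ℝ}
    (hs : SupportedInBall V r) (hr : r ≤ R) : SupportedInBall V R :=
  fun x hx => hs x (hr.trans_lt hx)

lemma SupportedInBall.integral_mul_eq (hs : SupportedInBall V ρ) (g : E → ℝ) :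
    ∫ x, V x * g x = ∫ x, V x * g x ∂(ballMeasure ρ) := by
  refine (setIntegral_eq_integral_of_forall_compl_eq_zero fun x hx => ?_).symm
  rw [mem_closedBall_zero_iff, not_le] at hx
  rw [hs x hx, zero_mul]

lemma SupportedInBall.potentialForm_self (hs : SupportedInBall V ρ) (f : E → ℝ) :
    potentialForm V f f = ∫ x, V x * f x ^ 2 ∂(ballMeasure ρ) := by
  simp only [← hs.integral_mul_eq, potentialForm, sq]

lemma exists_abs_potentialForm_self_le (hd : 2 < finrank ℝ E) (hV : IsPotential V)
    (hs : SupportedInBall V ρ) :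
    ∃ C, 0 ≤ C ∧ ∀ f, IsTestFunction f → |potentialForm V f f| ≤ C * dirichletForm f f := by
  obtain ⟨C, hC0, hC⟩ := exists_setIntegral_sq_le_dirichletForm hd
    (measure_closedBall_lt_top (μ := volume) (x := (0 : E)) (r := ρ)).ne
  obtain ⟨M, hM⟩ := hV.bdd
  have hM0 : 0 ≤ M := (abs_nonneg _).trans (hM 0)
  refine ⟨M * C, by positivity, fun f hf => ?_⟩
  rw [hs.potentialForm_self]
  calc |∫ x, V x * f x ^ 2 ∂(ballMeasure ρ)| ≤ ∫ x, M * f x ^ 2 ∂(ballMeasure ρ) := by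
        rw [← Real.norm_eq_abs]
        refine norm_integral_le_of_norm_le (hf.memLp_two.integrable_sq.const_mul M)
          (Eventually.of_forall fun x => ?_)
        rw [norm_mul, Real.norm_of_nonneg (sq_nonneg _)]
        exact mul_le_mul_of_nonneg_right (hM x) (sq_nonneg _)
    _ ≤ M * C * dirichletForm f f := by
        rw [integral_const_mul, mul_assoc]
        exact mul_le_mul_of_nonneg_left (hC f hf) hM0

lemma dirichletForm_pos_of_energyForm_neg (hd : 2 < finrank ℝ E) (hV : IsPotential V)
    (hs : SupportedInBall V ρ) (hf : IsTestFunction f) (h : energyForm V f f < 0) :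
    0 < dirichletForm f f := by
  obtain ⟨C, -, hC⟩ := exists_abs_potentialForm_self_le hd hV hs
  refine (dirichletForm_self_nonneg f).lt_of_ne fun h0 => ?_
  have hpot : potentialForm V f f = 0 := by simpa [← h0] using hC f hf
  rw [energyForm, hpot, ← h0, add_zero] at h
  exact h.false

lemma exists_dirichletForm_eq_one_energyForm_neg (hd : 2 < finrank ℝ E) (hV : IsPotential V)
    (hs : SupportedInBall V ρ) (h : ¬ EnergyNonneg V) :
    ∃ f, IsTestFunction f ∧ dirichletForm f f = 1 ∧ energyForm V f f < 0 := by
  rw [EnergyNonneg] at h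
  push Not at h
  obtain ⟨f, hf, hneg⟩ := h
  have hpos := dirichletForm_pos_of_energyForm_neg hd hV hs hf hneg
  set a := (√(dirichletForm f f))⁻¹
  have ha : a ^ 2 = (dirichletForm f f)⁻¹ := by rw [inv_pow, Real.sq_sqrt hpos.le]
  refine ⟨fun x => a * f x, hf.const_mul a, ?_, ?_⟩
  · rw [dirichletForm_const_mul_self, ha, inv_mul_cancel₀ hpos.ne']
  · rw [energyForm_const_mul_self, ha]
    exact mul_neg_of_pos_of_neg (inv_pos.2 hpos) hneg

end SupportedInBall

section ZeroEnergySequence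

variable {E : Type*} [NormedAddCommGroup E] [InnerProductSpace ℝ E] [FiniteDimensional ℝ E]
  [MeasurableSpace E] [BorelSpace E] {V : E → ℝ} {ρ : ℝ}

/-- The test functions `f n` have energies `∫ |∇(f n)|² + V (f n)²` tending to zero, and converge
to `u` in `L²` of the ball of radius `ρ`. Only the restriction of a zero-energy resonance to a ball
containing the support of `V` is ever needed, so no weak formulation on the whole space enters. -/
structure ZeroEnergySequence (V : E → ℝ) (ρ : ℝ) (f : ℕ → E → ℝ) (u : E → ℝ) : Prop where
  isTestFunction : ∀ n, IsTestFunction (f n)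
  tendsto_energyForm : Tendsto (fun n => energyForm V (f n) (f n)) atTop (𝓝 0)
  memLp : MemLp u 2 (ballMeasure ρ)
  tendsto_integral_sq_sub : Tendsto (fun n => ∫ x, (f n x - u x) ^ 2 ∂(ballMeasure ρ)) atTop (𝓝 0)

/-- `u` is the restriction to the ball of radius `ρ` of a zero-energy state of `-Δ + V`. -/
def IsZeroEnergyState (V : E → ℝ) (ρ : ℝ) (u : E → ℝ) : Prop := ∃ f, ZeroEnergySequence V ρ f u

namespace ZeroEnergySequence

variable {f g : ℕ → E → ℝ} {u v : E → ℝ}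

lemma tendsto_potentialForm (h : ZeroEnergySequence V ρ f u) {W : E → ℝ} (hW : IsPotential W)
    (hs : SupportedInBall W ρ) : Tendsto (fun n => potentialForm W (f n) (f n)) atTop
      (𝓝 (∫ x, W x * u x ^ 2 ∂(ballMeasure ρ))) := by
  simp only [hs.potentialForm_self, sq]
  exact hW.tendsto_integral_mul_mul (fun n => (h.isTestFunction n).memLp_two)
    (fun n => (h.isTestFunction n).memLp_two) h.memLp h.memLp h.tendsto_integral_sq_sub
    h.tendsto_integral_sq_sub

lemma tendsto_dirichletForm (h : ZeroEnergySequence V ρ f u) (hV : IsPotential V)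
    (hs : SupportedInBall V ρ) : Tendsto (fun n => dirichletForm (f n) (f n)) atTop
      (𝓝 (-∫ x, V x * u x ^ 2 ∂(ballMeasure ρ))) := by
  simpa [energyForm] using h.tendsto_energyForm.sub (h.tendsto_potentialForm hV hs)

lemma tendsto_integral_sq (h : ZeroEnergySequence V ρ f u) :
    Tendsto (fun n => ∫ x, f n x ^ 2 ∂(ballMeasure ρ)) atTop
      (𝓝 (∫ x, u x ^ 2 ∂(ballMeasure ρ))) := by
  simp only [sq]
  exact tendsto_integral_mul (fun n => (h.isTestFunction n).memLp_two)
    (fun n => (h.isTestFunction n).memLp_two) h.memLp h.memLp h.tendsto_integral_sq_sub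
    h.tendsto_integral_sq_sub

lemma exists_dirichletForm_le (h : ZeroEnergySequence V ρ f u) (hV : IsPotential V)
    (hs : SupportedInBall V ρ) : ∃ K, ∀ n, dirichletForm (f n) (f n) ≤ K := by
  obtain ⟨K, hK⟩ := (h.tendsto_dirichletForm hV hs).bddAbove_range
  exact ⟨K, fun n => hK ⟨n, rfl⟩⟩

lemma integral_mul_sq_neg (h : ZeroEnergySequence V ρ f u) (hd : 2 < finrank ℝ E)
    (hV : IsPotential V) (hs : SupportedInBall V ρ) (hu : 0 < ∫ x, u x ^ 2 ∂(ballMeasure ρ)) :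
    ∫ x, V x * u x ^ 2 ∂(ballMeasure ρ) < 0 := by
  obtain ⟨C, hC0, hC⟩ := exists_setIntegral_sq_le_dirichletForm hd
    (measure_closedBall_lt_top (μ := volume) (x := (0 : E)) (r := ρ)).ne
  have hle := le_of_tendsto_of_tendsto' h.tendsto_integral_sq
    ((h.tendsto_dirichletForm hV hs).const_mul C) fun n => hC _ (h.isTestFunction n)
  exact neg_pos.1 (pos_of_mul_pos_right (hu.trans_le hle) hC0)

lemma linComb (hV : IsPotential V) (hn : EnergyNonneg V) (hf : ZeroEnergySequence V ρ f u)
    (hg : ZeroEnergySequence V ρ g v) (a b : ℝ) :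
    ZeroEnergySequence V ρ (fun n x => a * f n x + b * g n x) (fun x => a * u x + b * v x) where
  isTestFunction n := (hf.isTestFunction n).linComb (hg.isTestFunction n) a b
  tendsto_energyForm :=
    squeeze_zero (fun n => hn _ ((hf.isTestFunction n).linComb (hg.isTestFunction n) a b))
      (fun n => hn.energyForm_linComb_self_le hV (hf.isTestFunction n) (hg.isTestFunction n) a b)
      (by simpa using (hf.tendsto_energyForm.const_mul (2 * a ^ 2)).add
            (hg.tendsto_energyForm.const_mul (2 * b ^ 2)))
  memLp := (hf.memLp.const_mul a).add (hg.memLp.const_mul b)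
  tendsto_integral_sq_sub := tendsto_integral_sq_linComb_sub
    (fun n => (hf.isTestFunction n).memLp_two) (fun n => (hg.isTestFunction n).memLp_two)
    hf.memLp hg.memLp hf.tendsto_integral_sq_sub hg.tendsto_integral_sq_sub a b

end ZeroEnergySequence

theorem exists_zeroEnergySequence (hd : 2 < finrank ℝ E) (hV : IsPotential V)
    (hs : SupportedInBall V ρ) {f : ℕ → E → ℝ} (hf : ∀ n, IsTestFunction (f n))
    (h1 : ∀ n, dirichletForm (f n) (f n) = 1)
    (hlim : Tendsto (fun n => energyForm V (f n) (f n)) atTop (𝓝 0)) :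
    ∃ φ : ℕ → ℕ, StrictMono φ ∧ ∃ u, ZeroEnergySequence V ρ (fun n => f (φ n)) u ∧
      ∫ x, V x * u x ^ 2 ∂(ballMeasure ρ) = -1 := by
  obtain ⟨φ, hφ, u, hu, hconv⟩ :=
    exists_subseq_tendsto_integral_sq_sub hd ρ hf (fun n => (h1 n).le)
  have hseq : ZeroEnergySequence V ρ (fun n => f (φ n)) u :=
    ⟨fun n => hf _, hlim.comp hφ.tendsto_atTop, hu, hconv⟩
  refine ⟨φ, hφ, u, hseq, ?_⟩
  have hone := hseq.tendsto_dirichletForm hV hs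
  simp only [h1] at hone
  exact neg_eq_iff_eq_neg.1 (tendsto_nhds_unique hone tendsto_const_nhds)

end ZeroEnergySequence

section AbsoluteValue

/-- A smooth approximation `√(t² + ε²) - ε` of `|t|`; subtracting `ε` makes it vanish at `0`, so
that composition with it preserves compact supports. -/
def smoothAbs (ε t : ℝ) : ℝ := √(t ^ 2 + ε ^ 2) - ε

variable {ε : ℝ}

lemma smoothAbs_nonneg (ε t : ℝ) : 0 ≤ smoothAbs ε t :=
  sub_nonneg.2 (Real.le_sqrt_of_sq_le (by linarith [sq_nonneg t]))

lemma abs_smoothAbs_sub_abs_le (hε : 0 ≤ ε) (t : ℝ) : |smoothAbs ε t - (|t|)| ≤ ε := by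
  have hlower : |t| ≤ √(t ^ 2 + ε ^ 2) := Real.abs_le_sqrt (by linarith [sq_nonneg ε])
  have hupper : √(t ^ 2 + ε ^ 2) ≤ |t| + ε := by
    rw [Real.sqrt_le_left (by positivity)]
    linarith [sq_abs t, mul_nonneg (abs_nonneg t) hε]
  rw [smoothAbs, abs_le]
  constructor <;> linarith

lemma hasDerivAt_smoothAbs (hε : 0 < ε) (t : ℝ) :
    HasDerivAt (smoothAbs ε) (t / √(t ^ 2 + ε ^ 2)) t := by
  have hinner : HasDerivAt (fun t : ℝ => t ^ 2 + ε ^ 2) (2 * t) t := by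
    simpa using (hasDerivAt_pow 2 t).add_const (ε ^ 2)
  have hsqrt := (hinner.sqrt (by positivity)).sub_const ε
  rwa [mul_div_mul_left _ _ two_ne_zero] at hsqrt

lemma contDiff_smoothAbs (hε : 0 < ε) : ContDiff ℝ ∞ (smoothAbs ε) :=
  (ContDiff.sqrt (by fun_prop) fun t => by positivity).sub contDiff_const

lemma IsTestFunction.smoothAbs {E : Type*} [NormedAddCommGroup E] [NormedSpace ℝ E] {f : E → ℝ}
    (hf : IsTestFunction f) (hε : 0 < ε) : IsTestFunction (fun x => smoothAbs ε (f x)) where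
  contDiff := (contDiff_smoothAbs hε).comp hf.contDiff
  hasCompactSupport := hf.hasCompactSupport.comp_left (g := CriticalCoupling.smoothAbs ε)
    (by simp [CriticalCoupling.smoothAbs, Real.sqrt_sq hε.le])

variable {E : Type*} [NormedAddCommGroup E] [InnerProductSpace ℝ E] [FiniteDimensional ℝ E]
  [MeasurableSpace E] [BorelSpace E] {V : E → ℝ} {ρ : ℝ}

lemma dirichletForm_scomp_le {f : E → ℝ} {θ : ℝ → ℝ} {θ' : E → ℝ} {L : ℝ} (hf : IsTestFunction f)
    (hθ : ∀ x, HasDerivAt θ (θ' x) (f x)) (hL : ∀ x, θ' x ^ 2 ≤ L) :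
    dirichletForm (fun x => θ (f x)) (fun x => θ (f x)) ≤ L * dirichletForm f f := by
  simp only [dirichletForm, gradInner_scomp_self (hf.differentiable _) (hθ _)]
  rw [← integral_const_mul]
  exact integral_mono_of_nonneg
    (Eventually.of_forall fun x => mul_nonneg (sq_nonneg _) (gradInner_self_nonneg f x))
    ((hf.integrable_gradInner hf).const_mul L)
    (Eventually.of_forall fun x => mul_le_mul_of_nonneg_right (hL x) (gradInner_self_nonneg f x))

lemma dirichletForm_smoothAbs_le {f : E → ℝ} (hf : IsTestFunction f) (hε : 0 < ε) :
    dirichletForm (fun x => smoothAbs ε (f x)) (fun x => smoothAbs ε (f x)) ≤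
      dirichletForm f f := by
  refine (dirichletForm_scomp_le (L := 1) hf (fun x => hasDerivAt_smoothAbs hε (f x))
    fun x => ?_).trans_eq (one_mul _)
  rw [div_pow, Real.sq_sqrt (by positivity)]
  exact div_le_one_of_le₀ (by linarith [sq_nonneg ε]) (by positivity)

theorem ZeroEnergySequence.exists_abs {f : ℕ → E → ℝ} {u : E → ℝ} (hV : IsPotential V)
    (hs : SupportedInBall V ρ) (hn : EnergyNonneg V) (h : ZeroEnergySequence V ρ f u) :
    ∃ g, ZeroEnergySequence V ρ g (fun x => |u x|) ∧ ∀ n x, 0 ≤ g n x := by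
  set e : ℕ → ℝ := fun n => 1 / ((n : ℝ) + 1)
  have he : ∀ n, 0 < e n := fun n => by positivity
  set g : ℕ → E → ℝ := fun n x => smoothAbs (e n) (f n x)
  have hg : ∀ n, IsTestFunction (g n) := fun n => (h.isTestFunction n).smoothAbs (he n)
  have hconv : Tendsto (fun n => ∫ x, (g n x - |u x|) ^ 2 ∂(ballMeasure ρ)) atTop (𝓝 0) :=
    tendsto_integral_sq_sub_abs (fun n => (h.isTestFunction n).memLp_two) h.memLp
      h.tendsto_integral_sq_sub (fun n x => abs_smoothAbs_sub_abs_le (he n).le (f n x))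
      tendsto_one_div_add_atTop_nhds_zero_nat
  have hpot : Tendsto (fun n => potentialForm V (g n) (g n)) atTop
      (𝓝 (∫ x, V x * u x ^ 2 ∂(ballMeasure ρ))) := by
    simpa only [hs.potentialForm_self, sq, Pi.abs_apply, abs_mul_abs_self] using
      hV.tendsto_integral_mul_mul (fun n => (hg n).memLp_two) (fun n => (hg n).memLp_two)
        h.memLp.abs h.memLp.abs hconv hconv
  refine ⟨g, ⟨hg, ?_, h.memLp.abs, hconv⟩, fun n x => smoothAbs_nonneg _ _⟩
  refine squeeze_zero (fun n => hn _ (hg n))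
    (g := fun n => dirichletForm (f n) (f n) + potentialForm V (g n) (g n)) (fun n => ?_)
    (by simpa using (h.tendsto_dirichletForm hV hs).add hpot)
  exact add_le_add_left (dirichletForm_smoothAbs_le (h.isTestFunction n) (he n)) _

end AbsoluteValue

section LogGradient

/-- The logarithm of `f`, shifted by `ε` to keep it finite where `f` vanishes. -/
def shiftedLog {α : Type*} (ε : ℝ) (f : α → ℝ) (x : α) : ℝ := Real.log (f x + ε)

/-- Moser's test function `ζ² / (f + ε)`: the energy form pairs it with `f` to give
`-∫ ζ² |∇ log (f + ε)|²` up to terms controlled by the cutoff `ζ`. -/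
def logTest {α : Type*} (ε : ℝ) (ζ f : α → ℝ) (x : α) : ℝ := ζ x ^ 2 * (f x + ε)⁻¹

section NormedSpace

variable {E : Type*} [NormedAddCommGroup E] [NormedSpace ℝ E] {ζ f : E → ℝ} {ε : ℝ}

lemma IsTestFunction.contDiff_shiftedLog (hf : IsTestFunction f) (hf0 : ∀ x, 0 ≤ f x)
    (hε : 0 < ε) : ContDiff ℝ ∞ (shiftedLog ε f) :=
  (hf.contDiff.add contDiff_const).log fun x => (add_pos_of_nonneg_of_pos (hf0 x) hε).ne'

lemma IsTestFunction.logTest (hζ : IsTestFunction ζ) (hf : IsTestFunction f)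
    (hf0 : ∀ x, 0 ≤ f x) (hε : 0 < ε) : IsTestFunction (logTest ε ζ f) :=
  (hζ.pow two_ne_zero).mul_contDiff
    ((hf.contDiff.add contDiff_const).inv fun x => (add_pos_of_nonneg_of_pos (hf0 x) hε).ne')

end NormedSpace

section Gradient

variable {E : Type*} [NormedAddCommGroup E] [InnerProductSpace ℝ E] [CompleteSpace E]
  {ζ f : E → ℝ} {ε : ℝ}

lemma gradient_logTest (hζ : IsTestFunction ζ) (hf : IsTestFunction f) (hf0 : ∀ x, 0 ≤ f x)
    (hε : 0 < ε) (x : E) :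
    ∇ (logTest ε ζ f) x =
      (2 * (ζ x * (f x + ε)⁻¹)) • ∇ ζ x - (ζ x * (f x + ε)⁻¹) ^ 2 • ∇ f x := by
  have hne : f x + ε ≠ 0 := (add_pos_of_nonneg_of_pos (hf0 x) hε).ne'
  have hsq : HasDerivAt (fun t : ℝ => t ^ 2) (2 * ζ x) (ζ x) := by
    simpa using hasDerivAt_pow 2 (ζ x)
  have hinv : HasDerivAt (fun t => (t + ε)⁻¹) (-1 / (f x + ε) ^ 2) (f x) :=
    ((hasDerivAt_id (f x)).add_const ε).inv hne
  unfold logTest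
  rw [gradient_mul (f := fun y => ζ y ^ 2) (g := fun y => (f y + ε)⁻¹)
      ((hζ.differentiable x).fun_pow 2) (((hf.differentiable x).add_const ε).fun_inv hne),
    gradient_scomp (hζ.differentiable x) hsq, gradient_scomp (hf.differentiable x) hinv,
    div_eq_mul_inv, ← inv_pow]
  module

lemma gradInner_shiftedLog (hf : IsTestFunction f) (hf0 : ∀ x, 0 ≤ f x) (hε : 0 < ε) (x : E) :
    gradInner (shiftedLog ε f) (shiftedLog ε f) x = ((f x + ε)⁻¹) ^ 2 * gradInner f f x := by
  have hlog : HasDerivAt (fun t => Real.log (t + ε)) (f x + ε)⁻¹ (f x) := by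
    simpa using ((hasDerivAt_id (f x)).add_const ε).log (add_pos_of_nonneg_of_pos (hf0 x) hε).ne'
  exact gradInner_scomp_self (hf.differentiable x) hlog

lemma gradInner_logTest_le (hζ : IsTestFunction ζ) (hf : IsTestFunction f)
    (hf0 : ∀ x, 0 ≤ f x) (hε : 0 < ε) (x : E) :
    gradInner f (logTest ε ζ f) x ≤ 2 * gradInner ζ ζ x -
      1 / 2 * (ζ x ^ 2 * gradInner (shiftedLog ε f) (shiftedLog ε f) x) := by
  have hsq := real_inner_self_nonneg (x := (ζ x * (f x + ε)⁻¹) • ∇ f x - (2 : ℝ) • ∇ ζ x)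
  rw [gradInner_shiftedLog hf hf0 hε]
  simp only [gradInner, gradient_logTest hζ hf hf0 hε, inner_sub_left, inner_sub_right,
    real_inner_smul_left, real_inner_smul_right, real_inner_comm (∇ f x) (∇ ζ x)] at hsq ⊢
  linarith

lemma gradInner_logTest_self_le (hζ : IsTestFunction ζ) (hζ1 : ∀ x, |ζ x| ≤ 1)
    (hf : IsTestFunction f) (hf0 : ∀ x, 0 ≤ f x) (hε : 0 < ε) (x : E) :
    gradInner (logTest ε ζ f) (logTest ε ζ f) x ≤
      8 * ε⁻¹ ^ 2 * gradInner ζ ζ x + 2 * ε⁻¹ ^ 4 * gradInner f f x := by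
  have hsq := real_inner_self_nonneg
    (x := (2 * (ζ x * (f x + ε)⁻¹)) • ∇ ζ x + (ζ x * (f x + ε)⁻¹) ^ 2 • ∇ f x)
  have hinv : 0 < (f x + ε)⁻¹ := inv_pos.2 (add_pos_of_nonneg_of_pos (hf0 x) hε)
  have ha : |ζ x * (f x + ε)⁻¹| ≤ ε⁻¹ := by
    rw [abs_mul, abs_of_pos hinv]
    exact (mul_le_of_le_one_left hinv.le (hζ1 x)).trans
      (inv_anti₀ hε (le_add_of_nonneg_left (hf0 x)))
  have hpow : ∀ k : ℕ, Even k → (ζ x * (f x + ε)⁻¹) ^ k ≤ ε⁻¹ ^ k := fun k hk => by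
    rw [← hk.pow_abs]
    exact pow_le_pow_left₀ (abs_nonneg _) ha k
  have hle2 := mul_le_mul_of_nonneg_right (hpow 2 even_two) (gradInner_self_nonneg ζ x)
  have hle4 := mul_le_mul_of_nonneg_right (hpow 4 (by decide)) (gradInner_self_nonneg f x)
  simp only [gradInner, gradient_logTest hζ hf hf0 hε, inner_sub_left, inner_sub_right,
    inner_add_left, inner_add_right, real_inner_smul_left, real_inner_smul_right] at hsq hle2 hle4 ⊢
  linarith

end Gradient

variable {E : Type*} [NormedAddCommGroup E] [InnerProductSpace ℝ E] [FiniteDimensional ℝ E]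
  [MeasurableSpace E] [BorelSpace E] {V ζ f : E → ℝ} {ε M : ℝ}

lemma dirichletForm_logTest_self_le (hζ : IsTestFunction ζ) (hζ1 : ∀ x, |ζ x| ≤ 1)
    (hf : IsTestFunction f) (hf0 : ∀ x, 0 ≤ f x) (hε : 0 < ε) :
    dirichletForm (logTest ε ζ f) (logTest ε ζ f) ≤
      8 * ε⁻¹ ^ 2 * dirichletForm ζ ζ + 2 * ε⁻¹ ^ 4 * dirichletForm f f := by
  have ht := hζ.logTest hf hf0 hε
  have hζi := (hζ.integrable_gradInner hζ (μ := volume)).const_mul (8 * ε⁻¹ ^ 2)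
  have hfi := (hf.integrable_gradInner hf (μ := volume)).const_mul (2 * ε⁻¹ ^ 4)
  simp only [dirichletForm, ← integral_const_mul]
  rw [← integral_add hζi hfi]
  exact integral_mono (ht.integrable_gradInner ht) (hζi.add hfi)
    (gradInner_logTest_self_le hζ hζ1 hf hf0 hε)

lemma potentialForm_le_of_mul_le {g h : E → ℝ} {c : ℝ} (hV : IsPotential V) (hM : ∀ x, |V x| ≤ M)
    (hζ : IsTestFunction ζ) (hg : IsTestFunction g) (hh : IsTestFunction h)
    (h0 : ∀ x, 0 ≤ g x * h x) (hle : ∀ x, g x * h x ≤ c * ζ x ^ 2) :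
    potentialForm V g h ≤ M * c * ∫ x, ζ x ^ 2 := by
  have hM0 : 0 ≤ M := (abs_nonneg _).trans (hM 0)
  rw [potentialForm, ← integral_const_mul]
  refine integral_mono (hg.integrable_mul_mul hV hh)
    ((hζ.pow two_ne_zero).integrable.const_mul _) fun x => ?_
  calc V x * (g x * h x) ≤ M * (g x * h x) :=
        mul_le_mul_of_nonneg_right ((le_abs_self _).trans (hM x)) (h0 x)
    _ ≤ M * (c * ζ x ^ 2) := mul_le_mul_of_nonneg_left (hle x) hM0
    _ = M * c * ζ x ^ 2 := by ring

lemma potentialForm_logTest_self_le (hV : IsPotential V) (hM : ∀ x, |V x| ≤ M)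
    (hζ : IsTestFunction ζ) (hζ1 : ∀ x, |ζ x| ≤ 1) (hf : IsTestFunction f) (hf0 : ∀ x, 0 ≤ f x)
    (hε : 0 < ε) :
    potentialForm V (logTest ε ζ f) (logTest ε ζ f) ≤ M * ε⁻¹ ^ 2 * ∫ x, ζ x ^ 2 := by
  have ht := hζ.logTest hf hf0 hε
  refine potentialForm_le_of_mul_le hV hM hζ ht ht (fun x => mul_self_nonneg _) fun x => ?_
  have hinv : 0 < (f x + ε)⁻¹ := inv_pos.2 (add_pos_of_nonneg_of_pos (hf0 x) hε)
  calc logTest ε ζ f x * logTest ε ζ f x = ζ x ^ 2 * (f x + ε)⁻¹ ^ 2 * ζ x ^ 2 := by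
        rw [logTest]
        ring
    _ ≤ 1 * ε⁻¹ ^ 2 * ζ x ^ 2 := by
        gcongr
        · exact (sq_le_one_iff_abs_le_one _).2 (hζ1 x)
        · exact le_add_of_nonneg_left (hf0 x)
    _ = ε⁻¹ ^ 2 * ζ x ^ 2 := by rw [one_mul]

lemma potentialForm_logTest_le (hV : IsPotential V) (hM : ∀ x, |V x| ≤ M)
    (hζ : IsTestFunction ζ) (hf : IsTestFunction f) (hf0 : ∀ x, 0 ≤ f x) (hε : 0 < ε) :
    potentialForm V f (logTest ε ζ f) ≤ M * ∫ x, ζ x ^ 2 := by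
  have hpos : ∀ x, 0 < f x + ε := fun x => add_pos_of_nonneg_of_pos (hf0 x) hε
  have heq : ∀ x, f x * logTest ε ζ f x = f x / (f x + ε) * ζ x ^ 2 := fun x => by
    rw [logTest]
    ring
  refine (potentialForm_le_of_mul_le (c := 1) hV hM hζ hf (hζ.logTest hf hf0 hε)
    (fun x => ?_) fun x => ?_).trans_eq (by rw [mul_one])
  · rw [heq]
    exact mul_nonneg (div_nonneg (hf0 x) (hpos x).le) (sq_nonneg _)
  · rw [heq]
    exact mul_le_mul_of_nonneg_right
      ((div_le_one (hpos x)).2 (le_add_of_nonneg_right hε.le)) (sq_nonneg _)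

lemma integrable_sq_mul_gradInner {w : E → ℝ} (hζ : IsTestFunction ζ) (hw : ContDiff ℝ ∞ w) :
    Integrable (fun x => ζ x ^ 2 * gradInner w w x) := by
  simp only [gradInner_self_eq]
  exact ((hζ.continuous.pow 2).mul
    ((hw.continuous_fderiv (by simp)).norm.pow 2)).integrable_of_hasCompactSupport
      (hζ.pow two_ne_zero).hasCompactSupport.mul_right

lemma integral_sq_mul_gradInner_shiftedLog_le (hV : IsPotential V) (hM : ∀ x, |V x| ≤ M)
    (hζ : IsTestFunction ζ) (hf : IsTestFunction f) (hf0 : ∀ x, 0 ≤ f x) (hε : 0 < ε) :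
    ∫ x, ζ x ^ 2 * gradInner (shiftedLog ε f) (shiftedLog ε f) x ≤
      4 * dirichletForm ζ ζ + 2 * M * (∫ x, ζ x ^ 2) - 2 * energyForm V f (logTest ε ζ f) := by
  have hζi := (hζ.integrable_gradInner hζ (μ := volume)).const_mul 2
  have hwi :=
    (integrable_sq_mul_gradInner hζ (hf.contDiff_shiftedLog hf0 hε)).const_mul (1 / 2)
  have hdir := integral_mono (hf.integrable_gradInner (hζ.logTest hf hf0 hε)) (hζi.sub hwi)
    (gradInner_logTest_le hζ hf hf0 hε)
  simp only [Pi.sub_apply] at hdir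
  rw [integral_sub hζi hwi, integral_const_mul, integral_const_mul] at hdir
  have hpot := potentialForm_logTest_le hV hM hζ hf hf0 hε
  simp only [energyForm, dirichletForm] at hdir ⊢
  linarith

theorem exists_integral_sq_mul_gradInner_shiftedLog_le (hV : IsPotential V) (hn : EnergyNonneg V)
    {f : ℕ → E → ℝ} (hf : ∀ n, IsTestFunction (f n)) (hf0 : ∀ n x, 0 ≤ f n x)
    (hlim : Tendsto (fun n => energyForm V (f n) (f n)) atTop (𝓝 0)) {K : ℝ}
    (hK : ∀ n, dirichletForm (f n) (f n) ≤ K) (hζ : IsTestFunction ζ) (hζ1 : ∀ x, |ζ x| ≤ 1) :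
    ∃ C, ∀ ε, 0 < ε → ∀ᶠ n in atTop,
      ∫ x, ζ x ^ 2 * gradInner (shiftedLog ε (f n)) (shiftedLog ε (f n)) x ≤ C := by
  obtain ⟨M, hM⟩ := hV.bdd
  refine ⟨4 * dirichletForm ζ ζ + 2 * M * (∫ x, ζ x ^ 2) + 2, fun ε hε => ?_⟩
  have hbdd : ∀ n, energyForm V (logTest ε ζ (f n)) (logTest ε ζ (f n)) ≤
      8 * ε⁻¹ ^ 2 * dirichletForm ζ ζ + 2 * ε⁻¹ ^ 4 * K + M * ε⁻¹ ^ 2 * ∫ x, ζ x ^ 2 := fun n =>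
    add_le_add ((dirichletForm_logTest_self_le hζ hζ1 (hf n) (hf0 n) hε).trans
        (by gcongr; exact hK n))
      (potentialForm_logTest_self_le hV hM hζ hζ1 (hf n) (hf0 n) hε)
  have hpair := hn.tendsto_energyForm_zero hV hf (fun n => hζ.logTest (hf n) (hf0 n) hε) hlim hbdd
  filter_upwards [hpair.eventually_const_lt neg_one_lt_zero] with n hlt
  linarith [integral_sq_mul_gradInner_shiftedLog_le hV hM hζ (hf n) (hf0 n) hε]

end LogGradient

section Cutoff

variable {E : Type*} [NormedAddCommGroup E] [InnerProductSpace ℝ E] [FiniteDimensional ℝ E]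

lemma exists_cutoff {r R : ℝ} (hr : 0 < r) (hR : r < R) :
    ∃ ζ : E → ℝ, IsTestFunction ζ ∧ (∀ x, ζ x ∈ Set.Icc 0 1) ∧ (∀ x, ‖x‖ ≤ r → ζ x = 1) ∧
      ∀ x, R ≤ ‖x‖ → ζ x = 0 :=
  let b : ContDiffBump (0 : E) := ⟨r, R, hr, hR⟩
  ⟨b, ⟨b.contDiff, b.hasCompactSupport⟩, fun _ => ⟨b.nonneg, b.le_one⟩,
    fun _ hx => b.one_of_mem_closedBall (mem_closedBall_zero_iff.2 hx),
    fun _ hx => b.zero_of_le_dist (by rwa [dist_zero_right])⟩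

end Cutoff

section LogOscillation

variable {E : Type*} [NormedAddCommGroup E] [InnerProductSpace ℝ E] [FiniteDimensional ℝ E]
  [MeasurableSpace E] [BorelSpace E] {V : E → ℝ} {ρ : ℝ}

lemma lintegral_ballMeasure_le_translate (F : E → ENNReal) {x : E} (hx : ‖x‖ ≤ ρ) :
    ∫⁻ y, F y ∂(ballMeasure ρ) ≤ ∫⁻ z, F (x + z) ∂(ballMeasure (2 * ρ)) := by
  rw [← lintegral_indicator measurableSet_closedBall,
    ← lintegral_indicator measurableSet_closedBall,
    ← lintegral_add_left_eq_self ((Metric.closedBall (0 : E) ρ).indicator F) x]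
  refine lintegral_mono fun z => ?_
  by_cases hz : x + z ∈ Metric.closedBall (0 : E) ρ
  · rw [Set.indicator_of_mem hz, Set.indicator_of_mem]
    rw [mem_closedBall_zero_iff] at *
    calc ‖z‖ = ‖(x + z) - x‖ := by rw [add_sub_cancel_left]
      _ ≤ ‖x + z‖ + ‖x‖ := norm_sub_le _ _
      _ ≤ 2 * ρ := by linarith
  · rw [Set.indicator_of_notMem hz]
    exact zero_le

lemma lintegral_ballMeasure_sq_sub_translate_le {w : E → ℝ} (hw : ContDiff ℝ 1 w) {z : E}
    (hz : ‖z‖ ≤ 2 * ρ) :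
    ∫⁻ x, ENNReal.ofReal ((w (x + z) - w x) ^ 2) ∂(ballMeasure ρ) ≤
      ENNReal.ofReal ((2 * ρ) ^ 2) *
        ∫⁻ x, ENNReal.ofReal (‖fderiv ℝ w x‖ ^ 2) ∂(ballMeasure (3 * ρ)) := by
  refine (lintegral_sq_sub_translate_le hw measurableSet_closedBall
    (measurableSet_closedBall (x := (0 : E)) (ε := 3 * ρ)) z fun x hx t ht => ?_).trans ?_
  · rw [mem_closedBall_zero_iff] at *
    calc ‖x + t • z‖ ≤ ‖x‖ + ‖t • z‖ := norm_add_le _ _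
      _ ≤ ρ + 1 * (2 * ρ) := by
          rw [norm_smul, Real.norm_of_nonneg ht.1.le]
          gcongr
          exact ht.2
      _ = 3 * ρ := by ring
  · gcongr

lemma lintegral_lintegral_sq_sub_le {w : E → ℝ} (hw : ContDiff ℝ 1 w) :
    ∫⁻ x, ∫⁻ y, ENNReal.ofReal ((w y - w x) ^ 2) ∂(ballMeasure ρ) ∂(ballMeasure ρ) ≤
      volume (Metric.closedBall (0 : E) (2 * ρ)) * (ENNReal.ofReal ((2 * ρ) ^ 2) *
        ∫⁻ x, ENNReal.ofReal (‖fderiv ℝ w x‖ ^ 2) ∂(ballMeasure (3 * ρ))) := by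
  have hcont : Continuous w := hw.continuous
  have hmeas : Measurable (Function.uncurry fun x z : E =>
      ENNReal.ofReal ((w (x + z) - w x) ^ 2)) :=
    (by fun_prop : Continuous fun p : E × E =>
      (w (p.1 + p.2) - w p.1) ^ 2).measurable.ennreal_ofReal
  calc ∫⁻ x, ∫⁻ y, ENNReal.ofReal ((w y - w x) ^ 2) ∂(ballMeasure ρ) ∂(ballMeasure ρ)
      ≤ ∫⁻ x, ∫⁻ z, ENNReal.ofReal ((w (x + z) - w x) ^ 2)
          ∂(ballMeasure (2 * ρ)) ∂(ballMeasure ρ) :=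
        setLIntegral_mono' measurableSet_closedBall fun x hx =>
          lintegral_ballMeasure_le_translate (fun y => ENNReal.ofReal ((w y - w x) ^ 2))
            (mem_closedBall_zero_iff.1 hx)
    _ = ∫⁻ z, ∫⁻ x, ENNReal.ofReal ((w (x + z) - w x) ^ 2)
          ∂(ballMeasure ρ) ∂(ballMeasure (2 * ρ)) := lintegral_lintegral_swap hmeas.aemeasurable
    _ ≤ ∫⁻ _, ENNReal.ofReal ((2 * ρ) ^ 2) *
          (∫⁻ x, ENNReal.ofReal (‖fderiv ℝ w x‖ ^ 2) ∂(ballMeasure (3 * ρ)))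
          ∂(ballMeasure (2 * ρ)) :=
        setLIntegral_mono measurable_const fun z hz =>
          lintegral_ballMeasure_sq_sub_translate_le hw (mem_closedBall_zero_iff.1 hz)
    _ = volume (Metric.closedBall (0 : E) (2 * ρ)) * (ENNReal.ofReal ((2 * ρ) ^ 2) *
          ∫⁻ x, ENNReal.ofReal (‖fderiv ℝ w x‖ ^ 2) ∂(ballMeasure (3 * ρ))) := by
        rw [setLIntegral_const, mul_comm]

lemma lintegral_ballMeasure_fderiv_sq_le {w ζ : E → ℝ} (hζ : IsTestFunction ζ)
    (hζ1 : ∀ x, ‖x‖ ≤ ρ → ζ x = 1) (hw : ContDiff ℝ ∞ w) :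
    ∫⁻ x, ENNReal.ofReal (‖fderiv ℝ w x‖ ^ 2) ∂(ballMeasure ρ) ≤
      ENNReal.ofReal (∫ x, ζ x ^ 2 * gradInner w w x) := by
  rw [ofReal_integral_eq_lintegral_ofReal (integrable_sq_mul_gradInner hζ hw)
    (Eventually.of_forall fun x => mul_nonneg (sq_nonneg _) (gradInner_self_nonneg _ _))]
  refine (setLIntegral_mono' measurableSet_closedBall fun x hx => ?_).trans
    (setLIntegral_le_lintegral _ _)
  rw [hζ1 x (mem_closedBall_zero_iff.1 hx), one_pow, one_mul, gradInner_self_eq]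

theorem exists_lintegral_sq_shiftedLog_sub_le (hV : IsPotential V) (hn : EnergyNonneg V)
    {f : ℕ → E → ℝ} (hf : ∀ n, IsTestFunction (f n)) (hf0 : ∀ n x, 0 ≤ f n x)
    (hlim : Tendsto (fun n => energyForm V (f n) (f n)) atTop (𝓝 0)) {K : ℝ}
    (hK : ∀ n, dirichletForm (f n) (f n) ≤ K) (hρ : 0 < ρ) :
    ∃ C : ENNReal, C ≠ ⊤ ∧ ∀ ε, 0 < ε → ∀ᶠ n in atTop,
      ∫⁻ x, ∫⁻ y, ENNReal.ofReal ((shiftedLog ε (f n) y - shiftedLog ε (f n) x) ^ 2)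
        ∂(ballMeasure ρ) ∂(ballMeasure ρ) ≤ C := by
  obtain ⟨ζ, hζ, hζ01, hζ1, -⟩ := exists_cutoff (E := E) (r := 3 * ρ) (R := 4 * ρ)
    (by positivity) (by linarith)
  obtain ⟨C, hC⟩ := exists_integral_sq_mul_gradInner_shiftedLog_le hV hn hf hf0 hlim hK hζ
    fun x => abs_le.2 ⟨by linarith [(hζ01 x).1], (hζ01 x).2⟩
  refine ⟨volume (Metric.closedBall (0 : E) (2 * ρ)) * (ENNReal.ofReal ((2 * ρ) ^ 2) *
    ENNReal.ofReal C), ?_, fun ε hε => ?_⟩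
  · exact ENNReal.mul_ne_top measure_closedBall_lt_top.ne
      (ENNReal.mul_ne_top ENNReal.ofReal_ne_top ENNReal.ofReal_ne_top)
  filter_upwards [hC ε hε] with n hn
  have hw := (hf n).contDiff_shiftedLog (hf0 n) hε
  refine (lintegral_lintegral_sq_sub_le (hw.of_le (by simp))).trans ?_
  gcongr
  exact (lintegral_ballMeasure_fderiv_sq_le hζ hζ1 hw).trans (ENNReal.ofReal_le_ofReal hn)

end LogOscillation

section VanishingSet

variable {α : Type*} [MeasurableSpace α] {μ : Measure α}

lemma exists_subseq_tendsto_ae {f : ℕ → α → ℝ} {u : α → ℝ} (hf : ∀ n, MemLp (f n) 2 μ)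
    (hu : MemLp u 2 μ) (hlim : Tendsto (fun n => ∫ x, (f n x - u x) ^ 2 ∂μ) atTop (𝓝 0)) :
    ∃ φ : ℕ → ℕ, StrictMono φ ∧ ∀ᵐ x ∂μ, Tendsto (fun n => f (φ n) x) atTop (𝓝 (u x)) :=
  (tendstoInMeasure_of_tendsto_eLpNorm two_ne_zero (fun n => (hf n).1) hu.1
    ((Lp.tendsto_Lp_iff_tendsto_eLpNorm'' _ hf _ hu).1
      ((tendsto_toLp_iff hf hu).2 hlim))).exists_seq_tendsto_ae

lemma lintegral_lintegral_sq_sub_le_of_tendsto_ae [SFinite μ] {w : ℕ → α → ℝ} {v : α → ℝ}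
    {C : ENNReal} (hw : ∀ n, Measurable (w n))
    (hlim : ∀ᵐ x ∂μ, Tendsto (fun n => w n x) atTop (𝓝 (v x)))
    (hC : ∀ᶠ n in atTop, ∫⁻ x, ∫⁻ y, ENNReal.ofReal ((w n y - w n x) ^ 2) ∂μ ∂μ ≤ C) :
    ∫⁻ x, ∫⁻ y, ENNReal.ofReal ((v y - v x) ^ 2) ∂μ ∂μ ≤ C := by
  set F : ℕ → α → α → ENNReal := fun n x y => ENNReal.ofReal ((w n y - w n x) ^ 2)
  have hF : ∀ n, Measurable (Function.uncurry (F n)) := fun n =>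
    ((((hw n).comp measurable_snd).sub ((hw n).comp measurable_fst)).pow_const 2).ennreal_ofReal
  calc ∫⁻ x, ∫⁻ y, ENNReal.ofReal ((v y - v x) ^ 2) ∂μ ∂μ
      ≤ ∫⁻ x, ∫⁻ y, liminf (fun n => F n x y) atTop ∂μ ∂μ := by
        refine lintegral_mono_ae (hlim.mono fun x hx => lintegral_mono_ae ?_)
        exact hlim.mono fun y hy => (ENNReal.tendsto_ofReal ((hy.sub hx).pow 2)).liminf_eq.ge
    _ ≤ ∫⁻ x, liminf (fun n => ∫⁻ y, F n x y ∂μ) atTop ∂μ :=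
        lintegral_mono fun x => lintegral_liminf_le fun n => (hF n).comp measurable_prodMk_left
    _ ≤ liminf (fun n => ∫⁻ x, ∫⁻ y, F n x y ∂μ ∂μ) atTop :=
        lintegral_liminf_le fun n => (hF n).lintegral_prod_right
    _ ≤ C := liminf_le_of_frequently_le' hC.frequently

lemma mul_measure_mul_measure_le_lintegral {G : α → α → ENNReal} {A B : Set α} {c : ENNReal}
    (hA : NullMeasurableSet A μ) (hB : NullMeasurableSet B μ)
    (h : ∀ x ∈ A, ∀ y ∈ B, c ≤ G x y) : c * (μ A * μ B) ≤ ∫⁻ x, ∫⁻ y, G x y ∂μ ∂μ := by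
  have hinner : ∀ x ∈ A, c * μ B ≤ ∫⁻ y, G x y ∂μ := fun x hx => by
    rw [← setLIntegral_const]
    exact (lintegral_mono_ae ((ae_restrict_iff'₀ hB).2 (Eventually.of_forall (h x hx)))).trans
      (setLIntegral_le_lintegral _ _)
  calc c * (μ A * μ B) = ∫⁻ _ in A, c * μ B ∂μ := by
        rw [setLIntegral_const]
        ring
    _ ≤ ∫⁻ x in A, ∫⁻ y, G x y ∂μ ∂μ :=
        lintegral_mono_ae ((ae_restrict_iff'₀ hA).2 (Eventually.of_forall hinner))
    _ ≤ ∫⁻ x, ∫⁻ y, G x y ∂μ ∂μ := setLIntegral_le_lintegral _ _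

lemma measure_le_eq_zero_of_lintegral_sq_shiftedLog_sub_le {u : α → ℝ} {C : ENNReal} {s : ℝ}
    (hu : AEMeasurable u μ) (hA : μ {x | u x = 0} ≠ 0) (hCtop : C ≠ ⊤)
    (hC : ∀ ε, 0 < ε →
      ∫⁻ x, ∫⁻ y, ENNReal.ofReal ((shiftedLog ε u y - shiftedLog ε u x) ^ 2) ∂μ ∂μ ≤ C)
    (hs : 0 < s) : μ {x | s ≤ u x} = 0 := by
  by_contra hne
  obtain ⟨n, hlt⟩ := ENNReal.exists_nat_mul_gt (mul_ne_zero hA hne) hCtop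
  refine hlt.not_ge (le_trans ?_ (hC (s * Real.exp (-√n)) (by positivity)))
  refine mul_measure_mul_measure_le_lintegral (nullMeasurableSet_eq_fun hu aemeasurable_const)
    (nullMeasurableSet_le aemeasurable_const hu) fun x hx y hy => ?_
  rw [Set.mem_ofPred_eq] at hx hy
  have hgap : √n ≤ shiftedLog (s * Real.exp (-√n)) u y - shiftedLog (s * Real.exp (-√n)) u x := by
    have hlog : Real.log s ≤ Real.log (u y + s * Real.exp (-√n)) :=
      Real.log_le_log hs (hy.trans (le_add_of_nonneg_right (by positivity)))
    rw [shiftedLog, shiftedLog, hx, zero_add, Real.log_mul hs.ne' (Real.exp_pos _).ne',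
      Real.log_exp]
    linarith
  calc (n : ENNReal) = ENNReal.ofReal (√n ^ 2) := by
        rw [Real.sq_sqrt (Nat.cast_nonneg n), ENNReal.ofReal_natCast]
    _ ≤ ENNReal.ofReal ((shiftedLog (s * Real.exp (-√n)) u y -
          shiftedLog (s * Real.exp (-√n)) u x) ^ 2) := by gcongr

lemma ae_eq_zero_of_lintegral_sq_shiftedLog_sub_le {u : α → ℝ} {C : ENNReal}
    (hu : AEMeasurable u μ) (hu0 : ∀ᵐ x ∂μ, 0 ≤ u x) (hA : μ {x | u x = 0} ≠ 0) (hCtop : C ≠ ⊤)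
    (hC : ∀ ε, 0 < ε →
      ∫⁻ x, ∫⁻ y, ENNReal.ofReal ((shiftedLog ε u y - shiftedLog ε u x) ^ 2) ∂μ ∂μ ≤ C) :
    ∀ᵐ x ∂μ, u x = 0 := by
  have hlt : ∀ᵐ x ∂μ, ∀ k : ℕ, u x < 1 / ((k : ℝ) + 1) := by
    refine ae_all_iff.2 fun k => ae_iff.2 ?_
    simpa only [not_lt] using
      measure_le_eq_zero_of_lintegral_sq_shiftedLog_sub_le hu hA hCtop hC (by positivity)
  filter_upwards [hlt, hu0] with x hx hx0
  exact (ge_of_tendsto' tendsto_one_div_add_atTop_nhds_zero_nat fun k => (hx k).le).antisymm hx0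

lemma ae_eq_zero_of_integral_eq_zero {u : α → ℝ} (hu : Integrable u μ)
    (hsign : (∀ᵐ x ∂μ, u x ≤ 0) ∨ ∀ᵐ x ∂μ, 0 ≤ u x) (h0 : ∫ x, u x ∂μ = 0) :
    ∀ᵐ x ∂μ, u x = 0 := by
  rcases hsign with hneg | hpos
  · have hzero := (integral_eq_zero_iff_of_nonneg_ae (hneg.mono fun x => neg_nonneg.2) hu.neg).1
      (by rw [integral_neg, h0, neg_zero])
    exact hzero.mono fun x => neg_eq_zero.1
  · exact (integral_eq_zero_iff_of_nonneg_ae hpos hu).1 h0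

end VanishingSet

section Uniqueness

variable {E : Type*} [NormedAddCommGroup E] [InnerProductSpace ℝ E] [FiniteDimensional ℝ E]
  [MeasurableSpace E] [BorelSpace E] {V : E → ℝ} {ρ : ℝ} {u v : E → ℝ}

theorem ZeroEnergySequence.ae_eq_zero_of_nonneg {f : ℕ → E → ℝ} (h : ZeroEnergySequence V ρ f u)
    (hV : IsPotential V) (hs : SupportedInBall V ρ) (hn : EnergyNonneg V) (hρ : 0 < ρ)
    (hf0 : ∀ n x, 0 ≤ f n x) (hA : ¬ ∀ᵐ x ∂(ballMeasure ρ), u x ≠ 0) :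
    ∀ᵐ x ∂(ballMeasure ρ), u x = 0 := by
  obtain ⟨K, hK⟩ := h.exists_dirichletForm_le hV hs
  obtain ⟨φ, hφ, hae⟩ := exists_subseq_tendsto_ae (fun n => (h.isTestFunction n).memLp_two)
    h.memLp h.tendsto_integral_sq_sub
  obtain ⟨C, hCtop, hC⟩ := exists_lintegral_sq_shiftedLog_sub_le hV hn
    (fun n => h.isTestFunction (φ n)) (fun n => hf0 (φ n))
    (h.tendsto_energyForm.comp hφ.tendsto_atTop) (fun n => hK (φ n)) hρ
  have hu0 : ∀ᵐ x ∂(ballMeasure ρ), 0 ≤ u x :=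
    hae.mono fun x hx => ge_of_tendsto' hx fun n => hf0 _ x
  refine ae_eq_zero_of_lintegral_sq_shiftedLog_sub_le h.memLp.1.aemeasurable hu0
    (by simpa [ae_iff] using hA) hCtop fun ε hε => ?_
  refine lintegral_lintegral_sq_sub_le_of_tendsto_ae (fun n => ?_) ?_ (hC ε hε)
  · exact ((h.isTestFunction _).contDiff_shiftedLog (hf0 _) hε).continuous.measurable
  · filter_upwards [hae, hu0] with x hx hx0
    exact (hx.add_const ε).log (by positivity)

namespace IsZeroEnergyState

lemma memLp (h : IsZeroEnergyState V ρ u) : MemLp u 2 (ballMeasure ρ) :=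
  let ⟨_, hf⟩ := h
  hf.memLp

theorem ae_eq_zero_or_ae_ne_zero (h : IsZeroEnergyState V ρ u) (hV : IsPotential V)
    (hs : SupportedInBall V ρ) (hn : EnergyNonneg V) (hρ : 0 < ρ) :
    (∀ᵐ x ∂(ballMeasure ρ), u x = 0) ∨ ∀ᵐ x ∂(ballMeasure ρ), u x ≠ 0 := by
  obtain ⟨f, hf⟩ := h
  obtain ⟨g, hg, hg0⟩ := hf.exists_abs hV hs hn
  refine or_iff_not_imp_right.2 fun hA => ?_
  simpa using hg.ae_eq_zero_of_nonneg hV hs hn hρ hg0 (by simpa using hA)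

/-- `u + |u|` is again a zero-energy state, so it vanishes almost everywhere or almost nowhere. -/
theorem ae_nonpos_or_ae_nonneg (h : IsZeroEnergyState V ρ u) (hV : IsPotential V)
    (hs : SupportedInBall V ρ) (hn : EnergyNonneg V) (hρ : 0 < ρ) :
    (∀ᵐ x ∂(ballMeasure ρ), u x ≤ 0) ∨ ∀ᵐ x ∂(ballMeasure ρ), 0 ≤ u x := by
  obtain ⟨f, hf⟩ := h
  obtain ⟨g, hg, -⟩ := hf.exists_abs hV hs hn
  have hplus : IsZeroEnergyState V ρ (fun x => 1 * u x + 1 * |u x|) := ⟨_, hf.linComb hV hn hg 1 1⟩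
  rcases hplus.ae_eq_zero_or_ae_ne_zero hV hs hn hρ with hzero | hne
  · exact Or.inl (hzero.mono fun x hx => by linarith [abs_nonneg (u x)])
  · refine Or.inr (hne.mono fun x hx => ?_)
    by_contra! hlt
    exact hx (by rw [abs_of_neg hlt]; ring)

theorem ae_eq_zero_of_integral_eq_zero (h : IsZeroEnergyState V ρ u) (hV : IsPotential V)
    (hs : SupportedInBall V ρ) (hn : EnergyNonneg V) (hρ : 0 < ρ)
    (h0 : ∫ x, u x ∂(ballMeasure ρ) = 0) : ∀ᵐ x ∂(ballMeasure ρ), u x = 0 :=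
  CriticalCoupling.ae_eq_zero_of_integral_eq_zero (h.memLp.integrable one_le_two)
    (h.ae_nonpos_or_ae_nonneg hV hs hn hρ) h0

theorem exists_ae_eq_const_mul (hu : IsZeroEnergyState V ρ u) (hv : IsZeroEnergyState V ρ v)
    (hV : IsPotential V) (hs : SupportedInBall V ρ) (hn : EnergyNonneg V) (hρ : 0 < ρ)
    (hu0 : 0 < ∫ x, u x ^ 2 ∂(ballMeasure ρ)) :
    ∃ c : ℝ, ∀ᵐ x ∂(ballMeasure ρ), v x = c * u x := by
  have hui := hu.memLp.integrable one_le_two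
  have hvi := hv.memLp.integrable one_le_two
  have hint : ∫ x, u x ∂(ballMeasure ρ) ≠ 0 := fun h0 => hu0.ne' <| integral_eq_zero_of_ae <|
    (hu.ae_eq_zero_of_integral_eq_zero hV hs hn hρ h0).mono fun x hx => by simp [hx]
  obtain ⟨f, hf⟩ := hu
  obtain ⟨g, hg⟩ := hv
  set c := (∫ x, v x ∂(ballMeasure ρ)) / ∫ x, u x ∂(ballMeasure ρ)
  have hdiff : IsZeroEnergyState V ρ (fun x => 1 * v x + -c * u x) :=
    ⟨_, hg.linComb hV hn hf 1 (-c)⟩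
  have hzero : ∫ x, (1 * v x + -c * u x) ∂(ballMeasure ρ) = 0 := by
    rw [integral_add (hvi.const_mul 1) (hui.const_mul (-c)), integral_const_mul,
      integral_const_mul, neg_mul, div_mul_cancel₀ _ hint, one_mul, add_neg_cancel]
  exact ⟨c, (hdiff.ae_eq_zero_of_integral_eq_zero hV hs hn hρ hzero).mono fun x hx => by linarith⟩

end IsZeroEnergyState

end Uniqueness

section CoupledFamily

namespace IsPotential

variable {α : Type*} [MeasurableSpace α] {V W : α → ℝ}

lemma const_mul (hV : IsPotential V) (c : ℝ) : IsPotential fun x => c * V x := by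
  obtain ⟨M, hM⟩ := hV.bdd
  refine ⟨hV.measurable.const_mul c, |c| * M, fun x => ?_⟩
  rw [abs_mul]
  gcongr
  exact hM x

lemma add (hV : IsPotential V) (hW : IsPotential W) : IsPotential fun x => V x + W x := by
  obtain ⟨M, hM⟩ := hV.bdd
  obtain ⟨N, hN⟩ := hW.bdd
  exact ⟨hV.measurable.add hW.measurable, M + N, fun x =>
    (abs_add_le _ _).trans (add_le_add (hM x) (hN x))⟩

end IsPotential

/-- The two-parameter family of potentials `V + l X - b Y` in which critical couplings are sought;
`perturbedPotential` is the case `X = χ_R`, `Y = η_R`. -/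
def coupled {α : Type*} (V X Y : α → ℝ) (l b : ℝ) (x : α) : ℝ := V x + l * X x - b * Y x

lemma coupled_zero_zero {α : Type*} {V X Y : α → ℝ} : coupled V X Y 0 0 = V := by
  ext x
  simp [coupled]

/-- The constituents of `coupled V X Y` are potentials supported in the ball of radius `ρ`. -/
structure IsCoupledFamily {E : Type*} [NormedAddCommGroup E] [MeasurableSpace E]
    (V X Y : E → ℝ) (ρ : ℝ) : Prop where
  isPotential : IsPotential V
  isPotential_left : IsPotential X
  isPotential_right : IsPotential Y
  supported : SupportedInBall V ρ
  supported_left : SupportedInBall X ρ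
  supported_right : SupportedInBall Y ρ

namespace IsCoupledFamily

section

variable {E : Type*} [NormedAddCommGroup E] [MeasurableSpace E] {V X Y : E → ℝ} {ρ : ℝ}

lemma isPotential_coupled (h : IsCoupledFamily V X Y ρ) (l b : ℝ) :
    IsPotential (coupled V X Y l b) := by
  have hsum := (h.isPotential.add (h.isPotential_left.const_mul l)).add
    (h.isPotential_right.const_mul (-b))
  refine (congrArg IsPotential (funext fun x => ?_)).mp hsum
  rw [neg_mul, ← sub_eq_add_neg, coupled]

lemma supported_coupled (h : IsCoupledFamily V X Y ρ) (l b : ℝ) :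
    SupportedInBall (coupled V X Y l b) ρ := fun x hx => by
  simp [coupled, h.supported x hx, h.supported_left x hx, h.supported_right x hx]

end

variable {E : Type*} [NormedAddCommGroup E] [InnerProductSpace ℝ E] [FiniteDimensional ℝ E]
  [MeasurableSpace E] [BorelSpace E] {V X Y f u : E → ℝ} {ρ l b l₀ b₀ : ℝ}

lemma energyForm_coupled (h : IsCoupledFamily V X Y ρ) (hf : IsTestFunction f) (l b : ℝ) :
    energyForm (coupled V X Y l b) f f =
      energyForm V f f + l * potentialForm X f f - b * potentialForm Y f f := by
  have hVi := hf.integrable_mul_mul (μ := volume) h.isPotential hf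
  have hXi := (hf.integrable_mul_mul (μ := volume) h.isPotential_left hf).const_mul l
  have hYi := (hf.integrable_mul_mul (μ := volume) h.isPotential_right hf).const_mul b
  have hVXi : Integrable (fun x => V x * (f x * f x) + l * (X x * (f x * f x))) := hVi.add hXi
  have hpot : potentialForm (coupled V X Y l b) f f =
      potentialForm V f f + l * potentialForm X f f - b * potentialForm Y f f := by
    simp only [potentialForm]
    rw [← integral_const_mul, ← integral_const_mul, ← integral_add hVi hXi,
      ← integral_sub hVXi hYi]
    exact integral_congr_ae (Eventually.of_forall fun x => by simp only [coupled]; ring)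
  rw [energyForm, hpot, energyForm]
  ring

lemma energyForm_coupled_eq_add (h : IsCoupledFamily V X Y ρ) (hf : IsTestFunction f)
    (l b l₀ b₀ : ℝ) :
    energyForm (coupled V X Y l b) f f = energyForm (coupled V X Y l₀ b₀) f f +
      (l - l₀) * potentialForm X f f - (b - b₀) * potentialForm Y f f := by
  rw [h.energyForm_coupled hf, h.energyForm_coupled hf]
  ring

/-- A zero-energy state at `(l₀, b₀)` provides a supporting line of the set of all `(l, b)` whose
form is nonnegative. -/
theorem sub_mul_integral_le (h : IsCoupledFamily V X Y ρ)
    (hu : IsZeroEnergyState (coupled V X Y l₀ b₀) ρ u) (hn : EnergyNonneg (coupled V X Y l b)) :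
    (b - b₀) * ∫ x, Y x * u x ^ 2 ∂(ballMeasure ρ) ≤
      (l - l₀) * ∫ x, X x * u x ^ 2 ∂(ballMeasure ρ) := by
  obtain ⟨f, hf⟩ := hu
  have hlim := (hf.tendsto_energyForm.add ((hf.tendsto_potentialForm h.isPotential_left
    h.supported_left).const_mul (l - l₀))).sub ((hf.tendsto_potentialForm h.isPotential_right
    h.supported_right).const_mul (b - b₀))
  rw [zero_add] at hlim
  refine sub_nonneg.1 (ge_of_tendsto' hlim fun n => ?_)
  rw [← h.energyForm_coupled_eq_add (hf.isTestFunction n)]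
  exact hn _ (hf.isTestFunction n)

/-- Normalised functions of negative energy at parameters tending to `(l₀, b₀)` are almost
minimisers at `(l₀, b₀)`. -/
theorem exists_zeroEnergySequence_of_tendsto (h : IsCoupledFamily V X Y ρ) (hd : 2 < finrank ℝ E)
    (hn : EnergyNonneg (coupled V X Y l₀ b₀)) {l b : ℕ → ℝ} (hl : Tendsto l atTop (𝓝 l₀))
    (hb : Tendsto b atTop (𝓝 b₀)) (hnot : ∀ n, ¬ EnergyNonneg (coupled V X Y (l n) (b n))) :
    ∃ (φ : ℕ → ℕ) (f : ℕ → E → ℝ) (u : E → ℝ),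
      ZeroEnergySequence (coupled V X Y l₀ b₀) ρ f u ∧ 0 < ∫ x, u x ^ 2 ∂(ballMeasure ρ) ∧
      ∀ n, energyForm (coupled V X Y (l (φ n)) (b (φ n))) (f n) (f n) < 0 := by
  have hW := h.isPotential_coupled
  have hWs := h.supported_coupled
  choose f hf hf1 hneg using fun n =>
    exists_dirichletForm_eq_one_energyForm_neg hd (hW _ _) (hWs _ _) (hnot n)
  obtain ⟨C, -, hC⟩ := exists_abs_potentialForm_self_le hd h.isPotential_left h.supported_left
  obtain ⟨D, -, hD⟩ := exists_abs_potentialForm_self_le hd h.isPotential_right h.supported_right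
  have herr : Tendsto (fun n => |l n - l₀| * C + |b n - b₀| * D) atTop (𝓝 0) := by
    simpa using ((hl.sub_const l₀).abs.mul_const C).add ((hb.sub_const b₀).abs.mul_const D)
  have hlim : Tendsto (fun n => energyForm (coupled V X Y l₀ b₀) (f n) (f n)) atTop (𝓝 0) := by
    refine squeeze_zero (fun n => hn _ (hf n)) (fun n => ?_) herr
    have hXle : |(l n - l₀) * potentialForm X (f n) (f n)| ≤ |l n - l₀| * C := by
      rw [abs_mul]
      gcongr
      simpa only [hf1, mul_one] using hC _ (hf n)
    have hYle : |(b n - b₀) * potentialForm Y (f n) (f n)| ≤ |b n - b₀| * D := by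
      rw [abs_mul]
      gcongr
      simpa only [hf1, mul_one] using hD _ (hf n)
    have hshift := h.energyForm_coupled_eq_add (hf n) (l n) (b n) l₀ b₀
    linarith [hneg n, neg_le_of_abs_le hXle, le_of_abs_le hYle]
  obtain ⟨φ, -, u, hu, hu1⟩ := exists_zeroEnergySequence hd (hW _ _) (hWs _ _) hf hf1 hlim
  exact ⟨φ, _, u, hu, integral_sq_pos_of_integral_mul_sq_ne hu.memLp (by rw [hu1]; norm_num),
    fun n => hneg _⟩

end IsCoupledFamily

end CoupledFamily

section CriticalityCriterion

variable {E : Type*} [NormedAddCommGroup E] [InnerProductSpace ℝ E] [FiniteDimensional ℝ E]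
  [MeasurableSpace E] [BorelSpace E] {ρ : ℝ}

theorem EnergyNonneg.exists_isZeroEnergyState_iff {V : E → ℝ} (hn : EnergyNonneg V)
    (hd : 2 < finrank ℝ E) (hV : IsPotential V) (hs : SupportedInBall V ρ) :
    (∃ u, IsZeroEnergyState V ρ u ∧ 0 < ∫ x, u x ^ 2 ∂(ballMeasure ρ)) ↔
      ∀ ε : ℝ, 0 < ε → ¬ EnergyNonneg fun x => (1 + ε) * V x := by
  have hfam : IsCoupledFamily V V V ρ := ⟨hV, hV, hV, hs, hs, hs⟩
  have hzero : coupled V V V 0 0 = V := by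
    ext x
    simp [coupled]
  have hscale : ∀ ε : ℝ, (fun x => (1 + ε) * V x) = coupled V V V ε 0 := fun ε => by
    ext x
    simp only [coupled]
    ring
  simp only [hscale]
  constructor
  · rintro ⟨u, hu, hu0⟩ ε hε hcon
    have hle := hfam.sub_mul_integral_le (l₀ := 0) (b₀ := 0) (by rwa [hzero]) hcon
    obtain ⟨f, hf⟩ := hu
    have hneg := hf.integral_mul_sq_neg hd hV hs hu0
    rw [sub_self, zero_mul, sub_zero] at hle
    exact hle.not_gt (mul_neg_of_pos_of_neg hε hneg)
  · intro h
    obtain ⟨-, f, u, hf, hu0, -⟩ := hfam.exists_zeroEnergySequence_of_tendsto hd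
      (l₀ := 0) (b₀ := 0) (by rwa [hzero]) tendsto_one_div_add_atTop_nhds_zero_nat
      tendsto_const_nhds fun n => h _ (by positivity)
    rw [hzero] at hf
    exact ⟨u, ⟨f, hf⟩, hu0⟩

lemma two_lt_finrank_E3 : 2 < finrank ℝ E3 := by
  rw [finrank_euclideanSpace_fin]
  norm_num

theorem atCriticalCoupling_iff {V : E3 → ℝ} (hV : IsPotential V) (hs : SupportedInBall V ρ) :
    AtCriticalCoupling V ↔
      EnergyNonneg V ∧ ∃ u, IsZeroEnergyState V ρ u ∧ 0 < ∫ x, u x ^ 2 ∂(ballMeasure ρ) := by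
  have hmul : ∀ ε : ℝ, IsPotential fun x => (1 + ε) * V x := fun ε => hV.const_mul _
  simp only [AtCriticalCoupling, schrodingerNonneg_iff_energyNonneg hV,
    schrodingerNonneg_iff_energyNonneg (hmul _)]
  exact and_congr_right fun hn => (hn.exists_isZeroEnergyState_iff two_lt_finrank_E3 hV hs).symm

end CriticalityCriterion

section CriticalStrength

variable {E : Type*} [NormedAddCommGroup E] [InnerProductSpace ℝ E] [FiniteDimensional ℝ E]
  [MeasurableSpace E] [BorelSpace E] {V X Y u v : E → ℝ} {ρ l b l₀ b₀ κ : ℝ}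

/-- The largest `b` for which `-Δ + V + l X - b Y` is nonnegative (with the junk value `0` if there
is no such `b`, or no largest one). -/
def criticalStrength (V X Y : E → ℝ) (l : ℝ) : ℝ := sSup {b | EnergyNonneg (coupled V X Y l b)}

namespace IsZeroEnergyState

theorem integral_mul_sq_pos (hu : IsZeroEnergyState V ρ u) (hV : IsPotential V)
    (hs : SupportedInBall V ρ) (hn : EnergyNonneg V) (hρ : 0 < ρ)
    (hu0 : 0 < ∫ x, u x ^ 2 ∂(ballMeasure ρ)) (hY : IsPotential Y) (hY0 : ∀ x, 0 ≤ Y x)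
    (hY1 : 0 < ∫ x, Y x ∂(ballMeasure ρ)) : 0 < ∫ x, Y x * u x ^ 2 ∂(ballMeasure ρ) := by
  have hnn : ∀ x, 0 ≤ Y x * u x ^ 2 := fun x => mul_nonneg (hY0 x) (sq_nonneg _)
  refine (integral_nonneg hnn).lt_of_ne fun h0 => hY1.ne' (integral_eq_zero_of_ae ?_)
  have hint : Integrable (fun x => Y x * u x ^ 2) (ballMeasure ρ) :=
    hu.memLp.integrable_sq.bdd_mul hY.measurable.aestronglyMeasurable
      (Eventually.of_forall hY.bdd.choose_spec)
  have hne : ∀ᵐ x ∂(ballMeasure ρ), u x ≠ 0 :=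
    (hu.ae_eq_zero_or_ae_ne_zero hV hs hn hρ).resolve_left fun hzero => hu0.ne' <|
      integral_eq_zero_of_ae <| hzero.mono fun x hx => by simp [hx]
  filter_upwards [(integral_eq_zero_iff_of_nonneg hnn hint).1 h0.symm, hne] with x hx hux
  exact (mul_eq_zero.1 hx).resolve_right (pow_ne_zero 2 hux)

theorem exists_integral_mul_sq_eq (hu : IsZeroEnergyState V ρ u) (hv : IsZeroEnergyState V ρ v)
    (hV : IsPotential V) (hs : SupportedInBall V ρ) (hn : EnergyNonneg V) (hρ : 0 < ρ)
    (hu0 : 0 < ∫ x, u x ^ 2 ∂(ballMeasure ρ)) :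
    ∃ c : ℝ, ∀ T : E → ℝ, ∫ x, T x * v x ^ 2 ∂(ballMeasure ρ) =
      c * ∫ x, T x * u x ^ 2 ∂(ballMeasure ρ) := by
  obtain ⟨c, hc⟩ := hu.exists_ae_eq_const_mul hv hV hs hn hρ hu0
  refine ⟨c ^ 2, fun T => ?_⟩
  rw [← integral_const_mul]
  exact integral_congr_ae <| hc.mono fun x hx => by simp only [hx]; ring

end IsZeroEnergyState

namespace IsCoupledFamily

lemma bddAbove_setOf_energyNonneg (h : IsCoupledFamily V X Y ρ)
    (hY1 : 0 < ∫ x, Y x ∂(ballMeasure ρ)) (l : ℝ) :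
    BddAbove {b | EnergyNonneg (coupled V X Y l b)} := by
  obtain ⟨ζ, hζ, -, hζ1, -⟩ := exists_cutoff (E := E) (r := max ρ 1) (R := max ρ 1 + 1)
    (lt_max_of_lt_right one_pos) (lt_add_one _)
  have hpot : potentialForm Y ζ ζ = ∫ x, Y x ∂(ballMeasure ρ) := by
    rw [h.supported_right.potentialForm_self]
    refine setIntegral_congr_fun measurableSet_closedBall fun x hx => ?_
    rw [hζ1 x ((mem_closedBall_zero_iff.1 hx).trans (le_max_left _ _)), one_pow, mul_one]
  refine ⟨(energyForm V ζ ζ + l * potentialForm X ζ ζ) / ∫ x, Y x ∂(ballMeasure ρ),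
    fun b hb => ?_⟩
  have hnn := hb _ hζ
  rw [h.energyForm_coupled hζ, hpot] at hnn
  rw [le_div_iff₀ hY1]
  linarith

lemma isClosed_setOf_energyNonneg (h : IsCoupledFamily V X Y ρ) (l : ℝ) :
    IsClosed {b | EnergyNonneg (coupled V X Y l b)} := by
  have heq : {b | EnergyNonneg (coupled V X Y l b)} = ⋂ (f : E → ℝ) (_ : IsTestFunction f),
      {b | 0 ≤ energyForm V f f + l * potentialForm X f f - b * potentialForm Y f f} := by
    ext b
    simp only [Set.mem_ofPred_eq, Set.mem_iInter]
    exact forall₂_congr fun f hf => by rw [h.energyForm_coupled hf]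
  rw [heq]
  exact isClosed_iInter fun f => isClosed_iInter fun _ =>
    isClosed_le continuous_const (by fun_prop)

lemma energyNonneg_criticalStrength (h : IsCoupledFamily V X Y ρ)
    (hY1 : 0 < ∫ x, Y x ∂(ballMeasure ρ)) (hb : EnergyNonneg (coupled V X Y l b)) :
    EnergyNonneg (coupled V X Y l (criticalStrength V X Y l)) :=
  (h.isClosed_setOf_energyNonneg l).csSup_mem ⟨b, hb⟩ (h.bddAbove_setOf_energyNonneg hY1 l)

lemma le_criticalStrength (h : IsCoupledFamily V X Y ρ) (hY1 : 0 < ∫ x, Y x ∂(ballMeasure ρ))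
    (hb : EnergyNonneg (coupled V X Y l b)) : b ≤ criticalStrength V X Y l :=
  le_csSup (h.bddAbove_setOf_energyNonneg hY1 l) hb

theorem exists_isZeroEnergyState_criticalStrength (h : IsCoupledFamily V X Y ρ)
    (hd : 2 < finrank ℝ E) (hY1 : 0 < ∫ x, Y x ∂(ballMeasure ρ))
    (hb : EnergyNonneg (coupled V X Y l b)) :
    ∃ u, IsZeroEnergyState (coupled V X Y l (criticalStrength V X Y l)) ρ u ∧
      0 < ∫ x, u x ^ 2 ∂(ballMeasure ρ) := by
  have hlim : Tendsto (fun n : ℕ => criticalStrength V X Y l + 1 / ((n : ℝ) + 1)) atTop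
      (𝓝 (criticalStrength V X Y l)) := by
    simpa using tendsto_one_div_add_atTop_nhds_zero_nat.const_add (criticalStrength V X Y l)
  obtain ⟨-, f, u, hf, hu0, -⟩ := h.exists_zeroEnergySequence_of_tendsto hd
    (h.energyNonneg_criticalStrength hY1 hb) tendsto_const_nhds hlim fun n hcon =>
      (h.le_criticalStrength hY1 hcon).not_gt (lt_add_of_pos_right _ (by positivity))
  exact ⟨u, ⟨f, hf⟩, hu0⟩

theorem eq_criticalStrength (h : IsCoupledFamily V X Y ρ) (hρ : 0 < ρ) (hY0 : ∀ x, 0 ≤ Y x)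
    (hY1 : 0 < ∫ x, Y x ∂(ballMeasure ρ)) (hn : EnergyNonneg (coupled V X Y l b))
    (hu : IsZeroEnergyState (coupled V X Y l b) ρ u) (hu0 : 0 < ∫ x, u x ^ 2 ∂(ballMeasure ρ)) :
    b = criticalStrength V X Y l := by
  have hpos := hu.integral_mul_sq_pos (h.isPotential_coupled l b) (h.supported_coupled l b) hn hρ
    hu0 h.isPotential_right hY0 hY1
  have hle := h.sub_mul_integral_le hu (h.energyNonneg_criticalStrength hY1 hn)
  rw [sub_self, zero_mul] at hle
  exact (h.le_criticalStrength hY1 hn).antisymm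
    (sub_nonpos.1 (nonpos_of_mul_nonpos_left hle hpos))

lemma energyNonneg_coupled_zero (h : IsCoupledFamily V X Y ρ) (hX0 : ∀ x, 0 ≤ X x)
    (hn : EnergyNonneg V) (hl : 0 ≤ l) : EnergyNonneg (coupled V X Y l 0) := fun f hf => by
  rw [h.energyForm_coupled hf, zero_mul, sub_zero]
  exact add_nonneg (hn f hf) (mul_nonneg hl (potentialForm_self_nonneg hX0 f))

/-- If the form were negative at `b₀ + r (l n - l₀) - κ |l n - l₀|` with `l n → l₀`, the limiting
zero-energy state `v` at `(l₀, b₀)` would satisfy `κ ∫ Y v² ≤ |∫ X v² - r ∫ Y v²|`; but `v` is a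
multiple of `u`, and the right side vanishes for `u`. -/
theorem eventually_energyNonneg_coupled (h : IsCoupledFamily V X Y ρ) (hd : 2 < finrank ℝ E)
    (hρ : 0 < ρ) (hY0 : ∀ x, 0 ≤ Y x) (hY1 : 0 < ∫ x, Y x ∂(ballMeasure ρ))
    (hn : EnergyNonneg (coupled V X Y l₀ b₀)) (hu : IsZeroEnergyState (coupled V X Y l₀ b₀) ρ u)
    (hu0 : 0 < ∫ x, u x ^ 2 ∂(ballMeasure ρ)) {r : ℝ}
    (hr : ∫ x, X x * u x ^ 2 ∂(ballMeasure ρ) = r * ∫ x, Y x * u x ^ 2 ∂(ballMeasure ρ))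
    (hκ : 0 < κ) :
    ∀ᶠ l in 𝓝 l₀, EnergyNonneg (coupled V X Y l (b₀ + r * (l - l₀) - κ * |l - l₀|)) := by
  by_contra hcon
  obtain ⟨l, hl, hnot⟩ := exists_seq_forall_of_frequently (not_eventually.1 hcon)
  have hl0 : Tendsto (fun n => l n - l₀) atTop (𝓝 0) := by simpa using hl.sub_const l₀
  have hb : Tendsto (fun n => b₀ + r * (l n - l₀) - κ * |l n - l₀|) atTop (𝓝 b₀) := by
    simpa using ((hl0.const_mul r).const_add b₀).sub (hl0.abs.const_mul κ)
  obtain ⟨φ, f, v, hf, hv0, hneg⟩ := h.exists_zeroEnergySequence_of_tendsto hd hn hl hb hnot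
  have hW := h.isPotential_coupled l₀ b₀
  have hWs := h.supported_coupled l₀ b₀
  have hpos := IsZeroEnergyState.integral_mul_sq_pos ⟨f, hf⟩ hW hWs hn hρ hv0 h.isPotential_right
    hY0 hY1
  have hXlim := hf.tendsto_potentialForm h.isPotential_left h.supported_left
  have hYlim := hf.tendsto_potentialForm h.isPotential_right h.supported_right
  have hle : κ * ∫ x, Y x * v x ^ 2 ∂(ballMeasure ρ) ≤
      |∫ x, X x * v x ^ 2 ∂(ballMeasure ρ) - r * ∫ x, Y x * v x ^ 2 ∂(ballMeasure ρ)| := by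
    refine le_of_tendsto_of_tendsto' (hYlim.const_mul κ) (hXlim.sub (hYlim.const_mul r)).abs
      fun n => ?_
    have hlt := hneg n
    rw [h.energyForm_coupled_eq_add (hf.isTestFunction n) _ _ l₀ b₀] at hlt
    by_contra! hgap
    have habs := neg_abs_le ((l (φ n) - l₀) *
      (potentialForm X (f n) (f n) - r * potentialForm Y (f n) (f n)))
    rw [abs_mul] at habs
    linarith [hn _ (hf.isTestFunction n),
      mul_le_mul_of_nonneg_left hgap.le (abs_nonneg (l (φ n) - l₀))]
  obtain ⟨c, hc⟩ := hu.exists_integral_mul_sq_eq ⟨f, hf⟩ hW hWs hn hρ hu0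
  rw [hc X, hr, mul_left_comm, ← hc Y, sub_self, abs_zero] at hle
  exact hle.not_gt (mul_pos hκ hpos)

theorem hasDerivAt_criticalStrength (h : IsCoupledFamily V X Y ρ) (hd : 2 < finrank ℝ E)
    (hρ : 0 < ρ) (hY0 : ∀ x, 0 ≤ Y x) (hY1 : 0 < ∫ x, Y x ∂(ballMeasure ρ))
    (hn : EnergyNonneg (coupled V X Y l₀ b₀)) (hu : IsZeroEnergyState (coupled V X Y l₀ b₀) ρ u)
    (hu0 : 0 < ∫ x, u x ^ 2 ∂(ballMeasure ρ)) :
    HasDerivAt (criticalStrength V X Y) ((∫ x, X x * u x ^ 2 ∂(ballMeasure ρ)) /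
      ∫ x, Y x * u x ^ 2 ∂(ballMeasure ρ)) l₀ := by
  have hpos := hu.integral_mul_sq_pos (h.isPotential_coupled l₀ b₀) (h.supported_coupled l₀ b₀) hn
    hρ hu0 h.isPotential_right hY0 hY1
  obtain rfl := h.eq_criticalStrength hρ hY0 hY1 hn hu hu0
  set r := (∫ x, X x * u x ^ 2 ∂(ballMeasure ρ)) / ∫ x, Y x * u x ^ 2 ∂(ballMeasure ρ)
  have hr : ∫ x, X x * u x ^ 2 ∂(ballMeasure ρ) = r * ∫ x, Y x * u x ^ 2 ∂(ballMeasure ρ) :=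
    (div_mul_cancel₀ _ hpos.ne').symm
  rw [hasDerivAt_iff_isLittleO, Asymptotics.isLittleO_iff]
  intro κ hκ
  filter_upwards [h.eventually_energyNonneg_coupled hd hρ hY0 hY1 hn hu hu0 hr hκ] with l hl
  have hlower := h.le_criticalStrength hY1 hl
  have hupper := h.sub_mul_integral_le hu (h.energyNonneg_criticalStrength hY1 hl)
  rw [hr, ← mul_assoc, mul_le_mul_iff_left₀ hpos] at hupper
  rw [Real.norm_eq_abs, Real.norm_eq_abs, smul_eq_mul, abs_le]
  constructor
  · linarith
  · linarith [mul_nonneg hκ.le (abs_nonneg (l - l₀))]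

theorem differentiableAt_criticalStrength (h : IsCoupledFamily V X Y ρ) (hd : 2 < finrank ℝ E)
    (hρ : 0 < ρ) (hY0 : ∀ x, 0 ≤ Y x) (hY1 : 0 < ∫ x, Y x ∂(ballMeasure ρ))
    (hb : EnergyNonneg (coupled V X Y l b)) : DifferentiableAt ℝ (criticalStrength V X Y) l := by
  obtain ⟨u, hu, hu0⟩ := h.exists_isZeroEnergyState_criticalStrength hd hY1 hb
  exact (h.hasDerivAt_criticalStrength hd hρ hY0 hY1 (h.energyNonneg_criticalStrength hY1 hb)
    hu hu0).differentiableAt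

theorem exists_forall_energyNonneg (h : IsCoupledFamily V X Y ρ) (hd : 2 < finrank ℝ E)
    (hρ : 0 < ρ) (hX0 : ∀ x, 0 ≤ X x) (hY0 : ∀ x, 0 ≤ Y x)
    (hY1 : 0 < ∫ x, Y x ∂(ballMeasure ρ)) (hn : EnergyNonneg V) (hu : IsZeroEnergyState V ρ u)
    (hu0 : 0 < ∫ x, u x ^ 2 ∂(ballMeasure ρ)) :
    ∃ δ : ℝ, 0 < δ ∧ ∀ l, -δ < l → ∃ b, EnergyNonneg (coupled V X Y l b) := by
  have hzero : coupled V X Y 0 0 = V := coupled_zero_zero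
  have hpos := hu.integral_mul_sq_pos h.isPotential h.supported hn hρ hu0 h.isPotential_right
    hY0 hY1
  obtain ⟨δ, hδ, hball⟩ := Metric.eventually_nhds_iff.1 <| h.eventually_energyNonneg_coupled hd hρ
    hY0 hY1 (l₀ := 0) (b₀ := 0) (by rwa [hzero]) (by rwa [hzero]) hu0
    (div_mul_cancel₀ _ hpos.ne').symm one_pos
  refine ⟨δ, hδ, fun l hl => ?_⟩
  rcases le_or_gt 0 l with hl0 | hl0
  · exact ⟨0, h.energyNonneg_coupled_zero hX0 hn hl0⟩
  · refine ⟨_, hball ?_⟩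
    rw [dist_zero_right, Real.norm_eq_abs, abs_of_neg hl0]
    linarith

end IsCoupledFamily

end CriticalStrength

section PerturbedPotential

variable {V₀ : E3 → ℝ} {R ρ l : ℝ}

lemma measurableSet_annulus (R : ℝ) : MeasurableSet {r : E3 | R < ‖r‖ ∧ ‖r‖ ≤ 2 * R} :=
  (measurableSet_lt measurable_const measurable_norm).inter
    (measurableSet_le measurable_norm measurable_const)

lemma isPotential_indicator_one {α : Type*} [MeasurableSpace α] {s : Set α}
    (hs : MeasurableSet s) : IsPotential (s.indicator fun _ => 1) := by
  refine ⟨measurable_const.indicator hs, 1, fun x => ?_⟩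
  by_cases hx : x ∈ s <;> simp [hx]

lemma isPotential_chiR (R : ℝ) : IsPotential (chiR R) :=
  isPotential_indicator_one (measurableSet_le measurable_norm measurable_const)

lemma isPotential_etaR (R : ℝ) : IsPotential (etaR R) :=
  isPotential_indicator_one (measurableSet_annulus R)

lemma chiR_nonneg (R : ℝ) (x : E3) : 0 ≤ chiR R x :=
  Set.indicator_nonneg (fun _ _ => zero_le_one) x

lemma etaR_nonneg (R : ℝ) (x : E3) : 0 ≤ etaR R x :=
  Set.indicator_nonneg (fun _ _ => zero_le_one) x

lemma supportedInBall_chiR (hρ : R ≤ ρ) : SupportedInBall (chiR R) ρ := fun _ hx =>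
  Set.indicator_of_notMem (s := {r : E3 | ‖r‖ ≤ R}) (hρ.trans_lt hx).not_ge _

lemma supportedInBall_etaR (hρ : 2 * R ≤ ρ) : SupportedInBall (etaR R) ρ := fun _ hx =>
  Set.indicator_of_notMem (s := {r : E3 | R < ‖r‖ ∧ ‖r‖ ≤ 2 * R})
    (fun h => (hρ.trans_lt hx).not_ge h.2) _

lemma isCoupledFamily_chiR_etaR (hV : IsPotential V₀) (hs : SupportedInBall V₀ ρ) (hR : 0 < R)
    (hρ : 2 * R ≤ ρ) : IsCoupledFamily V₀ (chiR R) (etaR R) ρ :=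
  ⟨hV, isPotential_chiR R, isPotential_etaR R, hs, supportedInBall_chiR (by linarith),
    supportedInBall_etaR hρ⟩

lemma integral_etaR_pos (hR : 0 < R) (hρ : 2 * R ≤ ρ) :
    0 < ∫ x, etaR R x ∂(ballMeasure ρ) := by
  set U : Set E3 := {x | R < ‖x‖ ∧ ‖x‖ < 2 * R}
  have hUo : IsOpen U := (isOpen_lt continuous_const continuous_norm).inter
    (isOpen_lt continuous_norm continuous_const)
  have hUne : U.Nonempty := by
    obtain ⟨x, hx⟩ := exists_norm_eq E3 (by positivity : 0 ≤ 3 / 2 * R)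
    exact ⟨x, by rw [hx]; linarith, by rw [hx]; linarith⟩
  have hsub : U ⊆ {x | R < ‖x‖ ∧ ‖x‖ ≤ 2 * R} ∩ Metric.closedBall 0 ρ := fun x hx =>
    ⟨⟨hx.1, hx.2.le⟩, mem_closedBall_zero_iff.2 (hx.2.le.trans hρ)⟩
  change 0 < ∫ x, Set.indicator _ (1 : E3 → ℝ) x ∂_
  rw [integral_indicator_one (measurableSet_annulus R), measureReal_restrict_apply
    (measurableSet_annulus R)]
  exact ENNReal.toReal_pos ((hUo.measure_pos volume hUne).trans_le (measure_mono hsub)).ne'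
    (measure_ne_top_of_subset Set.inter_subset_right measure_closedBall_lt_top.ne)

theorem atCriticalCoupling_perturbedPotential_iff (hV : IsPotential V₀)
    (hs : SupportedInBall V₀ ρ) (hR : 0 < R) (hρ : 2 * R ≤ ρ)
    (hadm : ∃ b, EnergyNonneg (coupled V₀ (chiR R) (etaR R) l b)) (b : ℝ) :
    AtCriticalCoupling (perturbedPotential V₀ R l b) ↔
      b = criticalStrength V₀ (chiR R) (etaR R) l := by
  have h := isCoupledFamily_chiR_etaR hV hs hR hρ
  have hη := integral_etaR_pos hR hρ
  obtain ⟨b₀, hb₀⟩ := hadm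
  change AtCriticalCoupling (coupled V₀ (chiR R) (etaR R) l b) ↔ _
  rw [atCriticalCoupling_iff (h.isPotential_coupled l b) (h.supported_coupled l b)]
  constructor
  · rintro ⟨hn, u, hu, hu0⟩
    exact h.eq_criticalStrength (by linarith) (etaR_nonneg R) hη hn hu hu0
  · rintro rfl
    exact ⟨h.energyNonneg_criticalStrength hη hb₀,
      h.exists_isZeroEnergyState_criticalStrength two_lt_finrank_E3 hη hb₀⟩

end PerturbedPotential

section Truncation

/-- A bounded truncation, used together with `rootTrunc` as a test function: it satisfies
`boundedTrunc' = 3 * rootTrunc' ^ 2`. -/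
def boundedTrunc (t : ℝ) : ℝ := 1 - (1 + t) ^ (-(1 / 3) : ℝ)

/-- The truncation whose Dirichlet integral is controlled by the potential alone; its sixth power,
the power of the Sobolev inequality in dimension three, grows like `t ^ 2`. -/
def rootTrunc (t : ℝ) : ℝ := (1 + t) ^ (1 / 3 : ℝ) - 1

lemma hasDerivAt_one_add_rpow {t : ℝ} (ht : 0 ≤ t) (p : ℝ) :
    HasDerivAt (fun s : ℝ => (1 + s) ^ p) (p * (1 + t) ^ (p - 1)) t := by
  simpa using ((hasDerivAt_id t).const_add 1).rpow_const (p := p) (Or.inl (by positivity))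

lemma hasDerivAt_boundedTrunc {t : ℝ} (ht : 0 ≤ t) :
    HasDerivAt boundedTrunc (1 / 3 * (1 + t) ^ (-(4 / 3) : ℝ)) t := by
  have hcoeff : 1 / 3 * (1 + t) ^ (-(4 / 3) : ℝ) = -(-(1 / 3) * (1 + t) ^ (-(1 / 3) - 1 : ℝ)) := by
    norm_num
  rw [hcoeff]
  exact (hasDerivAt_one_add_rpow ht _).const_sub 1

lemma hasDerivAt_rootTrunc {t : ℝ} (ht : 0 ≤ t) :
    HasDerivAt rootTrunc (1 / 3 * (1 + t) ^ (-(2 / 3) : ℝ)) t := by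
  have hexp : (-(2 / 3) : ℝ) = 1 / 3 - 1 := by norm_num
  rw [hexp]
  exact (hasDerivAt_one_add_rpow ht _).sub_const 1

lemma boundedTrunc_le_one {t : ℝ} (ht : 0 ≤ t) : boundedTrunc t ≤ 1 :=
  sub_le_self 1 (by positivity)

lemma rootTrunc_nonneg {t : ℝ} (ht : 0 ≤ t) : 0 ≤ rootTrunc t :=
  sub_nonneg.2 (Real.one_le_rpow (by linarith) (by norm_num))

lemma sq_le_rootTrunc {t : ℝ} (ht : 0 ≤ t) : t ^ 2 ≤ 32 * (1 + rootTrunc t ^ 6) := by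
  have hcube : (1 + rootTrunc t) ^ 3 = 1 + t := by
    rw [rootTrunc, add_sub_cancel, ← Real.rpow_natCast, ← Real.rpow_mul (by positivity)]
    norm_num
  calc t ^ 2 ≤ (1 + t) ^ 2 := by gcongr; linarith
    _ = (1 + rootTrunc t) ^ 6 := by rw [← hcube]; ring
    _ ≤ 2 ^ (6 - 1) * (1 ^ 6 + rootTrunc t ^ 6) := add_pow_le zero_le_one (rootTrunc_nonneg ht) 6
    _ = 32 * (1 + rootTrunc t ^ 6) := by norm_num

namespace IsTestFunction

section

variable {E : Type*} [NormedAddCommGroup E] [NormedSpace ℝ E] {f : E → ℝ}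

lemma one_add_rpow_sub_one (hf : IsTestFunction f) (hf0 : ∀ x, 0 ≤ f x) (p : ℝ) :
    IsTestFunction (fun x => (1 + f x) ^ p - 1) where
  contDiff := ((contDiff_const.add hf.contDiff).rpow_const_of_ne
    (fun x => (add_pos_of_pos_of_nonneg one_pos (hf0 x)).ne')).sub contDiff_const
  hasCompactSupport := hf.hasCompactSupport.comp_left (g := fun t : ℝ => (1 + t) ^ p - 1) (by simp)

lemma rootTrunc (hf : IsTestFunction f) (hf0 : ∀ x, 0 ≤ f x) :
    IsTestFunction (fun x => rootTrunc (f x)) := hf.one_add_rpow_sub_one hf0 _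

lemma boundedTrunc (hf : IsTestFunction f) (hf0 : ∀ x, 0 ≤ f x) :
    IsTestFunction (fun x => boundedTrunc (f x)) := by
  convert (hf.one_add_rpow_sub_one hf0 (-(1 / 3))).const_mul (-1) using 2 with x
  rw [CriticalCoupling.boundedTrunc]
  ring

end

variable {E : Type*} [NormedAddCommGroup E] [InnerProductSpace ℝ E] [FiniteDimensional ℝ E]
  [MeasurableSpace E] [BorelSpace E] {V f : E → ℝ}

lemma dirichletForm_boundedTrunc (hf : IsTestFunction f) (hf0 : ∀ x, 0 ≤ f x) :
    dirichletForm f (fun x => CriticalCoupling.boundedTrunc (f x)) =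
      3 * dirichletForm (fun x => CriticalCoupling.rootTrunc (f x))
        (fun x => CriticalCoupling.rootTrunc (f x)) := by
  rw [dirichletForm, dirichletForm, ← integral_const_mul]
  refine integral_congr_ae (Eventually.of_forall fun x => ?_)
  have hsq : ((1 + f x) ^ (-(2 / 3) : ℝ)) ^ 2 = (1 + f x) ^ (-(4 / 3) : ℝ) := by
    rw [← Real.rpow_natCast, ← Real.rpow_mul (by linarith [hf0 x])]
    norm_num
  simp only
  rw [gradInner_scomp_right (hf.differentiable x) (hasDerivAt_boundedTrunc (hf0 x)),
    gradInner_scomp_self (hf.differentiable x) (hasDerivAt_rootTrunc (hf0 x)), mul_pow, hsq]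
  ring

lemma energyForm_boundedTrunc_self_le (hf : IsTestFunction f) (hf0 : ∀ x, 0 ≤ f x)
    (hneg : ∀ x, V x ≤ 0) :
    energyForm V (fun x => CriticalCoupling.boundedTrunc (f x))
      (fun x => CriticalCoupling.boundedTrunc (f x)) ≤ dirichletForm f f := by
  have hle := dirichletForm_scomp_le (L := 1) hf (fun x => hasDerivAt_boundedTrunc (hf0 x))
    fun x => by
      have hpow : (1 + f x) ^ (-(4 / 3) : ℝ) ≤ 1 :=
        Real.rpow_le_one_of_one_le_of_nonpos (by linarith [hf0 x]) (by norm_num)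
      have hpow0 : 0 ≤ (1 + f x) ^ (-(4 / 3) : ℝ) := Real.rpow_nonneg (by linarith [hf0 x]) _
      exact pow_le_one₀ (by positivity) (by linarith)
  rw [one_mul] at hle
  exact (add_le_of_nonpos_right (potentialForm_self_nonpos hneg _)).trans hle

lemma integrable_mul (hf : IsTestFunction f) (hV : IsPotential V) :
    Integrable fun x => V x * f x :=
  memLp_one_iff_integrable.1 (hV.memLp_mul (memLp_one_iff_integrable.2 hf.integrable))

lemma integral_mul_le_potentialForm_boundedTrunc (hf : IsTestFunction f) (hf0 : ∀ x, 0 ≤ f x)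
    (hV : IsPotential V) (hneg : ∀ x, V x ≤ 0) :
    ∫ x, V x * f x ≤ potentialForm V f (fun x => CriticalCoupling.boundedTrunc (f x)) := by
  refine integral_mono (hf.integrable_mul hV) (hf.integrable_mul_mul hV (hf.boundedTrunc hf0))
    fun x => ?_
  exact mul_le_mul_of_nonpos_left (mul_le_of_le_one_right (hf0 x) (boundedTrunc_le_one (hf0 x)))
    (hneg x)

theorem dirichletForm_rootTrunc_le (hf : IsTestFunction f) (hf0 : ∀ x, 0 ≤ f x)
    (hV : IsPotential V) (hneg : ∀ x, V x ≤ 0) :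
    3 * dirichletForm (fun x => CriticalCoupling.rootTrunc (f x))
        (fun x => CriticalCoupling.rootTrunc (f x)) ≤
      energyForm V f (fun x => CriticalCoupling.boundedTrunc (f x)) - ∫ x, V x * f x := by
  rw [← hf.dirichletForm_boundedTrunc hf0, energyForm]
  linarith [hf.integral_mul_le_potentialForm_boundedTrunc hf0 hV hneg]

lemma potentialForm_self_le_rootTrunc {W : E → ℝ} (hf : IsTestFunction f) (hf0 : ∀ x, 0 ≤ f x)
    (hW : IsPotential W) (hWi : Integrable W) (hW0 : ∀ x, 0 ≤ W x) (hW1 : ∀ x, W x ≤ 1) :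
    potentialForm W f f ≤
      32 * ((∫ x, W x) + ∫ x, CriticalCoupling.rootTrunc (f x) ^ 6) := by
  have hroot : Integrable fun x => CriticalCoupling.rootTrunc (f x) ^ 6 :=
    ((hf.rootTrunc hf0).pow (by norm_num)).integrable
  rw [← integral_add hWi hroot, ← integral_const_mul]
  refine integral_mono (hf.integrable_mul_mul hW hf) ((hWi.add hroot).const_mul 32) fun x => ?_
  calc W x * (f x * f x) ≤ W x * (32 * (1 + CriticalCoupling.rootTrunc (f x) ^ 6)) := by
        rw [← sq]
        exact mul_le_mul_of_nonneg_left (sq_le_rootTrunc (hf0 x)) (hW0 x)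
    _ = 32 * (W x + W x * CriticalCoupling.rootTrunc (f x) ^ 6) := by ring
    _ ≤ 32 * (W x + CriticalCoupling.rootTrunc (f x) ^ 6) := by
        gcongr
        exact mul_le_of_le_one_left (by positivity) (hW1 x)

end IsTestFunction

end Truncation

section LinearGrowth

variable {E : Type*} [NormedAddCommGroup E] [InnerProductSpace ℝ E] [FiniteDimensional ℝ E]
  [MeasurableSpace E] [BorelSpace E]

theorem exists_integral_pow_six_le (hd : finrank ℝ E = 3) :
    ∃ S : ℝ, 0 ≤ S ∧ ∀ f : E → ℝ, IsTestFunction f → ∫ x, f x ^ 6 ≤ S * dirichletForm f f ^ 3 := by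
  refine ⟨(eLpNormLESNormFDerivOfEqInnerConst (volume : Measure E) 2 : ℝ) ^ 6, by positivity,
    fun f hf => ?_⟩
  have hsob := eLpNorm_le_eLpNorm_fderiv_of_eq_inner (volume : Measure E)
    (hf.contDiff.of_le (by simp)) hf.hasCompactSupport (p := 2) (p' := 6) (by norm_num)
    (by lia) (by rw [hd]; norm_num)
  have hmem : MemLp f 6 volume := hf.continuous.memLp_of_hasCompactSupport hf.hasCompactSupport
  have hpow : ∀ x, ‖f x‖ ^ (6 : ℝ) = f x ^ 6 := fun x => by
    rw [Real.norm_eq_abs, ← Even.pow_abs (n := 6) (by decide)]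
    norm_cast
  have hdir := dirichletForm_self_nonneg f
  simp only [ENNReal.coe_ofNat] at hsob
  rw [hf.eLpNorm_fderiv, hmem.eLpNorm_eq_integral_rpow_norm (by norm_num) (by norm_num),
    ENNReal.coe_nnreal_eq, ← ENNReal.ofReal_mul (NNReal.coe_nonneg _),
    ENNReal.ofReal_le_ofReal_iff (by positivity), ENNReal.toReal_ofNat,
    Real.rpow_inv_le_iff_of_pos (by positivity) (by positivity) (by norm_num)] at hsob
  simp only [hpow] at hsob
  refine hsob.trans_eq ?_
  have hsqrt : √(dirichletForm f f) ^ 6 = dirichletForm f f ^ 3 := by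
    rw [pow_mul _ 2 3, Real.sq_sqrt hdir]
  rw [← hsqrt, ← mul_pow]
  norm_cast

variable {V W : E → ℝ} {ρ : ℝ} {f : ℕ → E → ℝ} {u : E → ℝ}

namespace ZeroEnergySequence

lemma const_mul (h : ZeroEnergySequence V ρ f u) (hV : IsPotential V) (hn : EnergyNonneg V)
    (c : ℝ) : ZeroEnergySequence V ρ (fun n x => c * f n x) (fun x => c * u x) := by
  simpa only [zero_mul, add_zero] using h.linComb hV hn h c 0

lemma tendsto_integral_potential_mul (h : ZeroEnergySequence V ρ f u) (hW : IsPotential W)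
    (hs : SupportedInBall W ρ) :
    Tendsto (fun n => ∫ x, W x * f n x) atTop (𝓝 (∫ x, W x * u x ∂(ballMeasure ρ))) := by
  simp only [hs.integral_mul_eq]
  have hWm : MemLp W 2 (ballMeasure ρ) := by simpa using hW.memLp_mul (memLp_const 1)
  exact tendsto_integral_mul (fun _ => hWm) (fun n => (h.isTestFunction n).memLp_two) hWm h.memLp
    (by simp) h.tendsto_integral_sq_sub

lemma tendsto_energyForm_boundedTrunc (h : ZeroEnergySequence V ρ f u) (hV : IsPotential V)
    (hs : SupportedInBall V ρ) (hn : EnergyNonneg V) (hneg : ∀ x, V x ≤ 0)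
    (hf0 : ∀ n x, 0 ≤ f n x) :
    Tendsto (fun n => energyForm V (f n) (fun x => boundedTrunc (f n x))) atTop (𝓝 0) := by
  obtain ⟨K, hK⟩ := h.exists_dirichletForm_le hV hs
  exact hn.tendsto_energyForm_zero hV h.isTestFunction
    (fun n => (h.isTestFunction n).boundedTrunc (hf0 n)) h.tendsto_energyForm
    fun n => ((h.isTestFunction n).energyForm_boundedTrunc_self_le (hf0 n) hneg).trans (hK n)

end ZeroEnergySequence

theorem exists_integral_mul_sq_le (hd : finrank ℝ E = 3) :
    ∃ S : ℝ, 0 ≤ S ∧ ∀ {V W : E → ℝ} {ρ : ℝ} {f : ℕ → E → ℝ} {u : E → ℝ}, IsPotential V →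
      SupportedInBall V ρ → (∀ x, V x ≤ 0) → EnergyNonneg V → ZeroEnergySequence V ρ f u →
      (∀ n x, 0 ≤ f n x) → IsPotential W → SupportedInBall W ρ → Integrable W → (∀ x, 0 ≤ W x) →
      (∀ x, W x ≤ 1) →
      ∫ x, W x * u x ^ 2 ∂(ballMeasure ρ) ≤
        32 * ((∫ x, W x) + S * (-∫ x, V x * u x ∂(ballMeasure ρ)) ^ 3) := by
  obtain ⟨S, hS0, hS⟩ := exists_integral_pow_six_le hd
  refine ⟨S / 27, by positivity, ?_⟩
  intro V W ρ f u hV hsV hneg hn h hf0 hW hsW hWi hW0 hW1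
  have hlim : Tendsto (fun n => energyForm V (f n) (fun x => boundedTrunc (f n x)) -
      ∫ x, V x * f n x) atTop (𝓝 (-∫ x, V x * u x ∂(ballMeasure ρ))) := by
    simpa only [zero_sub] using (h.tendsto_energyForm_boundedTrunc hV hsV hn hneg hf0).sub
      (h.tendsto_integral_potential_mul hV hsV)
  refine le_of_tendsto_of_tendsto' (h.tendsto_potentialForm hW hsW)
    (((hlim.pow 3).const_mul (S / 27)).const_add (∫ x, W x) |>.const_mul 32) fun n => ?_
  have hf := h.isTestFunction n
  have hD := hf.dirichletForm_rootTrunc_le (hf0 n) hV hneg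
  refine (hf.potentialForm_self_le_rootTrunc (hf0 n) hW hWi hW0 hW1).trans ?_
  gcongr
  calc ∫ x, rootTrunc (f n x) ^ 6 ≤ S * dirichletForm (fun x => rootTrunc (f n x))
          (fun x => rootTrunc (f n x)) ^ 3 := hS _ (hf.rootTrunc (hf0 n))
    _ = S / 27 * (3 * dirichletForm (fun x => rootTrunc (f n x))
          (fun x => rootTrunc (f n x))) ^ 3 := by ring
    _ ≤ _ := by
        gcongr
        exact mul_nonneg zero_le_three (dirichletForm_self_nonneg _)

end LinearGrowth

section Laplacian

variable {E : Type*} [NormedAddCommGroup E] [InnerProductSpace ℝ E] [FiniteDimensional ℝ E]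
  {f g : E → ℝ}

lemma laplacian_eq_sum_fderiv (hf : ContDiff ℝ 2 f) (x : E) :
    Δ f x = ∑ i, fderiv ℝ (fun y => fderiv ℝ f y (stdOrthonormalBasis ℝ E i)) x
      (stdOrthonormalBasis ℝ E i) := by
  rw [InnerProductSpace.laplacian_eq_iteratedFDeriv_stdOrthonormalBasis]
  refine Finset.sum_congr rfl fun i _ => ?_
  have hdiff : DifferentiableAt ℝ (fderiv ℝ f) x :=
    (hf.fderiv_right (m := 1) (by norm_num)).differentiable one_ne_zero x
  rw [iteratedFDeriv_two_apply, fderiv_clm_apply hdiff (differentiableAt_const _)]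
  simp

lemma laplacian_comp_const_smul (hf : ContDiff ℝ 2 f) (c : ℝ) (x : E) :
    Δ (fun y => f (c • y)) x = c ^ 2 * Δ f (c • x) := by
  simp only [InnerProductSpace.laplacian_eq_iteratedFDeriv_stdOrthonormalBasis,
    iteratedFDeriv_comp_const_smul c (i := 2) hf, smul_apply, smul_eq_mul, Finset.mul_sum]

lemma laplacian_eq_zero_of_eqOn {U : Set E} (hU : IsOpen U) {c : ℝ} (hf : ∀ x ∈ U, f x = c) :
    ∀ x ∈ U, Δ f x = 0 := fun x hx => by
  have hev : f =ᶠ[𝓝 x] fun _ => c := by filter_upwards [hU.mem_nhds hx] with y hy using hf y hy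
  rw [(InnerProductSpace.laplacian_congr_nhds hev).eq_of_nhds,
    InnerProductSpace.laplacian_const, Pi.zero_apply]

namespace IsTestFunction

lemma laplacian (hf : IsTestFunction f) : IsTestFunction (Δ f) where
  contDiff := by
    simp only [funext (laplacian_eq_sum_fderiv hf.contDiff_two)]
    exact ContDiff.sum fun i _ => ((hf.fderiv_apply _).fderiv_apply _).contDiff
  hasCompactSupport := HasCompactSupport.intro hf.hasCompactSupport
    (laplacian_eq_zero_of_eqOn (isClosed_tsupport f).isOpen_compl
      fun _ hx => image_eq_zero_of_notMem_tsupport hx)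

variable [MeasurableSpace E] [BorelSpace E] {W : E → ℝ}

theorem dirichletForm_eq_neg_integral_mul_laplacian (hf : IsTestFunction f)
    (hg : IsTestFunction g) : dirichletForm f g = -∫ x, f x * Δ g x := by
  set b := stdOrthonormalBasis ℝ E
  have hparts : ∀ i, ∫ x, fderiv ℝ f x (b i) * fderiv ℝ g x (b i) =
      -∫ x, f x * fderiv ℝ (fun y => fderiv ℝ g y (b i)) x (b i) := fun i => by
    rw [integral_mul_fderiv_eq_neg_fderiv_mul_of_integrable
      ((hf.fderiv_apply _).mul_contDiff (hg.fderiv_apply _).contDiff).integrable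
      (hf.mul_contDiff ((hg.fderiv_apply _).fderiv_apply _).contDiff).integrable
      (hf.mul_contDiff (hg.fderiv_apply _).contDiff).integrable
      (fun x _ => hf.differentiable x) (fun x _ => (hg.fderiv_apply _).differentiable x), neg_neg]
  simp only [dirichletForm, gradInner_eq_sum b,
    laplacian_eq_sum_fderiv hg.contDiff_two, Finset.mul_sum]
  rw [integral_finsetSum _ fun i _ =>
      ((hf.fderiv_apply _).mul_contDiff (hg.fderiv_apply _).contDiff).integrable,
    integral_finsetSum _ fun i _ =>
      (hf.mul_contDiff ((hg.fderiv_apply _).fderiv_apply _).contDiff).integrable]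
  simp only [hparts, Finset.sum_neg_distrib, b]

lemma sq_dirichletForm_le (hf : IsTestFunction f) (hg : IsTestFunction g) (hW : IsPotential W)
    (hW0 : ∀ x, 0 ≤ W x) (hWg : ∀ x, Δ g x ≠ 0 → W x = 1) :
    dirichletForm f g ^ 2 ≤ potentialForm W f f * ∫ x, Δ g x ^ 2 := by
  set s := {x | Δ g x ≠ 0}
  have hs : MeasurableSet s :=
    (isOpen_ne_fun hg.laplacian.continuous continuous_const).measurableSet
  have hsupp : ∀ x, x ∉ s → Δ g x = 0 := fun x hx => not_not.1 hx
  have hpot : ∫ x in s, f x ^ 2 ≤ potentialForm W f f := by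
    calc ∫ x in s, f x ^ 2 = ∫ x in s, W x * (f x * f x) :=
          setIntegral_congr_fun hs fun x hx => by rw [hWg x hx, one_mul, sq]
      _ ≤ potentialForm W f f := setIntegral_le_integral (hf.integrable_mul_mul hW hf)
          (Eventually.of_forall fun x => mul_nonneg (hW0 x) (mul_self_nonneg _))
  calc dirichletForm f g ^ 2 = (∫ x in s, f x * Δ g x) ^ 2 := by
        rw [hf.dirichletForm_eq_neg_integral_mul_laplacian hg, neg_sq,
          setIntegral_eq_integral_of_forall_compl_eq_zero fun x hx => by rw [hsupp x hx, mul_zero]]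
    _ ≤ (∫ x in s, f x ^ 2) * ∫ x in s, Δ g x ^ 2 :=
        sq_integral_mul_le hf.memLp_two hg.laplacian.memLp_two
    _ = (∫ x in s, f x ^ 2) * ∫ x, Δ g x ^ 2 := by
        rw [setIntegral_eq_integral_of_forall_compl_eq_zero (f := fun x => Δ g x ^ 2)
          fun x hx => by simp only [hsupp x hx]; norm_num]
    _ ≤ potentialForm W f f * ∫ x, Δ g x ^ 2 :=
        mul_le_mul_of_nonneg_right hpot (integral_nonneg fun _ => sq_nonneg _)

end IsTestFunction

end Laplacian

section AnnulusBound

variable {E : Type*} [NormedAddCommGroup E] [InnerProductSpace ℝ E] [FiniteDimensional ℝ E]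

lemma exists_laplacian_ne_zero_imp_mem_annulus :
    ∃ ζ : E → ℝ, IsTestFunction ζ ∧ (∀ x, ‖x‖ ≤ 1 → ζ x = 1) ∧
      ∀ x, Δ ζ x ≠ 0 → 1 < ‖x‖ ∧ ‖x‖ ≤ 2 := by
  obtain ⟨ζ, hζ, -, hζ1, hζ0⟩ := exists_cutoff (E := E) (r := 5 / 4) (R := 7 / 4) (by norm_num)
    (by norm_num)
  refine ⟨ζ, hζ, fun x hx => hζ1 x (by linarith), fun x hx => ⟨?_, ?_⟩⟩
  · by_contra! h
    exact hx (laplacian_eq_zero_of_eqOn (U := {y : E | ‖y‖ < 5 / 4})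
      (isOpen_lt continuous_norm continuous_const) (fun y hy => hζ1 y (le_of_lt hy)) x
      (show ‖x‖ < 5 / 4 by linarith))
  · by_contra! h
    exact hx (laplacian_eq_zero_of_eqOn (U := {y : E | 7 / 4 < ‖y‖})
      (isOpen_lt continuous_const continuous_norm) (fun y hy => hζ0 y (le_of_lt hy)) x
      (show 7 / 4 < ‖x‖ by linarith))

variable [MeasurableSpace E] [BorelSpace E]

lemma integral_sq_laplacian_comp_inv_smul {g : E → ℝ} (hg : ContDiff ℝ 2 g)
    (hd : finrank ℝ E = 3) {R : ℝ} (hR : 0 < R) :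
    R * ∫ x, Δ (fun y => g (R⁻¹ • y)) x ^ 2 = ∫ x, Δ g x ^ 2 := by
  simp only [laplacian_comp_const_smul hg, mul_pow, integral_const_mul]
  rw [Measure.integral_comp_smul volume (fun x => Δ g x ^ 2), hd, abs_of_pos (by positivity),
    smul_eq_mul]
  field_simp

theorem exists_cutoff_annulus (hd : finrank ℝ E = 3) :
    ∃ A : ℝ, 0 ≤ A ∧ ∀ R : ℝ, 0 < R → ∃ φ : E → ℝ, IsTestFunction φ ∧ (∀ x, ‖x‖ ≤ R → φ x = 1) ∧
      (∀ x, Δ φ x ≠ 0 → R < ‖x‖ ∧ ‖x‖ ≤ 2 * R) ∧ R * ∫ x, Δ φ x ^ 2 = A := by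
  obtain ⟨ζ, hζ, hζ1, hζΔ⟩ := exists_laplacian_ne_zero_imp_mem_annulus (E := E)
  refine ⟨∫ x, Δ ζ x ^ 2, integral_nonneg fun _ => sq_nonneg _, fun R hR =>
    ⟨fun x => ζ (R⁻¹ • x), hζ.comp_const_smul (by positivity), fun x hx => hζ1 _ ?_,
      fun x hx => ?_, integral_sq_laplacian_comp_inv_smul hζ.contDiff_two hd hR⟩⟩
  · rwa [norm_smul, norm_inv, Real.norm_of_nonneg hR.le, inv_mul_le_one₀ hR]
  · rw [laplacian_comp_const_smul hζ.contDiff_two] at hx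
    have h := hζΔ _ (right_ne_zero_of_mul hx)
    rwa [norm_smul, norm_inv, Real.norm_of_nonneg hR.le, lt_inv_mul_iff₀ hR, inv_mul_le_iff₀ hR,
      mul_one, mul_comm R] at h

theorem ZeroEnergySequence.sq_integral_potential_mul_le {V W : E → ℝ} {ρ R : ℝ} {f : ℕ → E → ℝ}
    {u φ : E → ℝ} (h : ZeroEnergySequence V ρ f u) (hV : IsPotential V) (hs : SupportedInBall V ρ)
    (hn : EnergyNonneg V) (hsR : SupportedInBall V R) (hφ : IsTestFunction φ)
    (hφ1 : ∀ x, ‖x‖ ≤ R → φ x = 1) (hW : IsPotential W) (hsW : SupportedInBall W ρ)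
    (hW0 : ∀ x, 0 ≤ W x) (hWφ : ∀ x, Δ φ x ≠ 0 → W x = 1) :
    (∫ x, V x * u x ∂(ballMeasure ρ)) ^ 2 ≤
      (∫ x, W x * u x ^ 2 ∂(ballMeasure ρ)) * ∫ x, Δ φ x ^ 2 := by
  have hpot : ∀ n, potentialForm V (f n) φ = ∫ x, V x * f n x := fun n => by
    refine integral_congr_ae (Eventually.of_forall fun x => ?_)
    rcases le_or_gt ‖x‖ R with hx | hx
    · simp only [hφ1 x hx, mul_one]
    · simp only [hsR x hx, zero_mul]
  have hlim : Tendsto (fun n => dirichletForm (f n) φ) atTop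
      (𝓝 (-∫ x, V x * u x ∂(ballMeasure ρ))) := by
    simpa [energyForm, hpot] using (hn.tendsto_energyForm_zero hV h.isTestFunction (fun _ => hφ)
      h.tendsto_energyForm fun _ => le_rfl).sub (h.tendsto_integral_potential_mul hV hs)
  rw [← neg_sq]
  exact le_of_tendsto_of_tendsto' (hlim.pow 2) ((h.tendsto_potentialForm hW hsW).mul_const _)
    fun n => (h.isTestFunction n).sq_dirichletForm_le hφ hW hW0 hWφ

end AnnulusBound

section DerivativeBound

lemma integral_mul_abs_neg {α : Type*} [MeasurableSpace α] {μ : Measure α} [IsFiniteMeasure μ]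
    {V u : α → ℝ} (hV : IsPotential V) (hneg : ∀ x, V x ≤ 0) (hu : MemLp u 2 μ)
    (h : ∫ x, V x * u x ^ 2 ∂μ < 0) : ∫ x, V x * |u x| ∂μ < 0 := by
  have hle : ∀ x, V x * |u x| ≤ 0 := fun x => mul_nonpos_of_nonpos_of_nonneg (hneg x) (abs_nonneg _)
  refine (integral_nonpos hle).lt_of_ne fun h0 => h.ne ?_
  have hint : Integrable (fun x => V x * |u x|) μ := (hV.memLp_mul hu.abs).integrable one_le_two
  have hae := (integral_eq_zero_iff_of_nonneg (fun x => neg_nonneg.2 (hle x)) hint.neg).1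
    (by rw [integral_neg, h0, neg_zero])
  refine integral_eq_zero_of_ae ?_
  filter_upwards [hae] with x hx
  rw [← sq_abs, sq, ← mul_assoc, neg_eq_zero.1 hx, zero_mul, Pi.zero_apply]

lemma chiR_le_one (R : ℝ) (x : E3) : chiR R x ≤ 1 :=
  Set.indicator_apply_le' (fun _ => le_rfl) fun _ => zero_le_one

lemma setOf_norm_le_eq_closedBall (R : ℝ) : {r : E3 | ‖r‖ ≤ R} = Metric.closedBall 0 R := by
  ext x
  exact mem_closedBall_zero_iff.symm

lemma integrable_chiR (R : ℝ) : Integrable (chiR R) := by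
  rw [chiR, setOf_norm_le_eq_closedBall]
  exact (integrable_indicator_iff measurableSet_closedBall).2
    (integrableOn_const measure_closedBall_lt_top.ne)

lemma integral_chiR {R : ℝ} (hR : 0 ≤ R) :
    ∫ x, chiR R x = R ^ 3 * volume.real (Metric.closedBall (0 : E3) 1) := by
  rw [chiR, setOf_norm_le_eq_closedBall]
  change ∫ x, Set.indicator _ (1 : E3 → ℝ) x = _
  rw [integral_indicator_one measurableSet_closedBall, Measure.addHaar_real_closedBall' _ _ hR,
    finrank_euclideanSpace_fin]

theorem exists_integral_chiR_mul_sq_le :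
    ∃ C : ℝ, 0 ≤ C ∧ ∀ {V : E3 → ℝ} {R ρ : ℝ} {f : ℕ → E3 → ℝ} {u : E3 → ℝ}, IsPotential V →
      SupportedInBall V ρ → (∀ x, V x ≤ 0) → EnergyNonneg V → ZeroEnergySequence V ρ f u →
      (∀ n x, 0 ≤ f n x) → ∫ x, V x * u x ∂(ballMeasure ρ) < 0 → 0 < R → R ≤ ρ →
      ∫ x, chiR R x * u x ^ 2 ∂(ballMeasure ρ) ≤
        C * (R * (∫ x, V x * u x ∂(ballMeasure ρ)) ^ 2) := by
  obtain ⟨S, hS0, hS⟩ := exists_integral_mul_sq_le (E := E3) finrank_euclideanSpace_fin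
  refine ⟨32 * (volume.real (Metric.closedBall (0 : E3) 1) + S), by positivity, ?_⟩
  intro V R ρ f u hV hs hneg hn h hf0 hG hR hρ
  set G := -∫ x, V x * u x ∂(ballMeasure ρ)
  have hGpos : 0 < G := neg_pos.2 hG
  -- Scaling `u` by `R / G` balances the two terms of the bound, both becoming of order `R ^ 3`.
  have hscaled := hS hV hs hneg hn (h.const_mul hV hn (R / G))
    (fun n x => mul_nonneg (by positivity) (hf0 n x)) (isPotential_chiR R) (supportedInBall_chiR hρ)
    (integrable_chiR R) (chiR_nonneg R) (chiR_le_one R)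
  have hV' : -∫ x, V x * (R / G * u x) ∂(ballMeasure ρ) = R := by
    simp only [mul_left_comm _ (R / G), integral_const_mul, ← mul_neg]
    exact div_mul_cancel₀ R hGpos.ne'
  simp only [hV', mul_pow, mul_left_comm _ ((R / G) ^ 2), integral_const_mul, integral_chiR hR.le]
    at hscaled
  rw [div_pow, div_mul_eq_mul_div, div_le_iff₀ (by positivity)] at hscaled
  rw [← neg_sq, ← mul_le_mul_iff_right₀ (show 0 < R ^ 2 by positivity)]
  linarith

theorem exists_mul_sq_le_integral_etaR :
    ∃ C : ℝ, 0 ≤ C ∧ ∀ {V : E3 → ℝ} {R ρ : ℝ} {u : E3 → ℝ}, IsPotential V →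
      SupportedInBall V R → EnergyNonneg V → IsZeroEnergyState V ρ u → 0 < R → 2 * R ≤ ρ →
      R * (∫ x, V x * u x ∂(ballMeasure ρ)) ^ 2 ≤
        C * ∫ x, etaR R x * u x ^ 2 ∂(ballMeasure ρ) := by
  obtain ⟨A, hA0, hA⟩ := exists_cutoff_annulus (E := E3) finrank_euclideanSpace_fin
  refine ⟨A, hA0, ?_⟩
  rintro V R ρ u hV hs hn ⟨f, h⟩ hR hρ
  obtain ⟨φ, hφ, hφ1, hφΔ, hA⟩ := hA R hR
  have hle := h.sq_integral_potential_mul_le hV (hs.mono (by linarith)) hn hs hφ hφ1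
    (isPotential_etaR R) (supportedInBall_etaR hρ) (etaR_nonneg R)
    fun x hx => Set.indicator_of_mem (s := {r : E3 | R < ‖r‖ ∧ ‖r‖ ≤ 2 * R}) (hφΔ x hx) _
  rw [← hA]
  linarith [mul_le_mul_of_nonneg_left hle hR.le]

theorem exists_integral_chiR_le_integral_etaR :
    ∃ C : ℝ, ∀ {V : E3 → ℝ} {R ρ : ℝ} {u : E3 → ℝ}, IsPotential V →
      SupportedInBall V R → (∀ x, V x ≤ 0) → EnergyNonneg V → IsZeroEnergyState V ρ u →
      0 < ∫ x, u x ^ 2 ∂(ballMeasure ρ) → 0 < R → 2 * R ≤ ρ →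
      ∫ x, chiR R x * u x ^ 2 ∂(ballMeasure ρ) ≤
        C * ∫ x, etaR R x * u x ^ 2 ∂(ballMeasure ρ) := by
  obtain ⟨C₁, hC₁, hupper⟩ := exists_integral_chiR_mul_sq_le
  obtain ⟨C₂, -, hlower⟩ := exists_mul_sq_le_integral_etaR
  refine ⟨C₁ * C₂, ?_⟩
  rintro V R ρ u hV hs hneg hn ⟨f, h⟩ hu0 hR hρ
  have hsρ := hs.mono (show R ≤ ρ by linarith)
  obtain ⟨g, hg, hg0⟩ := h.exists_abs hV hsρ hn
  have hG := integral_mul_abs_neg hV hneg h.memLp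
    (h.integral_mul_sq_neg two_lt_finrank_E3 hV hsρ hu0)
  simp only [← sq_abs (u _), mul_assoc]
  exact (hupper hV hsρ hneg hn hg hg0 hG hR (by linarith)).trans
    (mul_le_mul_of_nonneg_left (hlower hV hs hn ⟨g, hg⟩ hR hρ) hC₁)

theorem exists_abs_deriv_criticalStrength_le {V : E3 → ℝ} {r : ℝ} (hV : IsPotential V)
    (hneg : ∀ x, V x ≤ 0) (hs : SupportedInBall V r) (hc : AtCriticalCoupling V) :
    ∃ C R₀ : ℝ, ∀ R, R₀ ≤ R → |deriv (criticalStrength V (chiR R) (etaR R)) 0| ≤ C := by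
  obtain ⟨C, hC⟩ := exists_integral_chiR_le_integral_etaR
  refine ⟨C, max r 1, fun R hrR => ?_⟩
  have hR : 0 < R := one_pos.trans_le ((le_max_right r 1).trans hrR)
  have hsR := hs.mono ((le_max_left r 1).trans hrR)
  have hs2 := hsR.mono (show R ≤ 2 * R by linarith)
  obtain ⟨hn, u, hu, hu0⟩ := (atCriticalCoupling_iff hV hs2).1 hc
  have hfam := isCoupledFamily_chiR_etaR hV hs2 hR le_rfl
  have hη := integral_etaR_pos hR le_rfl
  have hzero : coupled V (chiR R) (etaR R) 0 0 = V := coupled_zero_zero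
  have hderiv := hfam.hasDerivAt_criticalStrength two_lt_finrank_E3 (by linarith) (etaR_nonneg R) hη
    (hzero.symm ▸ hn) (hzero.symm ▸ hu) hu0
  have hpos := hu.integral_mul_sq_pos hV hs2 hn (by linarith) hu0 (isPotential_etaR R)
    (etaR_nonneg R) hη
  rw [hderiv.deriv, abs_of_nonneg (div_nonneg (integral_nonneg fun x =>
    mul_nonneg (chiR_nonneg R x) (sq_nonneg _)) hpos.le), div_le_iff₀ hpos]
  exact hC hV hsR hneg hn hu hu0 hR le_rfl

end DerivativeBound

end CriticalCoupling

open CriticalCoupling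

theorem proposition1 (V₀ : E3 → ℝ) (hmeas : Measurable V₀)
    (hbdd : ∃ M : ℝ, ∀ r, |V₀ r| ≤ M)
    (hneg : ∀ r, V₀ r ≤ 0)
    (hrange : ∃ rV : ℝ, ∀ r, rV ≤ ‖r‖ → V₀ r = 0)
    (hcrit : AtCriticalCoupling V₀) :
    ∃ B : ℝ → ℝ → ℝ,
      (∀ R : ℝ, 0 < R →
        (∀ l : ℝ, 0 ≤ l → 0 ≤ B R l) ∧
        ∃ δ : ℝ, 0 < δ ∧
          (∀ l : ℝ, -δ < l → ∀ b : ℝ,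
            AtCriticalCoupling (perturbedPotential V₀ R l b) ↔ b = B R l) ∧
          (∀ l : ℝ, -δ < l → l < δ → DifferentiableAt ℝ (B R) l)) ∧
      ∃ C R₀ : ℝ, ∀ R : ℝ, R₀ ≤ R → |deriv (B R) 0| ≤ C := by
  have hV : IsPotential V₀ := ⟨hmeas, hbdd⟩
  obtain ⟨rV, hrV⟩ := hrange
  have hs : SupportedInBall V₀ rV := fun x hx => hrV x hx.le
  refine ⟨fun R => criticalStrength V₀ (chiR R) (etaR R), fun R hR => ?_,
    exists_abs_deriv_criticalStrength_le hV hneg hs hcrit⟩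
  set ρ := max rV (2 * R)
  have hρ : 2 * R ≤ ρ := le_max_right _ _
  have hρ0 : 0 < ρ := by linarith
  have hsρ : SupportedInBall V₀ ρ := hs.mono (le_max_left _ _)
  have hfam := isCoupledFamily_chiR_etaR hV hsρ hR hρ
  have hη := integral_etaR_pos hR hρ
  obtain ⟨hn, u, hu, hu0⟩ := (atCriticalCoupling_iff hV hsρ).1 hcrit
  obtain ⟨δ, hδ, hadm⟩ := hfam.exists_forall_energyNonneg two_lt_finrank_E3 hρ0 (chiR_nonneg R)
    (etaR_nonneg R) hη hn hu hu0
  refine ⟨fun l hl => hfam.le_criticalStrength hη (hfam.energyNonneg_coupled_zero (chiR_nonneg R)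
      hn hl), δ, hδ,
    fun l hl => atCriticalCoupling_perturbedPotential_iff hV hsρ hR hρ (hadm l hl),
    fun l hl _ => ?_⟩
  obtain ⟨b, hb⟩ := hadm l hl
  exact hfam.differentiableAt_criticalStrength two_lt_finrank_E3 hρ0 (etaR_nonneg R) hη hb

end
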